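/- Fix an integer $k\ge 1$. **Multiple nested boxes with $k$ piles** is the following problem. Given $n\ge 1$ boxes in dimension $d$, where box $i$ has size $(b_{i,1},\dots,b_{i,d})$ with nonnegative integer entries, determine the maximum number of boxes that can be placed on $k$ (possibly empty) piles, each box being used at most once, such that in each pile each box fits into the next. Here (no rotation) a box of size $(a_1,\dots,a_d)$ fits into a box of size $(b_1,\dots,b_d)$ if $a_i\le b_i$ for all $1\le i\le d$. The model is the word RAM: a program is a finite list of instructions acting on registers and a random-access memory of $w$-bit words; each instruction (loading a constant, arithmetic modulo $2^w$, division with remainder, bitwise operations and shifts, indirect load and store, jumps and conditional jumps on comparison of two registers) costs one step. Initially one register contains $n$, the $nd$ numbers $b_{i,j}$ are stored consecutively in the memory, one per word, and everything else is $0$; the program has to stop with the answer in a register. **Theorem.** For every $k\ge 1$ there is an $\varepsilon>0$ such that multiple nested boxes with $k$ piles in any fixed dimension $d$ can be solved in time $O(n^{k+1-\varepsilon})$ on the word RAM with word size $\Theta(\log n)$. Precisely: for every $d\ge 0$ there are a program $P$ and constants $c, C$ (depending only on $k$ and $d$) such that for all $n\ge 1$, all $w\ge c(\lfloor\log_2 n\rfloor+1)$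 and all inputs of $n$ boxes in dimension $d$ with entries in $\{0,\dots,2^w-1\}$, the program $P$ on the machine with $w$-bit words stops after at most $C\,n^{k+1-\varepsilon}$ steps with the correct answer. -/

import Mathlib

/-! ### The word RAM -/

namespace WordRAM

/-- Binary operations on machine words. -/
inductive BinOp
  | add | sub | mul | div | mod | and | or | xor | shl | shr

/-- The effect of a binary operation on `w`-bit words, i.e. modulo `2 ^ w`
(division by `0` returns `0`, and `x` modulo `0` is `x`). -/
def BinOp.eval (w : ℕ) : BinOp → ℕ → ℕ → ℕ
  | .add, x, y => (x + y) % 2 ^ w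
  | .sub, x, y => (x + 2 ^ w - y) % 2 ^ w
  | .mul, x, y => (x * y) % 2 ^ w
  | .div, x, y => (x / y) % 2 ^ w
  | .mod, x, y => (x % y) % 2 ^ w
  | .and, x, y => (x &&& y) % 2 ^ w
  | .or,  x, y => (x ||| y) % 2 ^ w
  | .xor, x, y => (x ^^^ y) % 2 ^ w
  | .shl, x, y => (x <<< y) % 2 ^ w
  | .shr, x, y => (x >>> y) % 2 ^ w

/-- Instructions. The arguments `r`, `a`, `b` name registers, `l` is a position in the program. -/
inductive Instr
  /-- `R[r] := x` -/
  | const (r x : ℕ)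
  /-- `R[r] := R[a] o R[b]` -/
  | op (o : BinOp) (r a b : ℕ)
  /-- `R[r] := M[R[a]]` -/
  | load (r a : ℕ)
  /-- `M[R[a]] := R[b]` -/
  | store (a b : ℕ)
  /-- continue at position `l` -/
  | jump (l : ℕ)
  /-- continue at position `l` if `R[a] < R[b]` -/
  | jumpLt (a b l : ℕ)
  /-- continue at position `l` if `R[a] = R[b]` -/
  | jumpEq (a b l : ℕ)

/-- A program is a finite list of instructions (so it uses finitely many registers). -/
abbrev Program := List Instr

/-- A configuration: program counter, registers, and memory. Addresses are the contents of
registers, so only the memory cells with addresses below `2 ^ w` are ever used. -/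
structure Config where
  pc : ℕ
  reg : ℕ → ℕ
  mem : ℕ → ℕ

/-- The machine stops when the program counter leaves the program. -/
def Halted (P : Program) (s : Config) : Prop := P.length ≤ s.pc

/-- Execution of one instruction on a machine with `w`-bit words. -/
def exec (w : ℕ) (s : Config) : Instr → Config
  | .const r x => ⟨s.pc + 1, Function.update s.reg r (x % 2 ^ w), s.mem⟩
  | .op o r a b => ⟨s.pc + 1, Function.update s.reg r (o.eval w (s.reg a) (s.reg b)), s.mem⟩
  | .load r a => ⟨s.pc + 1, Function.update s.reg r (s.mem (s.reg a)), s.mem⟩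
  | .store a b => ⟨s.pc + 1, s.reg, Function.update s.mem (s.reg a) (s.reg b)⟩
  | .jump l => ⟨l, s.reg, s.mem⟩
  | .jumpLt a b l => ⟨if s.reg a < s.reg b then l else s.pc + 1, s.reg, s.mem⟩
  | .jumpEq a b l => ⟨if s.reg a = s.reg b then l else s.pc + 1, s.reg, s.mem⟩

/-- One step of the program `P`; a halted configuration does not change. -/
def step (P : Program) (w : ℕ) (s : Config) : Config :=
  match P[s.pc]? with
  | some i => exec w s i
  | none => s

/-- Started in `s`, the program `P` stops after at most `t` steps (each instruction costs one
step), and then register `0` contains `v`. -/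
def HaltsWith (P : Program) (w : ℕ) (s : Config) (t v : ℕ) : Prop :=
  Halted P ((step P w)^[t] s) ∧ ((step P w)^[t] s).reg 0 = v

end WordRAM

/-! ### Multiple nested boxes -/

namespace NestedBoxes

/-- Box `a` fits into box `b` (without rotation). -/
def FitsInto {d : ℕ} (a b : Fin d → ℕ) : Prop := ∀ i, a i ≤ b i

/-- `p` places some of the `n` boxes `B` on `k` piles, where `p t` lists the boxes of pile `t`
from the innermost to the outermost: in each pile each box fits into the next one, and each of
the `n` boxes is used at most once. -/
structure IsPiling {n d k : ℕ} (B : Fin n → Fin d → ℕ) (p : Fin k → List (Fin n)) : Prop where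
  fits : ∀ t, (p t).IsChain fun a b => FitsInto (B a) (B b)
  nodup : ∀ t, (p t).Nodup
  disjoint : ∀ s t, s ≠ t → (p s).Disjoint (p t)

/-- `m` is the maximum number of boxes that can be used on `k` piles. -/
def IsOptimum {n d : ℕ} (k : ℕ) (B : Fin n → Fin d → ℕ) (m : ℕ) : Prop :=
  IsGreatest {m | ∃ p : Fin k → List (Fin n), IsPiling B p ∧ ∑ t, (p t).length = m} m

/-- The initial configuration: register `0` contains `n`, the size of box `i` in dimension `j`
is in memory cell `i * d + j`, and everything else is `0`. -/
def input {n d : ℕ} (B : Fin n → Fin d → ℕ) : WordRAM.Config where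
  pc := 0
  reg := fun r => if r = 0 then n else 0
  mem := fun a =>
    if h : a < n * d then B (Fin.divNat (⟨a, h⟩ : Fin (n * d))) (Fin.modNat (⟨a, h⟩ : Fin (n * d)))
    else 0

end NestedBoxes

/-! ### A structured language over the word RAM -/

namespace WordRAM

/-! The bound holds with `ε = 1/2` because `k` piles can be handled in time `n ^ k` times a power of
`log n`. (From here on the number of piles is written `k + 1`.)

Replace the entries of the boxes by their ranks in each coordinate and process the boxes by
increasing sum of ranks. If a box fits into one that was processed earlier, the two have equal
sizes, so a new box may always be put on top. A partial solution is described by a tuple with one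
box per pile, into which all boxes of that pile fit. When `x` is processed, one entry of the tuple
becomes `x`; after a cyclic rotation this is the last entry. For each of the `n ^ k` choices of the
other entries, the best predecessor is the maximum over the stored tuples with the same other
entries whose last box fits into `x`. This is an orthogonal range maximum query. An empty pile may
carry any entry, so a pile is started by taking `x` itself as predecessor.

The queries use dyadic blocks: `r ≤ y` holds if and only if `r / 2 ^ ℓ + 1 = (y + 1) / 2 ^ ℓ` for
some level `ℓ` (`le_of_block_eq`, `exists_block_eq`). With `L = O(log n)` levels, a tuple is written
to `L ^ d` cells and a query reads `L ^ d` cells. Addresses are numbers in a radix `S` linear in `n`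
(`cellAt_inj`). The table may be much larger than the number of steps, but it never has to be
cleared: memory starts at zero, which is the correct default, and the word size suffices to address
it.

Correctness consists of two one-sided invariants in `TableOk`: every stored value is realized by
piles (`Reach`), and every piling is accounted for by some tuple (`Complete`). `TableOk.step`
preserves both by means of `Reach.step` and `Complete.step`.

The algorithm is written in a small structured language, compiled to the machine by
`Stmt.Exec.simulates`. Correctness (`Total`) and running time (`Exec.le_time`) are proved
separately. Sorting is done with a tournament tree (`fill_spec`, `pop_spec`). -/

/-- Arithmetic operations of the structured language. -/
inductive ArithOp
  | add | sub | mul | div | mod | shr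

namespace ArithOp

/-- The value of an operation on natural numbers. -/
def eval : ArithOp → ℕ → ℕ → ℕ
  | .add, x, y => x + y
  | .sub, x, y => x - y
  | .mul, x, y => x * y
  | .div, x, y => x / y
  | .mod, x, y => x % y
  | .shr, x, y => x / 2 ^ y

/-- The machine operation implementing an arithmetic operation. -/
def toBinOp : ArithOp → BinOp
  | .add => .add
  | .sub => .sub
  | .mul => .mul
  | .div => .div
  | .mod => .mod
  | .shr => .shr

/-- The operation on `w`-bit words neither overflows nor underflows. -/
def Safe (w : ℕ) : ArithOp → ℕ → ℕ → Prop
  | .add, x, y => x + y < 2 ^ w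
  | .sub, x, y => y ≤ x
  | .mul, x, y => x * y < 2 ^ w
  | .div, _, _ => True
  | .mod, _, _ => True
  | .shr, _, _ => True

/-- Under `Safe` the reduction modulo `2 ^ w` is the identity, so all later reasoning about programs
takes place in `ℕ`. Division, remainder and right shift never exceed their first operand and need no
condition. -/
theorem toBinOp_eval {w x y : ℕ} (o : ArithOp) (hx : x < 2 ^ w) (h : o.Safe w x y) :
    o.toBinOp.eval w x y = o.eval x y := by
  cases o <;> simp only [Safe] at h <;> simp only [toBinOp, BinOp.eval, eval]
  · exact Nat.mod_eq_of_lt h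
  · rw [show x + 2 ^ w - y = (x - y) + 2 ^ w by omega, Nat.add_mod_right]
    exact Nat.mod_eq_of_lt (by omega)
  · exact Nat.mod_eq_of_lt h
  · exact Nat.mod_eq_of_lt ((Nat.div_le_self _ _).trans_lt hx)
  · exact Nat.mod_eq_of_lt ((Nat.mod_le _ _).trans_lt hx)
  · rw [Nat.shiftRight_eq_div_pow]
    exact Nat.mod_eq_of_lt ((Nat.div_le_self _ _).trans_lt hx)

theorem eval_lt {w x y : ℕ} (o : ArithOp) (hx : x < 2 ^ w) (h : o.Safe w x y) :
    o.eval x y < 2 ^ w := by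
  rw [← toBinOp_eval o hx h]
  cases o <;> exact Nat.mod_lt _ (by positivity)

end ArithOp

/-- States of the structured language: variables and arrays. -/
structure State where
  var : ℕ → ℕ
  arr : ℕ → ℕ → ℕ

namespace State

/-- Assign the value `v` to the variable `x`. -/
def set (s : State) (x v : ℕ) : State := ⟨Function.update s.var x v, s.arr⟩

/-- Write the value `v` into entry `i` of the array `g`. -/
def put (s : State) (g i v : ℕ) : State :=
  ⟨s.var, Function.update s.arr g (Function.update (s.arr g) i v)⟩

@[simp] theorem set_var (s : State) (x v y : ℕ) :
    (s.set x v).var y = if y = x then v else s.var y := by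
  simp [set, Function.update_apply]

@[simp] theorem set_arr (s : State) (x v : ℕ) : (s.set x v).arr = s.arr := rfl

@[simp] theorem put_var (s : State) (g i v : ℕ) : (s.put g i v).var = s.var := rfl

@[simp] theorem put_arr (s : State) (g i v g' : ℕ) :
    (s.put g i v).arr g' = if g' = g then Function.update (s.arr g) i v else s.arr g' := by
  by_cases h : g' = g
  · subst h; simp [put]
  · simp [put, h]

end State

/-- Expressions. -/
inductive Expr
  | var (x : ℕ)
  | const (c : ℕ)
  | bin (o : ArithOp) (a b : Expr)
  | get (g : ℕ) (e : Expr)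

namespace Expr

/-- The value of an expression. -/
def eval (s : State) : Expr → ℕ
  | var x => s.var x
  | const c => c
  | bin o a b => o.eval (a.eval s) (b.eval s)
  | get g e => s.arr g (e.eval s)

/-- No operation overflows, and the array indices are below `U`. -/
def Safe (w U : ℕ) (s : State) : Expr → Prop
  | var _ => True
  | const c => c < 2 ^ w
  | bin o a b => a.Safe w U s ∧ b.Safe w U s ∧ o.Safe w (a.eval s) (b.eval s)
  | get _ e => e.Safe w U s ∧ e.eval s < U

/-- The variables are below `V` and the array names are below `8`. -/
def Wf (V : ℕ) : Expr → Bool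
  | var x => decide (x < V)
  | const _ => true
  | bin _ a b => a.Wf V && b.Wf V
  | get g e => decide (g < 8) && e.Wf V

/-- Code that evaluates an expression into register `t`, using only registers from `t` on for
writing. Register `V` contains the length of the arrays. -/
def code (V : ℕ) : ℕ → Expr → List Instr
  | t, var x => [.op .or t x x]
  | t, const c => [.const t c]
  | t, bin o a b => a.code V t ++ (b.code V (t + 1) ++ [.op o.toBinOp t t (t + 1)])
  | t, get g e => e.code V t ++
      [.const (t + 1) g, .op .mul (t + 1) (t + 1) V, .op .add t t (t + 1), .load t t]

/-- The length of the code of an expression. -/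
def len : Expr → ℕ
  | var _ => 1
  | const _ => 1
  | bin _ a b => a.len + (b.len + 1)
  | get _ e => e.len + 4

theorem length_code (V t : ℕ) (e : Expr) : (e.code V t).length = e.len := by
  induction e generalizing t with
  | var | const => rfl
  | bin o a b iha ihb => simp [code, len, iha, ihb]
  | get g e ih => simp [code, len, ih]

end Expr

/-- Statements. The loop `loop x e c` evaluates `e` once, to `N` say, and executes `c` with
`x = 0, …, N - 1`. -/
inductive Stmt
  | skip
  | assign (x : ℕ) (e : Expr)
  | put (g : ℕ) (e₁ e₂ : Expr)
  | seq (c₁ c₂ : Stmt)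
  | ifLt (a b : Expr) (c₁ c₂ : Stmt)
  | loop (x : ℕ) (e : Expr) (c : Stmt)

namespace Stmt

/-- Well-formed statements: variables are below `V` and array names are below `8`. -/
def Wf (V : ℕ) : Stmt → Bool
  | skip => true
  | assign x e => decide (x < V) && e.Wf V
  | put g e₁ e₂ => decide (g < 8) && (e₁.Wf V && e₂.Wf V)
  | seq c₁ c₂ => c₁.Wf V && c₂.Wf V
  | ifLt a b c₁ c₂ => (a.Wf V && b.Wf V) && (c₁.Wf V && c₂.Wf V)
  | loop x e c => decide (x < V) && (e.Wf V && c.Wf V)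

/-- The length of the code of a statement. -/
def len : Stmt → ℕ
  | skip => 0
  | assign _ e => e.len + 1
  | put _ e₁ e₂ => e₁.len + (e₂.len + 4)
  | seq c₁ c₂ => c₁.len + c₂.len
  | ifLt a b c₁ c₂ => a.len + (b.len + (1 + (c₂.len + (1 + c₁.len))))
  | loop _ e c => e.len + (4 + (c.len + 3))

/-- Code for a statement, at position `o` of a program, with temporary registers from `t` on. -/
def code (V : ℕ) : ℕ → ℕ → Stmt → List Instr
  | _, _, skip => []
  | _, t, assign x e => e.code V t ++ [.op .or x t t]
  | _, t, put g e₁ e₂ => e₁.code V t ++ (e₂.code V (t + 1) ++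
      [.const (t + 2) g, .op .mul (t + 2) (t + 2) V, .op .add t t (t + 2), .store t (t + 1)])
  | o, t, seq c₁ c₂ => c₁.code V o t ++ c₂.code V (o + c₁.len) t
  | o, t, ifLt a b c₁ c₂ =>
      a.code V t ++ (b.code V (t + 1) ++
        ([.jumpLt t (t + 1) (o + a.len + b.len + 1 + c₂.len + 1)] ++
          (c₂.code V (o + a.len + b.len + 1) t ++
            ([.jump (o + a.len + b.len + 1 + c₂.len + 1 + c₁.len)] ++
              c₁.code V (o + a.len + b.len + 1 + c₂.len + 1) t))))
  | o, t, loop x e c =>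
      e.code V t ++
        ([.const (t + 1) 0, .jumpLt (t + 1) t (o + e.len + 3),
          .jump (o + e.len + 4 + c.len + 3), .op .or x (t + 1) (t + 1)] ++
          (c.code V (o + e.len + 4) (t + 2) ++
            [.const (t + 2) 1, .op .add (t + 1) (t + 1) (t + 2), .jump (o + e.len + 1)]))

theorem length_code (V o t : ℕ) (c : Stmt) : (c.code V o t).length = c.len := by
  induction c generalizing o t with
  | skip => rfl
  | assign x e => simp [code, len, Expr.length_code]
  | put g e₁ e₂ => simp [code, len, Expr.length_code]
  | seq c₁ c₂ ih₁ ih₂ => simp [code, len, ih₁, ih₂]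
  | ifLt a b c₁ c₂ ih₁ ih₂ =>
    simp [code, len, ih₁, ih₂, Expr.length_code]; omega
  | loop x e c ih => simp [code, len, ih, Expr.length_code]; omega

/-- Execution of a statement without overflows, from one state to another, in the given number
of steps. -/
inductive Exec (w U : ℕ) : Stmt → State → ℕ → State → Prop
  | skip (s) : Exec w U skip s 0 s
  | assign (x e s) : e.Safe w U s → Exec w U (assign x e) s (e.len + 1) (s.set x (e.eval s))
  | put (g e₁ e₂ s) : e₁.Safe w U s → e₂.Safe w U s → e₁.eval s < U →
      Exec w U (put g e₁ e₂) s (e₁.len + (e₂.len + 4)) (s.put g (e₁.eval s) (e₂.eval s))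
  | seq {c₁ c₂ s t₁ s₁ t₂ s₂} : Exec w U c₁ s t₁ s₁ → Exec w U c₂ s₁ t₂ s₂ →
      Exec w U (seq c₁ c₂) s (t₁ + t₂) s₂
  | ifTrue {a b c₁ c₂ s t s₁} : a.Safe w U s → b.Safe w U s → a.eval s < b.eval s →
      Exec w U c₁ s t s₁ → Exec w U (ifLt a b c₁ c₂) s (a.len + (b.len + (1 + t))) s₁
  | ifFalse {a b c₁ c₂ s t s₁} : a.Safe w U s → b.Safe w U s → ¬ a.eval s < b.eval s →
      Exec w U c₂ s t s₁ → Exec w U (ifLt a b c₁ c₂) s (a.len + (b.len + (1 + (t + 1)))) s₁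
  | loop {x e c s} (f : ℕ → State) (τ : ℕ → ℕ) : e.Safe w U s → f 0 = s →
      (∀ i < e.eval s, Exec w U c ((f i).set x i) (τ i) (f (i + 1))) →
      Exec w U (loop x e c) s (e.len + (1 + (∑ i ∈ Finset.range (e.eval s), (τ i + 5) + 2)))
        (f (e.eval s))

end Stmt

/-! ### Correctness of the compiler -/

/-- The list `l` of instructions stands at position `o` of the program `P`. -/
def CodeAt (P : Program) (o : ℕ) (l : List Instr) : Prop :=
  ∃ a b, P = a ++ (l ++ b) ∧ a.length = o

theorem CodeAt.left {P : Program} {o : ℕ} {l l' : List Instr} (h : CodeAt P o (l ++ l')) :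
    CodeAt P o l := by
  obtain ⟨a, b, rfl, rfl⟩ := h
  exact ⟨a, l' ++ b, by simp, rfl⟩

theorem CodeAt.right {P : Program} {o : ℕ} {l l' : List Instr} (h : CodeAt P o (l ++ l')) :
    CodeAt P (o + l.length) l' := by
  obtain ⟨a, b, rfl, rfl⟩ := h
  exact ⟨a ++ l, b, by simp, by simp⟩

theorem CodeAt.tail {P : Program} {o : ℕ} {i : Instr} {l : List Instr} (h : CodeAt P o (i :: l)) :
    CodeAt P (o + 1) l :=
  CodeAt.right (l := [i]) h

theorem CodeAt.step {P : Program} {w : ℕ} {s : Config} {i : Instr} {l : List Instr}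
    (h : CodeAt P s.pc (i :: l)) : step P w s = exec w s i := by
  obtain ⟨a, b, rfl, ha⟩ := h
  simp [WordRAM.step, ← ha]

/-- The configuration `s` becomes `s'` in exactly `t` steps. -/
def Steps (P : Program) (w : ℕ) (s : Config) (t : ℕ) (s' : Config) : Prop :=
  (step P w)^[t] s = s'

theorem Steps.refl (P : Program) (w : ℕ) (s : Config) : Steps P w s 0 s := rfl

theorem Steps.trans {P : Program} {w : ℕ} {s s' s'' : Config} {t t' : ℕ}
    (h : Steps P w s t s') (h' : Steps P w s' t' s'') : Steps P w s (t + t') s'' := by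
  unfold Steps at *
  rw [add_comm, Function.iterate_add_apply, h, h']

theorem CodeAt.steps {P : Program} {w o : ℕ} {s : Config} {i : Instr} {l : List Instr}
    (h : CodeAt P o (i :: l)) (ho : s.pc = o) : Steps P w s 1 (exec w s i) := by
  subst ho
  exact h.step

/-- The configuration `σ` represents the state `s`. -/
structure Rep (w V U : ℕ) (s : State) (σ : Config) : Prop where
  var : ∀ x < V, σ.reg x = s.var x
  len : σ.reg V = U
  arr : ∀ g < 8, ∀ i < U, σ.mem (g * U + i) = s.arr g i
  var_lt : ∀ x < V, s.var x < 2 ^ w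
  arr_lt : ∀ g < 8, ∀ i < U, s.arr g i < 2 ^ w

theorem address_lt {w U g i : ℕ} (hU : 8 * U < 2 ^ w) (hg : g < 8) (hi : i < U) :
    g * U + i < 2 ^ w := by
  have : g * U ≤ 7 * U := Nat.mul_le_mul_right _ (by omega)
  omega

/-- Division with remainder by `U`. Besides separating the arrays in memory, this also separates the
entries of the array of ranks and the digits of table addresses. -/
theorem address_inj {U g i g' i' : ℕ} (hi : i < U) (hi' : i' < U) (h : g * U + i = g' * U + i') :
    g = g' ∧ i = i' := by
  have hg : g = g' := by
    have h₁ := congrArg (· / U) h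
    have hU : 0 < U := by omega
    simpa [Nat.add_comm (_ * U), Nat.add_mul_div_right _ _ hU, Nat.div_eq_of_lt hi,
      Nat.div_eq_of_lt hi'] using h₁
  subst hg
  exact ⟨rfl, by omega⟩

theorem Expr.eval_lt {w V U : ℕ} {s : State} {σ : Config} (h : Rep w V U s σ) (e : Expr)
    (hw : e.Wf V = true) (hs : e.Safe w U s) : e.eval s < 2 ^ w := by
  induction e with
  | var x => exact h.var_lt x (by simpa [Wf] using hw)
  | const c => exact hs
  | bin o a b iha ihb =>
    simp only [Wf, Bool.and_eq_true] at hw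
    exact o.eval_lt (iha hw.1 hs.1) hs.2.2
  | get g e ih =>
    simp only [Wf, Bool.and_eq_true, decide_eq_true_eq] at hw
    exact h.arr_lt g hw.1 _ hs.2

/-- Configurations with the same memory that agree on the registers below `t`. -/
theorem Rep.congr {w V U t : ℕ} {s : State} {σ σ' : Config} (h : Rep w V U s σ) (ht : V < t)
    (hr : ∀ r < t, σ'.reg r = σ.reg r) (hm : σ'.mem = σ.mem) : Rep w V U s σ' where
  var x hx := by rw [hr x (by omega), h.var x hx]
  len := by rw [hr V ht, h.len]
  arr := by rw [hm]; exact h.arr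
  var_lt := h.var_lt
  arr_lt := h.arr_lt

/-- The temporaries form a stack: code for a subexpression at `t` writes nothing below `t`, so the
first operand survives in `t` while the second is evaluated from `t + 1` on. Variables and the array
length lie at or below `V < t` and are untouched. -/
theorem Expr.steps_code {w V U : ℕ} {P : Program} (hU : 8 * U < 2 ^ w) {s : State} (e : Expr)
    (hw : e.Wf V = true) (hs : e.Safe w U s) {σ : Config} {o t : ℕ} (ht : V < t)
    (hP : CodeAt P o (e.code V t)) (ho : σ.pc = o) (h : Rep w V U s σ) :
    ∃ σ', Steps P w σ e.len σ' ∧ σ'.pc = o + e.len ∧ σ'.reg t = e.eval s ∧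
      (∀ r < t, σ'.reg r = σ.reg r) ∧ σ'.mem = σ.mem := by
  induction e generalizing σ o t with
  | var x =>
    have hx : x < V := by simpa [Wf] using hw
    refine ⟨_, hP.steps ho, by simp [exec, len, ho], ?_, ?_, rfl⟩
    · simp [exec, eval, BinOp.eval, h.var x hx, Nat.mod_eq_of_lt (h.var_lt x hx)]
    · intro r hr
      simp [exec, hr.ne]
  | const c =>
    refine ⟨_, hP.steps ho, by simp [exec, len, ho], ?_, ?_, rfl⟩
    · simp [exec, eval, Nat.mod_eq_of_lt (show c < 2 ^ w from hs)]
    · intro r hr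
      simp [exec, hr.ne]
  | bin o' a b iha ihb =>
    simp only [Wf, Bool.and_eq_true] at hw
    obtain ⟨hsa, hsb, hso⟩ := hs
    obtain ⟨σ₁, h₁, hpc₁, hv₁, hr₁, hm₁⟩ := iha hw.1 hsa ht hP.left ho h
    have hP₂ := hP.right
    rw [Expr.length_code] at hP₂
    obtain ⟨σ₂, h₂, hpc₂, hv₂, hr₂, hm₂⟩ :=
      ihb hw.2 hsb (t := t + 1) (by omega) hP₂.left hpc₁ (h.congr ht hr₁ hm₁)
    have hP₃ := hP₂.right
    rw [Expr.length_code] at hP₃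
    refine ⟨_, h₁.trans (h₂.trans (hP₃.steps hpc₂)), by simp [exec, len, hpc₂]; omega, ?_, ?_, ?_⟩
    · simp only [exec, Function.update_self, hv₂, hr₂ t (by omega), hv₁]
      exact o'.toBinOp_eval (a.eval_lt h hw.1 hsa) hso
    · intro r hr
      simp only [exec, Function.update_of_ne hr.ne]
      rw [hr₂ r (by omega), hr₁ r hr]
    · simp [exec, hm₂, hm₁]
  | get g e ih =>
    simp only [Wf, Bool.and_eq_true, decide_eq_true_eq] at hw
    obtain ⟨σ₁, h₁, hpc₁, hv₁, hr₁, hm₁⟩ := ih hw.2 hs.1 ht hP.left ho h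
    have hP₂ := hP.right
    rw [Expr.length_code] at hP₂
    have hlt := address_lt hU hw.1 hs.2
    have hg : g < 2 ^ w := by
      have := hs.2
      omega
    have hgU : g * U < 2 ^ w := by omega
    have hV : σ₁.reg V = U := by rw [hr₁ V ht, h.len]
    refine ⟨_, h₁.trans (((hP₂.steps hpc₁).trans (hP₂.tail.steps ?_)).trans
      ((hP₂.tail.tail.steps ?_).trans (hP₂.tail.tail.tail.steps ?_))), ?_, ?_, ?_, ?_⟩
    · simp [exec, hpc₁]
    · simp [exec, hpc₁]
    · simp [exec, hpc₁]
    · simp [exec, hpc₁, len]; omega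
    · have hne : V ≠ t + 1 := by omega
      have := h.arr g hw.1 _ hs.2
      simp [exec, eval, BinOp.eval, hv₁, hV, hm₁, hne, Nat.mod_eq_of_lt hg, Nat.mod_eq_of_lt hgU,
        ← this]
      rw [Nat.mod_eq_of_lt (by omega), add_comm]
    · intro r hr
      have : r ≠ t + 1 := by omega
      simp [exec, hr.ne, this, hr₁ r hr]
    · simp [exec, hm₁]

theorem Rep.set {w V U : ℕ} {s : State} {σ : Config} (h : Rep w V U s σ) {x v : ℕ} (hx : x < V)
    (hv : v < 2 ^ w) (pc : ℕ) :
    Rep w V U (s.set x v) ⟨pc, Function.update σ.reg x v, σ.mem⟩ where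
  var y hy := by
    rw [State.set_var]
    split_ifs with hyx
    · simp [hyx]
    · simp [hyx, h.var y hy]
  len := by simp [Function.update_of_ne hx.ne', h.len]
  arr := h.arr
  var_lt y hy := by
    rw [State.set_var]
    split_ifs
    · exact hv
    · exact h.var_lt y hy
  arr_lt := h.arr_lt

/-- Induction on the execution. The clause about the registers strictly between `V` and `t` is what
the loop case needs: enclosing loops keep their bounds and counters there. -/
theorem Stmt.Exec.simulates {w V U : ℕ} {P : Program} (hU : 8 * U < 2 ^ w) {c : Stmt}
    {s s' : State} {T : ℕ} (hc : c.Exec w U s T s') (hw : c.Wf V = true) {σ : Config} {o t : ℕ}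
    (ht : V < t) (hP : CodeAt P o (c.code V o t)) (ho : σ.pc = o) (h : Rep w V U s σ) :
    ∃ σ', Steps P w σ T σ' ∧ σ'.pc = o + c.len ∧ Rep w V U s' σ' ∧
      (∀ r, V < r → r < t → σ'.reg r = σ.reg r) := by
  induction hc generalizing σ o t with
  | skip s => exact ⟨σ, .refl _ _ _, by simp [ho, len], h, fun _ _ _ => rfl⟩
  | assign x e s hs =>
    simp only [Wf, Bool.and_eq_true, decide_eq_true_eq] at hw
    obtain ⟨σ₁, h₁, hpc₁, hv₁, hr₁, hm₁⟩ := e.steps_code hU hw.2 hs ht hP.left ho h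
    have hP₂ := hP.right
    rw [Expr.length_code] at hP₂
    refine ⟨_, h₁.trans (hP₂.steps hpc₁), by simp [exec, len, hpc₁]; omega, ?_, ?_⟩
    · have := (h.congr ht hr₁ hm₁).set hw.1 (e.eval_lt h hw.2 hs) (σ₁.pc + 1)
      simpa [exec, BinOp.eval, hv₁, Nat.mod_eq_of_lt (e.eval_lt h hw.2 hs)] using this
    · intro r hr hrt
      have : r ≠ x := by omega
      simp [exec, this, hr₁ r hrt]
  | put g e₁ e₂ s hs₁ hs₂ hi =>
    simp only [Wf, Bool.and_eq_true, decide_eq_true_eq] at hw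
    obtain ⟨σ₁, h₁, hpc₁, hv₁, hr₁, hm₁⟩ := e₁.steps_code hU hw.2.1 hs₁ ht hP.left ho h
    have hP₂ := hP.right
    rw [Expr.length_code] at hP₂
    obtain ⟨σ₂, h₂, hpc₂, hv₂, hr₂, hm₂⟩ := e₂.steps_code hU hw.2.2 hs₂ (t := t + 1) (by omega)
      hP₂.left hpc₁ (h.congr ht hr₁ hm₁)
    have hP₃ := hP₂.right
    rw [Expr.length_code] at hP₃
    have hlt := address_lt hU hw.1 hi
    have hg : g < 2 ^ w := by omega
    have hgU : g * U < 2 ^ w := by omega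
    have hne : V ≠ t + 2 := by omega
    have hV : σ₂.reg V = U := by rw [hr₂ V (by omega), hr₁ V ht, h.len]
    have hvt : σ₂.reg t = e₁.eval s := by rw [hr₂ t (by omega), hv₁]
    have hlt' : e₁.eval s + g * U < 2 ^ w := by omega
    refine ⟨_, h₁.trans (h₂.trans (((hP₃.steps hpc₂).trans (hP₃.tail.steps ?_)).trans
      ((hP₃.tail.tail.steps ?_).trans (hP₃.tail.tail.tail.steps ?_)))), ?_, ?_, ?_⟩
    · simp [exec, hpc₂]
    · simp [exec, hpc₂]
    · simp [exec, hpc₂]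
    · simp [exec, hpc₂, len]; omega
    · have hb := e₂.eval_lt h hw.2.2 hs₂
      have hmem : ∀ g' < 8, ∀ i < U, Function.update σ₂.mem (e₁.eval s + g * U) (e₂.eval s)
          (g' * U + i) = (s.put g (e₁.eval s) (e₂.eval s)).arr g' i := by
        intro g' hg' i hi'
        rw [Function.update_apply, hm₂, hm₁, h.arr g' hg' i hi', State.put_arr]
        by_cases hgg : g' = g
        · subst hgg
          rw [if_pos rfl, Function.update_apply]
          by_cases hii : i = e₁.eval s
          · subst hii
            rw [if_pos (by omega), if_pos rfl]
          · rw [if_neg (by omega), if_neg hii]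
        · rw [if_neg (fun hh => hgg (address_inj hi' hi (hh.trans (add_comm _ _))).1), if_neg hgg]
      refine ⟨?_, ?_, ?_, h.var_lt, ?_⟩
      · intro x hx
        have h₁ : x ≠ t := by omega
        have h₂ : x ≠ t + 2 := by omega
        simp [exec, h₁, h₂, hr₂ x (by omega), hr₁ x (by omega), h.var x hx]
      · have h₁ : V ≠ t := by omega
        simp [exec, h₁, hne, hV]
      · simpa [exec, BinOp.eval, hvt, hv₂, hV, hne, Nat.mod_eq_of_lt hg, Nat.mod_eq_of_lt hgU,
          Nat.mod_eq_of_lt hlt'] using hmem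
      · intro g' hg' i hi'
        rw [State.put_arr]
        split_ifs with hgg
        · rw [Function.update_apply]
          split_ifs
          · exact hb
          · exact h.arr_lt g hw.1 i hi'
        · exact h.arr_lt g' hg' i hi'
    · intro r hr hrt
      have h₁ : r ≠ t := by omega
      have h₂ : r ≠ t + 2 := by omega
      simp [exec, h₁, h₂, hr₂ r (by omega), hr₁ r (by omega)]
  | seq hc₁ hc₂ ih₁ ih₂ =>
    simp only [Wf, Bool.and_eq_true] at hw
    obtain ⟨σ₁, h₁, hpc₁, hR₁, hr₁⟩ := ih₁ hw.1 ht hP.left ho h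
    have hP₂ := hP.right
    rw [length_code] at hP₂
    obtain ⟨σ₂, h₂, hpc₂, hR₂, hr₂⟩ := ih₂ hw.2 ht hP₂ hpc₁ hR₁
    exact ⟨σ₂, h₁.trans h₂, by rw [hpc₂, len]; omega, hR₂,
      fun r hr hrt => (hr₂ r hr hrt).trans (hr₁ r hr hrt)⟩
  | @ifTrue a b c₁ c₂ s T s' hsa hsb hlt hc ih =>
    simp only [Wf, Bool.and_eq_true] at hw
    obtain ⟨σ₁, h₁, hpc₁, hv₁, hr₁, hm₁⟩ := a.steps_code hU hw.1.1 hsa ht hP.left ho h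
    have hP₂ := hP.right
    rw [Expr.length_code] at hP₂
    obtain ⟨σ₂, h₂, hpc₂, hv₂, hr₂, hm₂⟩ := b.steps_code hU hw.1.2 hsb (t := t + 1) (by omega)
      hP₂.left hpc₁ (h.congr ht hr₁ hm₁)
    have hP₃ := hP₂.right
    rw [Expr.length_code] at hP₃
    have hP₄ := hP₃.right.right.right
    simp only [length_code, List.length_singleton] at hP₄
    have h₃ := hP₃.left.steps (w := w) hpc₂
    simp only [exec, hv₂, hr₂ t (by omega), hv₁, if_pos hlt] at h₃
    obtain ⟨σ₄, h₄, hpc₄, hR₄, hr₄⟩ := ih hw.2.1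
      (σ := ⟨o + a.len + b.len + 1 + c₂.len + 1, σ₂.reg, σ₂.mem⟩) ht hP₄ rfl
      ((h.congr ht hr₁ hm₁).congr (t := t + 1) (by omega) hr₂ hm₂ |>.congr
        (σ' := ⟨_, σ₂.reg, σ₂.mem⟩) (by omega : V < t) (fun _ _ => rfl) rfl)
    refine ⟨σ₄, h₁.trans (h₂.trans (h₃.trans h₄)), ?_, hR₄, ?_⟩
    · rw [hpc₄, len]; omega
    · intro r hr hrt
      rw [hr₄ r hr hrt]
      exact (hr₂ r (by omega)).trans (hr₁ r hrt)
  | @ifFalse a b c₁ c₂ s T s' hsa hsb hlt hc ih =>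
    simp only [Wf, Bool.and_eq_true] at hw
    obtain ⟨σ₁, h₁, hpc₁, hv₁, hr₁, hm₁⟩ := a.steps_code hU hw.1.1 hsa ht hP.left ho h
    have hP₂ := hP.right
    rw [Expr.length_code] at hP₂
    obtain ⟨σ₂, h₂, hpc₂, hv₂, hr₂, hm₂⟩ := b.steps_code hU hw.1.2 hsb (t := t + 1) (by omega)
      hP₂.left hpc₁ (h.congr ht hr₁ hm₁)
    have hP₃ := hP₂.right
    rw [Expr.length_code] at hP₃
    have hP₄ := hP₃.right.left
    have hP₅ := hP₃.right.right.left
    simp only [length_code, List.length_singleton] at hP₄ hP₅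
    have h₃ := hP₃.left.steps (w := w) hpc₂
    simp only [exec, hv₂, hr₂ t (by omega), hv₁, if_neg hlt, hpc₂] at h₃
    obtain ⟨σ₄, h₄, hpc₄, hR₄, hr₄⟩ := ih hw.2.2
      (σ := ⟨o + a.len + b.len + 1, σ₂.reg, σ₂.mem⟩) ht hP₄ rfl
      ((h.congr ht hr₁ hm₁).congr (t := t + 1) (by omega) hr₂ hm₂ |>.congr
        (σ' := ⟨_, σ₂.reg, σ₂.mem⟩) (by omega : V < t) (fun _ _ => rfl) rfl)
    refine ⟨_, h₁.trans (h₂.trans (h₃.trans (h₄.trans (hP₅.steps hpc₄)))), ?_, ?_, ?_⟩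
    · simp only [exec, len]; omega
    · exact hR₄.congr ht (fun _ _ => rfl) rfl
    · intro r hr hrt
      simp only [exec]
      rw [hr₄ r hr hrt]
      exact (hr₂ r (by omega)).trans (hr₁ r hrt)
  | @loop x e c s f τ hs hf hc ih =>
    simp only [Wf, Bool.and_eq_true, decide_eq_true_eq] at hw
    obtain ⟨σ₁, h₁, hpc₁, hv₁, hr₁, hm₁⟩ := e.steps_code hU hw.2.1 hs ht hP.left ho h
    have hN := e.eval_lt h hw.2.1 hs
    have hP₂ := hP.right
    rw [Expr.length_code] at hP₂
    have hP₃ := hP₂.left.tail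
    have hP₄ := hP₂.right.left
    have hP₅ := hP₂.right.right
    simp only [length_code, List.length_cons, List.length_nil] at hP₄ hP₅
    -- The invariant at the loop test before iteration `i`. The five extra steps per round are the
    -- test, the copy of the counter to `x`, the loading of `1`, the increment and the jump back.
    -- The counter has a register of its own, so the body may overwrite `x`.
    have key : ∀ i ≤ e.eval s, ∃ σ', Steps P w (exec w σ₁ (.const (t + 1) 0))
        (∑ j ∈ Finset.range i, (τ j + 5)) σ' ∧ σ'.pc = o + e.len + 1 ∧ Rep w V U (f i) σ' ∧
        σ'.reg t = e.eval s ∧ σ'.reg (t + 1) = i ∧ ∀ r, V < r → r < t → σ'.reg r = σ.reg r := by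
      intro i
      induction i with
      | zero =>
        intro _
        refine ⟨_, Steps.refl _ _ _, by simp [exec, hpc₁], ?_, by simp [exec, hv₁], by simp [exec],
          ?_⟩
        · rw [hf]
          refine h.congr ht (fun r hr => ?_) hm₁
          have : r ≠ t + 1 := by omega
          simp [exec, this, hr₁ r hr]
        · intro r hr hrt
          have : r ≠ t + 1 := by omega
          simp [exec, this, hr₁ r hrt]
      | succ i ihi =>
        intro hi
        obtain ⟨σ₂, h₂, hpc₂, hR₂, hv₂, hi₂, hr₂⟩ := ihi (by omega)
        have h₃ := hP₃.steps (w := w) hpc₂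
        simp only [exec, hv₂, hi₂, if_pos (show i < e.eval s by omega)] at h₃
        have h₄ := hP₃.tail.tail.steps (w := w) (s := ⟨o + e.len + 3, σ₂.reg, σ₂.mem⟩) rfl
        have hiw : i < 2 ^ w := by omega
        simp only [exec, BinOp.eval, hi₂, Nat.or_self, Nat.mod_eq_of_lt hiw] at h₄
        obtain ⟨σ₅, h₅, hpc₅, hR₅, hr₅⟩ := ih i (by omega) hw.2.2 (t := t + 2) (by omega) hP₄ rfl
          (hR₂.set hw.1 hiw (o + e.len + 3 + 1))
        have h₆ := hP₅.steps (w := w) hpc₅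
        have h₇ := hP₅.tail.steps (w := w) (s := exec w σ₅ (.const (t + 2) 1))
          (by simp [exec, hpc₅])
        have h₈ := hP₅.tail.tail.steps (w := w)
          (s := exec w (exec w σ₅ (.const (t + 2) 1)) (.op .add (t + 1) (t + 1) (t + 2)))
          (by simp [exec, hpc₅])
        have hx₁ : t + 1 ≠ x := by omega
        have hx₂ : t ≠ x := by omega
        have hi₅ : σ₅.reg (t + 1) = i := by
          rw [hr₅ (t + 1) (by omega) (by omega)]
          simp [hx₁, hi₂]
        have hv₅ : σ₅.reg t = e.eval s := by
          rw [hr₅ t (by omega) (by omega)]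
          simp [hx₂, hv₂]
        have hone : 1 < 2 ^ w := by
          have : 1 ≤ i + 1 := by omega
          omega
        refine ⟨exec w (exec w (exec w σ₅ (.const (t + 2) 1))
          (.op .add (t + 1) (t + 1) (t + 2))) (.jump (o + e.len + 1)), ?_, rfl, ?_, ?_, ?_, ?_⟩
        · have := h₂.trans (h₃.trans (h₄.trans (h₅.trans (h₆.trans (h₇.trans h₈)))))
          rw [Finset.sum_range_succ]
          convert this using 1
          ring
        · refine hR₅.congr (t := t) ht (fun r hr => ?_) rfl
          have h₁ : r ≠ t + 1 := by omega
          have h₂ : r ≠ t + 2 := by omega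
          simp [exec, h₁, h₂]
        · simp [exec, hv₅]
        · simp [exec, hi₅, BinOp.eval, Nat.mod_eq_of_lt hone,
            Nat.mod_eq_of_lt (show i + 1 < 2 ^ w by omega)]
        · intro r hr hrt
          have h₁ : r ≠ t + 1 := by omega
          have h₂ : r ≠ t + 2 := by omega
          have h₃ : r ≠ x := by omega
          simp [exec, h₁, h₂, hr₅ r hr (by omega), h₃, hr₂ r hr hrt]
    obtain ⟨σ₂, h₂, hpc₂, hR₂, hv₂, hi₂, hr₂⟩ := key _ le_rfl
    have h₃ := hP₃.steps (w := w) hpc₂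
    simp only [exec, hv₂, hi₂, lt_irrefl, if_false] at h₃
    have h₄ := hP₃.tail.steps (w := w) (s := ⟨σ₂.pc + 1, σ₂.reg, σ₂.mem⟩) (by simp [hpc₂])
    refine ⟨_, h₁.trans ((hP₂.steps hpc₁).trans (h₂.trans (h₃.trans h₄))), ?_, ?_, ?_⟩
    · simp [exec, len]; omega
    · exact hR₂.congr (t := t) ht (fun _ _ => rfl) rfl
    · simpa [exec] using hr₂

end WordRAM

namespace WordRAM

/-! ### Reasoning about structured programs -/

namespace Stmt

/-- Whether a statement contains an assignment to a variable. -/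
def writesVar (y : ℕ) : Stmt → Bool
  | skip => false
  | assign x _ => x == y
  | put _ _ _ => false
  | seq c₁ c₂ => c₁.writesVar y || c₂.writesVar y
  | ifLt _ _ c₁ c₂ => c₁.writesVar y || c₂.writesVar y
  | loop x _ c => (x == y) || c.writesVar y

/-- Whether a statement contains a write access to an array. -/
def writesArr (g : ℕ) : Stmt → Bool
  | skip => false
  | assign _ _ => false
  | put g' _ _ => g' == g
  | seq c₁ c₂ => c₁.writesArr g || c₂.writesArr g
  | ifLt _ _ c₁ c₂ => c₁.writesArr g || c₂.writesArr g
  | loop _ _ c => c.writesArr g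

/-- Two states agree on everything that a statement does not write to. -/
structure Frame (c : Stmt) (s s' : State) : Prop where
  var : ∀ y, c.writesVar y = false → s'.var y = s.var y
  arr : ∀ g, c.writesArr g = false → s'.arr g = s.arr g

/-- What is preserved is read off the syntax, so for the concrete programs below it is settled by
evaluation (`rfl`), and specifications need to mention only what changes. -/
theorem Exec.frame {w U t : ℕ} {c : Stmt} {s s' : State} (h : c.Exec w U s t s') :
    c.Frame s s' := by
  induction h with
  | skip s => exact ⟨fun _ _ => rfl, fun _ _ => rfl⟩
  | assign x e s _ =>
    refine ⟨fun y hy => ?_, fun _ _ => rfl⟩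
    simp only [writesVar, beq_eq_false_iff_ne] at hy
    simp [hy.symm]
  | put g e₁ e₂ s =>
    refine ⟨fun _ _ => rfl, fun g' hg => ?_⟩
    simp only [writesArr, beq_eq_false_iff_ne] at hg
    simp [hg.symm]
  | seq _ _ ih₁ ih₂ =>
    constructor
    · intro y hy
      simp only [writesVar, Bool.or_eq_false_iff] at hy
      rw [ih₂.var y hy.2, ih₁.var y hy.1]
    · intro y hy
      simp only [writesArr, Bool.or_eq_false_iff] at hy
      rw [ih₂.arr y hy.2, ih₁.arr y hy.1]
  | ifTrue _ _ _ _ ih =>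
    constructor
    · intro y hy
      simp only [writesVar, Bool.or_eq_false_iff] at hy
      exact ih.var y hy.1
    · intro y hy
      simp only [writesArr, Bool.or_eq_false_iff] at hy
      exact ih.arr y hy.1
  | ifFalse _ _ _ _ ih =>
    constructor
    · intro y hy
      simp only [writesVar, Bool.or_eq_false_iff] at hy
      exact ih.var y hy.2
    · intro y hy
      simp only [writesArr, Bool.or_eq_false_iff] at hy
      exact ih.arr y hy.2
  | @loop x e c s f τ _ hf _ ih =>
    constructor
    · intro y hy
      simp only [writesVar, Bool.or_eq_false_iff, beq_eq_false_iff_ne] at hy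
      have : ∀ i ≤ e.eval s, (f i).var y = s.var y := by
        intro i
        induction i with
        | zero => simp [hf]
        | succ i ihi =>
          intro hi
          rw [(ih i (by omega)).var y hy.2, State.set_var, if_neg hy.1.symm, ihi (by omega)]
      exact this _ le_rfl
    · intro g hg
      have : ∀ i ≤ e.eval s, (f i).arr g = s.arr g := by
        intro i
        induction i with
        | zero => simp [hf]
        | succ i ihi =>
          intro hi
          rw [(ih i (by omega)).arr g hg, State.set_arr, ihi (by omega)]
      exact this _ le_rfl

/-- Total correctness: started in `s`, the statement `c` ends, without overflows, in a state
with the property `Q`. -/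
def Total (w U : ℕ) (c : Stmt) (s : State) (Q : State → Prop) : Prop :=
  ∃ t s', c.Exec w U s t s' ∧ Q s'

variable {w U : ℕ} {s : State} {Q : State → Prop}

theorem Total.mono {c : Stmt} {Q' : State → Prop} (h : Total w U c s Q)
    (hQ : ∀ s', c.Frame s s' → Q s' → Q' s') : Total w U c s Q' := by
  obtain ⟨t, s', he, hs⟩ := h
  exact ⟨t, s', he, hQ s' he.frame hs⟩

theorem total_skip : Total w U skip s Q ↔ Q s := by
  constructor
  · rintro ⟨t, s', h, hQ⟩
    cases h
    exact hQ
  · exact fun h => ⟨_, _, .skip s, h⟩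

theorem total_assign {x : ℕ} {e : Expr} :
    Total w U (assign x e) s Q ↔ e.Safe w U s ∧ Q (s.set x (e.eval s)) := by
  constructor
  · rintro ⟨t, s', h, hQ⟩
    cases h
    exact ⟨by assumption, hQ⟩
  · exact fun h => ⟨_, _, .assign x e s h.1, h.2⟩

theorem total_put {g : ℕ} {e₁ e₂ : Expr} :
    Total w U (put g e₁ e₂) s Q ↔ e₁.Safe w U s ∧ e₂.Safe w U s ∧ e₁.eval s < U ∧
      Q (s.put g (e₁.eval s) (e₂.eval s)) := by
  constructor
  · rintro ⟨t, s', h, hQ⟩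
    cases h
    exact ⟨by assumption, by assumption, by assumption, hQ⟩
  · exact fun h => ⟨_, _, .put g e₁ e₂ s h.1 h.2.1 h.2.2.1, h.2.2.2⟩

theorem total_seq {c₁ c₂ : Stmt} :
    Total w U (seq c₁ c₂) s Q ↔ Total w U c₁ s fun s₁ => Total w U c₂ s₁ Q := by
  constructor
  · rintro ⟨t, s', h, hQ⟩
    cases h with
    | seq h₁ h₂ => exact ⟨_, _, h₁, _, _, h₂, hQ⟩
  · rintro ⟨t₁, s₁, h₁, t₂, s₂, h₂, hQ⟩
    exact ⟨_, _, .seq h₁ h₂, hQ⟩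

theorem total_ifLt {a b : Expr} {c₁ c₂ : Stmt} :
    Total w U (ifLt a b c₁ c₂) s Q ↔ a.Safe w U s ∧ b.Safe w U s ∧
      (a.eval s < b.eval s → Total w U c₁ s Q) ∧ (¬ a.eval s < b.eval s → Total w U c₂ s Q) := by
  constructor
  · rintro ⟨t, s', h, hQ⟩
    cases h with
    | ifTrue ha hb hlt hc => exact ⟨ha, hb, fun _ => ⟨_, _, hc, hQ⟩, fun h => absurd hlt h⟩
    | ifFalse ha hb hlt hc => exact ⟨ha, hb, fun h => absurd h hlt, fun _ => ⟨_, _, hc, hQ⟩⟩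
  · rintro ⟨ha, hb, h₁, h₂⟩
    by_cases hlt : a.eval s < b.eval s
    · obtain ⟨t, s', h, hQ⟩ := h₁ hlt
      exact ⟨_, _, .ifTrue ha hb hlt h, hQ⟩
    · obtain ⟨t, s', h, hQ⟩ := h₂ hlt
      exact ⟨_, _, .ifFalse ha hb hlt h, hQ⟩

theorem Total.loop {x : ℕ} {e : Expr} {c : Stmt} (I : ℕ → State → Prop) (he : e.Safe w U s)
    (h₀ : I 0 s)
    (hI : ∀ i < e.eval s, ∀ s', (Stmt.loop x e c).Frame s s' → I i s' →
      Total w U c (s'.set x i) (I (i + 1)))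
    (hQ : ∀ s', (Stmt.loop x e c).Frame s s' → I (e.eval s) s' → Q s') :
    Total w U (Stmt.loop x e c) s Q := by
  -- The constructor `Exec.loop` takes the whole sequence of states as a function. Successors are
  -- chosen for all states, with a dummy where the invariant fails, and then iterated.
  have step : ∀ i, ∀ s', ∃ r : ℕ × State, i < e.eval s → (Stmt.loop x e c).Frame s s' → I i s' →
      c.Exec w U (s'.set x i) r.1 r.2 ∧ I (i + 1) r.2 := by
    intro i s'
    by_cases h : i < e.eval s ∧ (Stmt.loop x e c).Frame s s' ∧ I i s'
    · obtain ⟨t, s'', h₁, h₂⟩ := hI i h.1 s' h.2.1 h.2.2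
      exact ⟨(t, s''), fun _ _ _ => ⟨h₁, h₂⟩⟩
    · exact ⟨(0, s), fun h₁ h₂ h₃ => absurd ⟨h₁, h₂, h₃⟩ h⟩
  choose r hr using step
  let f : ℕ → State := fun i => Nat.rec s (fun i s' => (r i s').2) i
  have hf : ∀ i ≤ e.eval s, (Stmt.loop x e c).Frame s (f i) ∧ I i (f i) := by
    intro i
    induction i with
    | zero => exact fun _ => ⟨⟨fun _ _ => rfl, fun _ _ => rfl⟩, h₀⟩
    | succ i ih =>
      intro hi
      obtain ⟨hF, hIi⟩ := ih (by omega)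
      obtain ⟨h₁, h₂⟩ := hr i (f i) (by omega) hF hIi
      have h₃ := h₁.frame
      refine ⟨⟨fun y hy => ?_, fun g hg => ?_⟩, h₂⟩
      · have hy' := hy
        simp only [writesVar, Bool.or_eq_false_iff, beq_eq_false_iff_ne] at hy'
        exact (h₃.var y hy'.2).trans ((by simp [hy'.1.symm] : _ = (f i).var y).trans (hF.var y hy))
      · exact (h₃.arr g hg).trans (hF.arr g hg)
  refine ⟨_, _, .loop f (fun i => (r i (f i)).1) he rfl ?_, hQ _ (hf _ le_rfl).1 (hf _ le_rfl).2⟩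
  intro i hi
  exact (hr i (f i) hi (hf i hi.le).1 (hf i hi.le).2).1

/-! ### Running times -/

end Stmt

/-- The value of an expression that is a constant or a variable, given the variables. -/
def Expr.bound (v : ℕ → ℕ) : Expr → ℕ
  | var x => v x
  | const c => c
  | _ => 0

/-- The expression is a constant or a variable in `K`. -/
def Expr.Static (K : ℕ → Bool) : Expr → Bool
  | var x => K x
  | const _ => true
  | _ => false

namespace Stmt

/-- A bound on the running time, provided that all loops are bounded by constants and by
variables, whose values are given by `v`, that do not change. -/
def time (v : ℕ → ℕ) : Stmt → ℕ
  | skip => 0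
  | assign _ e => e.len + 1
  | put _ e₁ e₂ => e₁.len + (e₂.len + 4)
  | seq c₁ c₂ => c₁.time v + c₂.time v
  | ifLt a b c₁ c₂ => a.len + (b.len + (1 + (c₁.time v + (c₂.time v + 1))))
  | loop _ e c => e.len + (1 + (e.bound v * (c.time v + 5) + 2))

/-- The bounds of the loops are constants and variables in `K`, and no variable in `K` is
written. -/
def Static (K : ℕ → Bool) : Stmt → Bool
  | skip => true
  | assign x _ => !K x
  | put _ _ _ => true
  | seq c₁ c₂ => c₁.Static K && c₂.Static K
  | ifLt _ _ c₁ c₂ => c₁.Static K && c₂.Static K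
  | loop x e c => (!K x) && (e.Static K && c.Static K)

/-- Since the variables in `K` never change, every loop bound is known in advance and all iterations
of a loop obey the same bound. A conditional is charged for both branches. Thus the running time
needs no invariant. -/
theorem Exec.le_time {w U t : ℕ} {c : Stmt} {s s' : State} (h : c.Exec w U s t s')
    {K : ℕ → Bool} (hK : c.Static K = true) {v : ℕ → ℕ} (hv : ∀ x, K x = true → s.var x = v x) :
    t ≤ c.time v ∧ ∀ x, K x = true → s'.var x = v x := by
  induction h with
  | skip s => exact ⟨le_rfl, hv⟩
  | assign x e s _ =>
    simp only [Static, Bool.not_eq_true'] at hK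
    refine ⟨le_rfl, fun y hy => ?_⟩
    have : y ≠ x := by rintro rfl; simp [hy] at hK
    simp [this, hv y hy]
  | put g e₁ e₂ s => exact ⟨le_rfl, hv⟩
  | seq _ _ ih₁ ih₂ =>
    simp only [Static, Bool.and_eq_true] at hK
    obtain ⟨h₁, hv₁⟩ := ih₁ hK.1 hv
    obtain ⟨h₂, hv₂⟩ := ih₂ hK.2 hv₁
    exact ⟨add_le_add h₁ h₂, hv₂⟩
  | ifTrue _ _ _ _ ih =>
    simp only [Static, Bool.and_eq_true] at hK
    obtain ⟨h₁, hv₁⟩ := ih hK.1 hv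
    exact ⟨by simp only [time]; omega, hv₁⟩
  | ifFalse _ _ _ _ ih =>
    simp only [Static, Bool.and_eq_true] at hK
    obtain ⟨h₁, hv₁⟩ := ih hK.2 hv
    exact ⟨by simp only [time]; omega, hv₁⟩
  | @loop x e c s f τ _ hf _ ih =>
    simp only [Static, Bool.and_eq_true, Bool.not_eq_true'] at hK
    obtain ⟨hx, he, hc⟩ := hK
    have hfv : ∀ i ≤ e.eval s, ∀ y, K y = true → (f i).var y = v y := by
      intro i
      induction i with
      | zero => exact fun _ => hf ▸ hv
      | succ i ihi =>
        intro hi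
        refine (ih i (by omega) hc fun y hy => ?_).2
        have : y ≠ x := by rintro rfl; simp [hy] at hx
        simp [this, ihi (by omega) y hy]
    refine ⟨?_, hfv _ le_rfl⟩
    have hb : e.eval s = e.bound v := by
      cases e with
      | var y => exact hv y he
      | const c => rfl
      | bin => simp [Expr.Static] at he
      | get => simp [Expr.Static] at he
    have hsum : ∑ i ∈ Finset.range (e.eval s), (τ i + 5) ≤ e.eval s * (c.time v + 5) := by
      rw [← smul_eq_mul, ← Finset.card_range (e.eval s), Finset.card_range]
      conv_rhs => rw [← Finset.card_range (e.eval s)]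
      refine Finset.sum_le_card_nsmul _ _ _ fun i hi => ?_
      rw [Finset.mem_range] at hi
      have := (ih i hi hc fun y hy => ?_).1
      · omega
      · have : y ≠ x := by rintro rfl; simp [hy] at hx
        simp [this, hfv i hi.le y hy]
    simp only [time]
    rw [hb] at hsum ⊢
    omega

end Stmt

/-! ### Notation for expressions -/

namespace Expr

instance : Add Expr := ⟨bin .add⟩
instance : Sub Expr := ⟨bin .sub⟩
instance : Mul Expr := ⟨bin .mul⟩
instance : Div Expr := ⟨bin .div⟩
instance : Mod Expr := ⟨bin .mod⟩

variable (w U : ℕ) (s : State) (a b : Expr)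

@[simp] theorem eval_var (x : ℕ) : (var x).eval s = s.var x := rfl
@[simp] theorem eval_const (c : ℕ) : (const c).eval s = c := rfl
@[simp] theorem eval_get (g : ℕ) : (get g a).eval s = s.arr g (a.eval s) := rfl
@[simp] theorem eval_add : (a + b).eval s = a.eval s + b.eval s := rfl
@[simp] theorem eval_sub : (a - b).eval s = a.eval s - b.eval s := rfl
@[simp] theorem eval_mul : (a * b).eval s = a.eval s * b.eval s := rfl
@[simp] theorem eval_div : (a / b).eval s = a.eval s / b.eval s := rfl
@[simp] theorem eval_mod : (a % b).eval s = a.eval s % b.eval s := rfl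
@[simp] theorem eval_shr : (bin .shr a b).eval s = a.eval s / 2 ^ b.eval s := rfl

@[simp] theorem safe_var (x : ℕ) : (var x).Safe w U s ↔ True := Iff.rfl
@[simp] theorem safe_const (c : ℕ) : (const c).Safe w U s ↔ c < 2 ^ w := Iff.rfl
@[simp] theorem safe_get (g : ℕ) :
    (get g a).Safe w U s ↔ a.Safe w U s ∧ a.eval s < U := Iff.rfl
@[simp] theorem safe_add : (a + b).Safe w U s ↔
    a.Safe w U s ∧ b.Safe w U s ∧ a.eval s + b.eval s < 2 ^ w := Iff.rfl
@[simp] theorem safe_sub : (a - b).Safe w U s ↔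
    a.Safe w U s ∧ b.Safe w U s ∧ b.eval s ≤ a.eval s := Iff.rfl
@[simp] theorem safe_mul : (a * b).Safe w U s ↔
    a.Safe w U s ∧ b.Safe w U s ∧ a.eval s * b.eval s < 2 ^ w := Iff.rfl
@[simp] theorem safe_div : (a / b).Safe w U s ↔ a.Safe w U s ∧ b.Safe w U s ∧ True := Iff.rfl
@[simp] theorem safe_mod : (a % b).Safe w U s ↔ a.Safe w U s ∧ b.Safe w U s ∧ True := Iff.rfl
@[simp] theorem safe_shr : (bin .shr a b).Safe w U s ↔
    a.Safe w U s ∧ b.Safe w U s ∧ True := Iff.rfl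

end Expr

/-- Sequential composition. -/
infixr:55 " ;; " => Stmt.seq

end WordRAM

namespace NestedBoxes

open WordRAM WordRAM.Stmt WordRAM.Expr

/-! ### The program -/

/-- Register `0` receives `n` and finally the answer. The constants that the table depends on are
exactly the registers below `5`, which is how `TableEnv.congr` refers to them. -/
abbrev rN : ℕ := 0
abbrev rSize : ℕ := 1
abbrev rLevels : ℕ := 2
abbrev rLevelCodes : ℕ := 3
abbrev rCodes : ℕ := 4
abbrev rBox : ℕ := 5
abbrev rNode : ℕ := 6
abbrev rLeft : ℕ := 7
abbrev rRight : ℕ := 8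
abbrev rWinner : ℕ := 9
abbrev rCount : ℕ := 10
abbrev rKeyBase : ℕ := 11
abbrev rKeyStep : ℕ := 12
abbrev rRank : ℕ := 13
abbrev rLast : ℕ := 14
abbrev rCoord : ℕ := 15
abbrev rAnswer : ℕ := 16
abbrev rCode : ℕ := 17
abbrev rBest : ℕ := 18
abbrev rLevelCode : ℕ := 19
abbrev rAddress : ℕ := 20
abbrev rRest : ℕ := 21
abbrev rLevel : ℕ := 22
abbrev rDim : ℕ := 23
abbrev rKey : ℕ := 24
abbrev rPoint : ℕ := 25
abbrev rTuple : ℕ := 26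
abbrev rRotation : ℕ := 27
abbrev rValue : ℕ := 28
abbrev rStep : ℕ := 29
abbrev rTree : ℕ := 30

/-- Array `0` starts at address `0`, so the input is already in place. -/
abbrev aInput : ℕ := 0
abbrev aRank : ℕ := 1
abbrev aRankSum : ℕ := 2
abbrev aTree : ℕ := 3
abbrev aCandidate : ℕ := 4
abbrev aTable : ℕ := 5

/-- The key of a box, in the array `g`. -/
def keyExpr (g : ℕ) (e : Expr) : Expr := get g (var rKeyBase + e * var rKeyStep)

/-- Recompute the entries of the tournament tree above the node `rNode`. -/
def siftUp (g : ℕ) : Stmt :=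
  loop rStep (var rLevels) <|
    assign rNode (var rNode / const 2) ;;
    assign rLeft (get aTree (var rNode * const 2)) ;;
    assign rRight (get aTree (var rNode * const 2 + const 1)) ;;
    ifLt (const 0) (var rLeft)
      (ifLt (const 0) (var rRight)
        (ifLt (keyExpr g (var rRight - const 1)) (keyExpr g (var rLeft - const 1))
          (assign rWinner (var rRight)) (assign rWinner (var rLeft)))
        (assign rWinner (var rLeft)))
      (assign rWinner (var rRight)) ;;
    put aTree (var rNode) (var rWinner)

/-- Set the leaf of the box `rBox` in the tournament tree. -/
def setLeaf (g : ℕ) (e : Expr) : Stmt :=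
  assign rNode (var rTree + var rBox) ;;
  put aTree (var rNode) e ;;
  siftUp g

/-- Insert all boxes into the tournament tree. -/
def fill (g : ℕ) : Stmt := loop rBox (var rN) (setLeaf g (var rBox + const 1))

/-- Remove a box with minimum key from the tournament tree. -/
def pop (g : ℕ) : Stmt :=
  assign rBox (get aTree (const 1) - const 1) ;;
  setLeaf g (const 0)

/-- Remove a box from the tournament tree and compute its rank in the coordinate `rCoord`. -/
def rankNext (d : ℕ) : Stmt :=
  pop aInput ;;
  assign rLeft (keyExpr aInput (var rBox)) ;;
  ifLt (var rLast) (var rLeft)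
    (assign rRank (var rRank + const 1) ;; assign rLast (var rLeft)) skip ;;
  put aRank (var rBox * const d + var rCoord) (var rRank) ;;
  put aRankSum (var rBox) (get aRankSum (var rBox) + var rRank)

/-- Compute the ranks of the boxes in each coordinate, and their sums. -/
def ranks (d : ℕ) : Stmt :=
  loop rCoord (const d) <|
    assign rKeyBase (var rCoord) ;;
    assign rKeyStep (const d) ;;
    fill aInput ;;
    assign rRank (const 0) ;;
    assign rLast (const 0) ;;
    loop rCount (var rN) (rankNext d)

/-- Compute the address of a cell of the table. -/
def cellAddress (d g : ℕ) : Stmt :=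
  assign rAddress (var rKey) ;;
  assign rRest (var rLevelCode) ;;
  loop rDim (const d) (
    assign rLevel (var rRest % var rLevels) ;;
    assign rRest (var rRest / var rLevels) ;;
    assign rAddress (var rAddress * var rSize + var rLevel) ;;
    assign rAddress (var rAddress * var rSize +
      (bin .shr (get aRank (var rPoint * const d + var rDim) + const 1 - const g) (var rLevel) +
        const g)))

/-- The maximum value over the boxes that fit into the box `rPoint`. -/
def query (d : ℕ) : Stmt :=
  assign rBest (const 0) ;;
  loop rLevelCode (var rLevelCodes) (
    cellAddress d 0 ;;
    ifLt (var rBest) (get aTable (var rAddress))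
      (assign rBest (get aTable (var rAddress))) skip)

/-- Compute the values of the tuples that end with the box `rBox`. -/
def computeCandidates (d : ℕ) : Stmt :=
  loop rCode (var rCodes) (
    assign rKey (var rCode) ;;
    assign rPoint (var rBox) ;;
    query d ;;
    put aCandidate (var rCode) (var rBest + const 1) ;;
    ifLt (var rAnswer) (var rBest + const 1) (assign rAnswer (var rBest + const 1)) skip)

/-- Insert a value into the table. -/
def update (d : ℕ) : Stmt :=
  loop rLevelCode (var rLevelCodes) (
    cellAddress d 1 ;;
    ifLt (get aTable (var rAddress)) (var rValue) (put aTable (var rAddress) (var rValue)) skip)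

/-- Insert the values of the tuples that contain the box `rBox`. -/
def insertCandidates (k d : ℕ) : Stmt :=
  loop rCode (var rCodes) (
    assign rTuple (var rBox * var rCodes + var rCode) ;;
    assign rValue (get aCandidate (var rCode)) ;;
    loop rRotation (const (k + 1)) (
      assign rKey (var rTuple % var rCodes) ;;
      assign rPoint (var rTuple / var rCodes) ;;
      update d ;;
      assign rTuple (var rKey * var rN + var rPoint)))

/-- Compute the constants. -/
def prelude (k d : ℕ) : Stmt :=
  assign rSize (const 2 * var rN + const (d + 2)) ;;
  assign rTree (const 2) ;;
  assign rLevels (const 1) ;;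
  loop rCount (var rN) (
    ifLt (var rTree) (var rN + const 2)
      (assign rTree (var rTree * const 2) ;; assign rLevels (var rLevels + const 1)) skip) ;;
  assign rLevelCodes (const 1) ;;
  loop rCount (const d) (assign rLevelCodes (var rLevelCodes * var rLevels)) ;;
  assign rCodes (const 1) ;;
  loop rCount (const k) (assign rCodes (var rCodes * var rN))

/-- The dynamic program. -/
def solve (k d : ℕ) : Stmt :=
  assign rKeyBase (const 0) ;;
  assign rKeyStep (const 1) ;;
  fill aRankSum ;;
  loop rCount (var rN) (
    pop aRankSum ;;
    computeCandidates d ;;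
    insertCandidates k d)

/-- The part of the program that does not change the constants. -/
def body (k d : ℕ) : Stmt := ranks d ;; solve k d

/-! ### The tournament tree -/

/-- The winner of two entries of the tournament tree; `0` means that there is no candidate. -/
def winner (key : ℕ → ℕ) (a b : ℕ) : ℕ :=
  if 0 < a then if 0 < b then if key (b - 1) < key (a - 1) then b else a else a else b

theorem winner_le {key : ℕ → ℕ} {a b n : ℕ} (ha : a ≤ n) (hb : b ≤ n) : winner key a b ≤ n := by
  unfold winner
  split_ifs <;> assumption

/-- The entry `q` of the tournament tree is the winner of its two children. -/
def NodeOk (key T : ℕ → ℕ) (q : ℕ) : Prop := T q = winner key (T (2 * q)) (T (2 * q + 1))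

/-- The tournament tree `T` with `2 ^ L` leaves has the leaves `ℓ` and is correct. -/
structure IsTree (L : ℕ) (key T leaf : ℕ → ℕ) : Prop where
  node : ∀ q, 1 ≤ q → q < 2 ^ L → NodeOk key T q
  leaf : ∀ x < 2 ^ L, T (2 ^ L + x) = leaf x

/-- The key function in a state. -/
def keyOf (g : ℕ) (s : State) (x : ℕ) : ℕ := s.arr g (s.var rKeyBase + x * s.var rKeyStep)

variable {w U n L g : ℕ} {s : State}

/-- At first only the parent of the changed leaf can disagree with its children, and repairing a
node moves the only possible error to its parent. After `L` rounds that would be node `0`, which is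
not in the tree. -/
theorem siftUp_spec (hg : g ≠ aTree) (hU : U < 2 ^ w) (hLU : 2 ^ (L + 1) ≤ U)
    (hL : s.var rLevels = L)
    (hkey : ∀ x < n, s.var rKeyBase + x * s.var rKeyStep < U)
    (hp : 2 ^ L ≤ s.var rNode) (hp' : s.var rNode < 2 ^ (L + 1))
    (hT : ∀ q, s.arr aTree q ≤ n)
    (hok : ∀ q, 1 ≤ q → q < 2 ^ L → q ≠ s.var rNode / 2 → NodeOk (keyOf g s) (s.arr aTree) q) :
    Total w U (siftUp g) s fun s' =>
      (∀ q, 1 ≤ q → q < 2 ^ L → NodeOk (keyOf g s) (s'.arr aTree) q) ∧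
      (∀ q, 2 ^ L ≤ q → s'.arr aTree q = s.arr aTree q) ∧ ∀ q, s'.arr aTree q ≤ n := by
  -- The starting node is a leaf, so `L` halvings lead to the root.
  have hpL : s.var rNode / 2 ^ L = 1 :=
    Nat.div_eq_of_lt_le (by simpa using hp) (by rw [pow_succ] at hp'; omega)
  unfold siftUp
  refine Total.loop (fun i s' => s'.var rNode = s.var rNode / 2 ^ i ∧
    (∀ q, 1 ≤ q → q < 2 ^ L → q ≠ s.var rNode / 2 ^ (i + 1) →
      NodeOk (keyOf g s) (s'.arr aTree) q) ∧
    (∀ q, 2 ^ L ≤ q → s'.arr aTree q = s.arr aTree q) ∧ ∀ q, s'.arr aTree q ≤ n)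
    trivial ⟨by simp, by simpa using hok, fun _ _ => rfl, hT⟩ ?_ ?_
  · intro i hi s₁ hF ⟨hnode, hok₁, hleaf, hT₁⟩
    rw [eval_var, hL] at hi
    have hbase := hF.var rKeyBase rfl
    have hstep := hF.var rKeyStep rfl
    have harr := hF.arr g (by simp [writesArr]; exact hg.symm)
    set p := s.var rNode / 2 ^ (i + 1) with hpdef
    have hpp : s₁.var rNode / 2 = p := by rw [hnode, hpdef, pow_succ, Nat.div_div_eq_div_mul]
    have hp1 : 1 ≤ p := by
      rw [hpdef, Nat.le_div_iff_mul_le (by positivity), one_mul]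
      exact (Nat.pow_le_pow_right (by norm_num) hi).trans hp
    have hp2 : p < 2 ^ L := by
      rw [hpdef, Nat.div_lt_iff_lt_mul (by positivity)]
      calc _ < 2 ^ (L + 1) := hp'
        _ ≤ 2 ^ L * 2 ^ (i + 1) := by
          rw [← pow_add]; exact Nat.pow_le_pow_right (by norm_num) (by omega)
    have hpU : 2 * p + 1 < U := by rw [pow_succ] at hLU; omega
    have hpost : ∀ (s₂ : State) (v : ℕ), s₂.var rNode = p → s₂.arr = s₁.arr →
        v = winner (keyOf g s) (s₁.arr aTree (2 * p)) (s₁.arr aTree (2 * p + 1)) →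
        (s₂.put aTree p v).var rNode = p ∧
        (∀ q, 1 ≤ q → q < 2 ^ L → q ≠ s.var rNode / 2 ^ (i + 1 + 1) →
          NodeOk (keyOf g s) ((s₂.put aTree p v).arr aTree) q) ∧
        (∀ q, 2 ^ L ≤ q → (s₂.put aTree p v).arr aTree q = s.arr aTree q) ∧
        ∀ q, (s₂.put aTree p v).arr aTree q ≤ n := by
      intro s₂ v h₁ h₂ h₃
      have hv : v ≤ n := h₃ ▸ winner_le (hT₁ _) (hT₁ _)
      simp only [State.put_var, h₁, State.put_arr, if_true, h₂, true_and]
      refine ⟨fun q hq1 hq2 hqp => ?_, fun q hq => ?_, fun q => ?_⟩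
      · rw [pow_succ, ← Nat.div_div_eq_div_mul, ← hpdef] at hqp
        unfold NodeOk
        rw [Function.update_of_ne (show 2 * q ≠ p by omega),
          Function.update_of_ne (show 2 * q + 1 ≠ p by omega)]
        by_cases hq : q = p
        · rw [hq, Function.update_self, h₃]
        · rw [Function.update_of_ne hq]
          exact hok₁ q hq1 hq2 hq
      · rw [Function.update_of_ne (by omega), hleaf q hq]
      · rw [Function.update_apply]
        split_ifs
        · exact hv
        · exact hT₁ q
    have hk : ∀ q, 0 < s₁.arr aTree q →
        ((1 ≤ s₁.arr aTree q ∧ (s₁.arr aTree q - 1) * s₁.var rKeyStep < 2 ^ w) ∧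
          s₁.var rKeyBase + (s₁.arr aTree q - 1) * s₁.var rKeyStep < 2 ^ w) ∧
          s₁.var rKeyBase + (s₁.arr aTree q - 1) * s₁.var rKeyStep < U := by
      intro q hq
      have := hkey (s₁.arr aTree q - 1) (by have := hT₁ q; omega)
      rw [hbase, hstep]
      omega
    have hkeyOf : ∀ x, s₁.arr g (s₁.var rKeyBase + x * s₁.var rKeyStep) = keyOf g s x := by
      intro x
      rw [keyOf, hbase, hstep, harr]
    have hpow : 2 < 2 ^ w ∧ ((2 < 2 ^ w ∧ 2 * p < 2 ^ w) ∧ 2 * p < U) ∧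
      (((2 < 2 ^ w ∧ 2 * p < 2 ^ w) ∧ 1 < 2 ^ w ∧ 2 * p + 1 < 2 ^ w) ∧ 2 * p + 1 < U) ∧
        0 < 2 ^ w ∧ p < U := by omega
    simp +decide only [keyExpr, total_seq, total_assign, total_put, total_ifLt, eval_var, eval_const,
      eval_get, eval_add, eval_sub, eval_mul, eval_div, safe_var, safe_const, safe_get, safe_add,
      safe_sub, safe_mul, safe_div, State.set_var, State.set_arr, if_true, if_false, true_and,
      and_true, hpp, hkeyOf, mul_comm p 2, hpow]
    have ha := hk (2 * p)
    have hb := hk (2 * p + 1)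
    refine ⟨fun h₁ => ⟨fun h₂ => ⟨hb h₂, ha h₁, fun h₃ => ?_, fun h₃ => ?_⟩, fun h₂ => ?_⟩,
      fun h₁ => ?_⟩
    all_goals
      refine hpost _ _ ?_ ?_ ?_
      · simp +decide
      · simp
      · unfold winner
        split_ifs <;> first | rfl | contradiction
  · intro s' hF ⟨_, hok', h⟩
    rw [eval_var, hL] at hok'
    refine ⟨fun q h1 h2 => hok' q h1 h2 ?_, h⟩
    rw [pow_succ, ← Nat.div_div_eq_div_mul, hpL]
    omega

/-- The constants that the tournament tree of the keys in the array `g` depends on. -/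
structure TreeEnv (w U n L g : ℕ) (s : State) : Prop where
  ne : g ≠ aTree
  hU : U < 2 ^ w
  hLU : 2 ^ (L + 1) ≤ U
  hn : n < 2 ^ L
  levels : s.var rLevels = L
  tree : s.var rTree = 2 ^ L
  boxes : s.var rN = n
  key_lt : ∀ x < n, s.var rKeyBase + x * s.var rKeyStep < U

theorem TreeEnv.congr {s' : State} (h : TreeEnv w U n L g s) (h₁ : s'.var rLevels = s.var rLevels)
    (h₂ : s'.var rTree = s.var rTree) (h₃ : s'.var rKeyBase = s.var rKeyBase)
    (h₄ : s'.var rKeyStep = s.var rKeyStep) (h₅ : s'.var rN = s.var rN) :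
    TreeEnv w U n L g s' where
  ne := h.ne
  hU := h.hU
  hLU := h.hLU
  hn := h.hn
  levels := h₁.trans h.levels
  tree := h₂.trans h.tree
  boxes := h₅.trans h.boxes
  key_lt := by rw [h₃, h₄]; exact h.key_lt

/-- The tournament tree contains the boxes in `A`. -/
structure HasTree (n L : ℕ) (key T : ℕ → ℕ) (A : Finset ℕ) : Prop where
  isTree : IsTree L key T fun x => if x ∈ A then x + 1 else 0
  le : ∀ q, T q ≤ n
  lt : ∀ x ∈ A, x < n

/-- Insertion and deletion are treated together: `A'` may differ from `A` only in whether it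
contains the box `rBox`. -/
theorem setLeaf_spec {e : Expr} {A A' : Finset ℕ} (hE : TreeEnv w U n L g s)
    (hA : HasTree n L (keyOf g s) (s.arr aTree) A) (hx : s.var rBox < n)
    (he : ∀ y, e.Safe w U (s.set rNode y) ∧
      e.eval (s.set rNode y) = if s.var rBox ∈ A' then s.var rBox + 1 else 0)
    (hA' : ∀ y < n, y ≠ s.var rBox → (y ∈ A' ↔ y ∈ A)) (hA'' : ∀ y ∈ A', y < n) :
    Total w U (setLeaf g e) s fun s' => HasTree n L (keyOf g s) (s'.arr aTree) A' := by
  obtain ⟨hg, hU, hLU, hn, hL, hT, -, hkey⟩ := hE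
  have hpow : 2 ^ (L + 1) = 2 * 2 ^ L := by ring
  have hlt : 2 ^ L + s.var rBox < U := by omega
  have hlt' : 2 ^ L + s.var rBox < 2 ^ w := by omega
  have hle : (if s.var rBox ∈ A' then s.var rBox + 1 else 0) ≤ n := by split_ifs <;> omega
  unfold setLeaf
  rw [total_seq, total_assign, total_seq, total_put]
  simp +decide only [eval_var, eval_add, safe_var, safe_add, State.set_var, if_true, true_and, he,
    hT, hlt, hlt']
  have hk : keyOf g (((s.set rNode (2 ^ L + s.var rBox)).put aTree (2 ^ L + s.var rBox)
      (if s.var rBox ∈ A' then s.var rBox + 1 else 0))) = keyOf g s := by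
    funext x
    simp +decide [keyOf, hg]
  refine (siftUp_spec (n := n) (L := L) hg hU hLU ?_ ?_ ?_ ?_ ?_ ?_).mono ?_
  · simpa +decide using hL
  · simpa +decide using hkey
  · simp +decide
  · simp +decide only [State.put_var, State.set_var, if_true]; omega
  · intro q
    simp only [State.put_arr, if_true, Function.update_apply, State.set_arr]
    split_ifs
    · omega
    · omega
    · exact hA.le q
  · intro q hq1 hq2 hqp
    rw [hk]
    simp +decide only [State.put_var, State.set_var, if_true] at hqp
    simp only [State.put_arr, if_true, State.set_arr]
    unfold NodeOk
    rw [Function.update_of_ne (by omega), Function.update_of_ne (by omega),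
      Function.update_of_ne (by omega)]
    exact hA.isTree.node q hq1 hq2
  · intro s' _ ⟨h₁, h₂, h₃⟩
    rw [hk] at h₁
    refine ⟨⟨h₁, fun x hx' => ?_⟩, h₃, hA''⟩
    rw [h₂ _ (by omega)]
    simp only [State.put_arr, if_true, State.set_arr]
    by_cases hxb : x = s.var rBox
    · rw [hxb, Function.update_self]
    · rw [Function.update_of_ne (by omega), hA.isTree.leaf x hx']
      by_cases hxn : x < n
      · simp only [hA' x hxn hxb]
      · rw [if_neg fun h => hxn (hA.lt x h), if_neg fun h => hxn (hA'' x h)]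

/-- Induction on the height `ℓ` of the node `q`; the leaves below it are the `x` with `(2 ^ L + x) /
2 ^ ℓ = q`, and they split into those below `2 * q` and those below `2 * q + 1`. The entry `0` means
that no box of `A` lies below. -/
theorem IsTree.subtree {key T : ℕ → ℕ} {A : Finset ℕ}
    (h : IsTree L key T fun x => if x ∈ A then x + 1 else 0) (ℓ : ℕ) (hℓ : ℓ ≤ L) (q : ℕ)
    (hq : 2 ^ L ≤ q * 2 ^ ℓ) (hq' : q * 2 ^ ℓ < 2 * 2 ^ L) :
    (T q = 0 → ∀ x < 2 ^ L, (2 ^ L + x) / 2 ^ ℓ = q → x ∉ A) ∧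
    (T q ≠ 0 → T q - 1 ∈ A ∧
      ∀ x < 2 ^ L, (2 ^ L + x) / 2 ^ ℓ = q → x ∈ A → key (T q - 1) ≤ key x) := by
  induction ℓ generalizing q with
  | zero =>
    rw [pow_zero, mul_one] at hq hq'
    obtain ⟨y, rfl⟩ := Nat.exists_eq_add_of_le hq
    have hT : T (2 ^ L + y) = if y ∈ A then y + 1 else 0 := h.leaf y (by omega)
    simp only [pow_zero, Nat.div_one, Nat.add_left_cancel_iff]
    rw [hT]
    split_ifs with hy
    · exact ⟨fun h => absurd h (by simp), fun _ => ⟨by simpa using hy, by rintro x _ rfl _; simp⟩⟩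
    · refine ⟨by rintro _ x _ rfl; exact hy, fun h => absurd rfl h⟩
  | succ ℓ ih =>
    have h2 : ∀ r : ℕ, r * 2 ^ (ℓ + 1) = (2 * r) * 2 ^ ℓ := fun r => by ring
    rw [h2] at hq hq'
    have hpos : 0 < 2 ^ ℓ := by positivity
    have hLℓ : 2 ^ L = 2 ^ (L - ℓ) * 2 ^ ℓ := by rw [← pow_add]; congr 1; omega
    have hLe : 2 ^ (L - ℓ) = 2 * 2 ^ (L - ℓ - 1) := by rw [← pow_succ']; congr 1; omega
    have hqL : 2 * q < 2 * 2 ^ (L - ℓ) := by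
      rw [hLℓ, ← mul_assoc] at hq'
      exact Nat.lt_of_mul_lt_mul_right hq'
    have hLL : 2 ^ (L - ℓ) ≤ 2 ^ L := Nat.pow_le_pow_right (by norm_num) (by omega)
    have hq1 : 1 ≤ q := by
      by_contra h0
      have : q = 0 := by omega
      subst this
      have : 0 < 2 ^ L := by positivity
      omega
    have hright : (2 * q + 1) * 2 ^ ℓ < 2 * 2 ^ L := by
      rw [hLℓ, ← mul_assoc]
      exact Nat.mul_lt_mul_of_pos_right (by omega) hpos
    obtain ⟨a0, a1⟩ := ih (by omega) (2 * q) hq hq'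
    obtain ⟨b0, b1⟩ := ih (by omega) (2 * q + 1) (by rw [add_mul]; omega) hright
    have hdiv : ∀ x, (2 ^ L + x) / 2 ^ (ℓ + 1) = q →
        (2 ^ L + x) / 2 ^ ℓ = 2 * q ∨ (2 ^ L + x) / 2 ^ ℓ = 2 * q + 1 := by
      intro x hx
      rw [pow_succ, ← Nat.div_div_eq_div_mul] at hx
      omega
    rw [h.node q hq1 (by omega)]
    unfold winner
    split_ifs with h₁ h₂ h₃
    · obtain ⟨bA, bm⟩ := b1 (by omega)
      obtain ⟨aA, am⟩ := a1 (by omega)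
      refine ⟨by omega, fun _ => ⟨bA, fun x hx hxq hxA => ?_⟩⟩
      rcases hdiv x hxq with hh | hh
      · exact h₃.le.trans (am x hx hh hxA)
      · exact bm x hx hh hxA
    · obtain ⟨bA, bm⟩ := b1 (by omega)
      obtain ⟨aA, am⟩ := a1 (by omega)
      refine ⟨by omega, fun _ => ⟨aA, fun x hx hxq hxA => ?_⟩⟩
      rcases hdiv x hxq with hh | hh
      · exact am x hx hh hxA
      · exact (not_lt.1 h₃).trans (bm x hx hh hxA)
    · obtain ⟨aA, am⟩ := a1 (by omega)
      refine ⟨by omega, fun _ => ⟨aA, fun x hx hxq hxA => ?_⟩⟩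
      rcases hdiv x hxq with hh | hh
      · exact am x hx hh hxA
      · exact absurd hxA (b0 (by omega) x hx hh)
    · refine ⟨fun h₀ x hx hxq hxA => ?_, fun h₀ => ?_⟩
      · rcases hdiv x hxq with hh | hh
        · exact a0 (by omega) x hx hh hxA
        · exact b0 h₀ x hx hh hxA
      · obtain ⟨bA, bm⟩ := b1 h₀
        refine ⟨bA, fun x hx hxq hxA => ?_⟩
        rcases hdiv x hxq with hh | hh
        · exact absurd hxA (a0 (by omega) x hx hh)
        · exact bm x hx hh hxA

theorem HasTree.root {key T : ℕ → ℕ} {A : Finset ℕ} (h : HasTree n L key T A) (hn : n < 2 ^ L)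
    (hA : A.Nonempty) : T 1 ≠ 0 ∧ T 1 - 1 ∈ A ∧ ∀ x ∈ A, key (T 1 - 1) ≤ key x := by
  obtain ⟨h₀, h₁⟩ := h.isTree.subtree L le_rfl 1 (by simp)
    (by have : 0 < 2 ^ L := by positivity
        omega)
  have hdiv : ∀ x ∈ A, x < 2 ^ L ∧ (2 ^ L + x) / 2 ^ L = 1 := by
    intro x hx
    have := h.lt x hx
    refine ⟨by omega, ?_⟩
    rw [Nat.add_div_left _ (by positivity), Nat.div_eq_of_lt (by omega)]
  obtain ⟨y, hy⟩ := hA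
  have hT : T 1 ≠ 0 := fun hT => h₀ hT y (hdiv y hy).1 (hdiv y hy).2 hy
  exact ⟨hT, (h₁ hT).1, fun x hx => (h₁ hT).2 x (hdiv x hx).1 (hdiv x hx).2 hx⟩

/-- The tournament tree is empty. -/
def EmptyTree (n L : ℕ) (T : ℕ → ℕ) : Prop :=
  (∀ q, 1 ≤ q → q < 2 ^ (L + 1) → T q = 0) ∧ ∀ q, T q ≤ n

theorem EmptyTree.hasTree {T : ℕ → ℕ} (h : EmptyTree n L T) (key : ℕ → ℕ) :
    HasTree n L key T ∅ := by
  have hpow : 2 ^ (L + 1) = 2 * 2 ^ L := by ring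
  refine ⟨⟨fun q h1 h2 => ?_, fun x hx => ?_⟩, h.2, by simp⟩
  · rw [NodeOk, h.1 q h1 (by omega), h.1 _ (by omega) (by omega), h.1 _ (by omega) (by omega)]
    rfl
  · have : 0 < 2 ^ L := by positivity
    simpa using h.1 (2 ^ L + x) (by omega) (by omega)

/-- Once all boxes have been removed the tree is zero again and can serve for the next sort without
being cleared. The induction goes from the leaves to the root, on the distance `2 ^ (L + 1) - q`. -/
theorem HasTree.emptyTree {key T : ℕ → ℕ} (h : HasTree n L key T ∅) : EmptyTree n L T := by
  refine ⟨?_, h.le⟩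
  have hpow : 2 ^ (L + 1) = 2 * 2 ^ L := by ring
  have key : ∀ m q, q + m = 2 ^ (L + 1) → 1 ≤ q → 1 ≤ m → T q = 0 := by
    intro m
    induction m using Nat.strong_induction_on with
    | _ m ih =>
      intro q hqm hq hm
      by_cases hqL : q < 2 ^ L
      · rw [h.isTree.node q hq hqL, ih (2 ^ (L + 1) - 2 * q) (by omega) (2 * q) (by omega) (by omega)
          (by omega), ih (2 ^ (L + 1) - (2 * q + 1)) (by omega) (2 * q + 1) (by omega) (by omega)
          (by omega)]
        rfl
      · have := h.isTree.leaf (q - 2 ^ L) (by omega)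
        rwa [show 2 ^ L + (q - 2 ^ L) = q by omega] at this
  exact fun q h1 h2 => key (2 ^ (L + 1) - q) q (by omega) h1 (by omega)

theorem fill_spec (hE : TreeEnv w U n L g s) (h : EmptyTree n L (s.arr aTree)) :
    Total w U (fill g) s fun s' => HasTree n L (keyOf g s) (s'.arr aTree) (Finset.range n) := by
  refine Total.loop (fun i s' => i ≤ n → HasTree n L (keyOf g s) (s'.arr aTree) (Finset.range i))
    trivial (fun _ => by simpa using h.hasTree _) ?_ ?_
  · intro i hi s₁ hF hI
    rw [eval_var, hE.boxes] at hi
    have hk : keyOf g (s₁.set rBox i) = keyOf g s := by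
      funext x
      simp +decide [keyOf, hF.var rKeyBase rfl, hF.var rKeyStep rfl,
        hF.arr g (by simp [setLeaf, siftUp, writesArr]; exact hE.ne.symm)]
    have hpow : 2 ^ (L + 1) = 2 * 2 ^ L := by ring
    have hU := hE.hU
    have hLU := hE.hLU
    have hn := hE.hn
    refine (setLeaf_spec (A := Finset.range i) (A' := Finset.range (i + 1)) (hE.congr
      ?_ ?_ ?_ ?_ ?_) ?_ ?_ ?_ ?_ ?_).mono ?_
    · simp +decide [hF.var rLevels rfl]
    · simp +decide [hF.var rTree rfl]
    · simp +decide [hF.var rKeyBase rfl]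
    · simp +decide [hF.var rKeyStep rfl]
    · simp +decide [hF.var rN rfl]
    · rw [hk]; exact hI hi.le
    · simpa using hi
    · intro y
      have hin : i ∈ Finset.range (i + 1) := by simp
      simp +decide only [eval_add, eval_var, eval_const, safe_add, safe_var, safe_const,
        State.set_var, if_true, if_false, true_and, hin, and_true]
      omega
    · intro y hy hyi
      simp at hyi ⊢
      omega
    · intro y hy
      rw [Finset.mem_range] at hy
      omega
    · intro s' _ h' _
      rwa [hk] at h'
  · intro s' _ hI
    rw [eval_var, hE.boxes] at hI
    exact hI le_rfl

theorem pop_spec {A : Finset ℕ} (hE : TreeEnv w U n L g s)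
    (hA : HasTree n L (keyOf g s) (s.arr aTree) A) (hne : A.Nonempty) :
    Total w U (pop g) s fun s' => s'.var rBox ∈ A ∧
      (∀ y ∈ A, keyOf g s (s'.var rBox) ≤ keyOf g s y) ∧
      HasTree n L (keyOf g s) (s'.arr aTree) (A.erase (s'.var rBox)) := by
  obtain ⟨h₀, h₁, h₂⟩ := hA.root hE.hn hne
  have hU := hE.hU
  have hLU := hE.hLU
  have hn := hE.hn
  have hpow : 2 ^ (L + 1) = 2 * 2 ^ L := by ring
  have hlt := hA.lt _ h₁
  have hs1 : 1 < U := by omega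
  have hs2 : 1 < 2 ^ w := by omega
  have hs3 : 1 ≤ s.arr aTree 1 := by omega
  unfold pop
  rw [total_seq, total_assign]
  simp only [eval_sub, eval_get, eval_const, safe_sub, safe_get, safe_const, hs1, hs2, hs3,
    true_and]
  have hk : keyOf g (s.set rBox (s.arr aTree 1 - 1)) = keyOf g s := by
    funext x
    simp +decide [keyOf]
  refine (setLeaf_spec (A := A) (A' := A.erase (s.arr aTree 1 - 1)) (hE.congr
      ?_ ?_ ?_ ?_ ?_) ?_ ?_ ?_ ?_ ?_).mono ?_
  · simp +decide
  · simp +decide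
  · simp +decide
  · simp +decide
  · simp +decide
  · rw [hk]; exact hA
  · simpa using hlt
  · intro y
    simp +decide
  · intro y hy hyi
    simp at hyi ⊢
    exact fun _ => hyi
  · intro y hy
    exact hA.lt y (Finset.mem_of_mem_erase hy)
  · intro s' hF h'
    rw [hk] at h'
    have : s'.var rBox = s.arr aTree 1 - 1 := by
      rw [hF.var rBox rfl]
      simp
    rw [this]
    exact ⟨h₁, h₂, h'⟩

end NestedBoxes

namespace NestedBoxes

open WordRAM WordRAM.Stmt WordRAM.Expr

/-! ### Ranks -/

/-- The boxes outside `A` have been ranked; `r` is the last rank and `last` is the last key. -/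
structure Ranked (n : ℕ) (A : Finset ℕ) (key rk : ℕ → ℕ) (r last : ℕ) : Prop where
  done : ∀ x < n, x ∉ A → key x ≤ last ∧ rk x ≤ r ∧ (key x < last ↔ rk x < r)
  todo : ∀ x ∈ A, last ≤ key x
  iff : ∀ x < n, ∀ y < n, x ∉ A → y ∉ A → (rk x ≤ rk y ↔ key x ≤ key y)

/-- The initial key `0` need not occur: if the smallest key is `0` its rank is `0`, otherwise ranks
begin with `1`. Either way they stay at most `n`. -/
theorem Ranked.init {n : ℕ} {key rk : ℕ → ℕ} : Ranked n (Finset.range n) key rk 0 0 where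
  done _ hx hxA := absurd (Finset.mem_range.2 hx) hxA
  todo _ _ := Nat.zero_le _
  iff _ hx _ _ hxA := absurd (Finset.mem_range.2 hx) hxA

/-- Keys come out in nondecreasing order, so a comparison with the last key decides everything: a
larger key opens a new rank, an equal key shares the current one. Hence equal entries get equal
ranks. -/
theorem Ranked.next {n : ℕ} {A : Finset ℕ} {key rk rk' : ℕ → ℕ} {r r' last x : ℕ}
    (h : Ranked n A key rk r last) (hx : x ∈ A) (hmin : ∀ y ∈ A, key x ≤ key y)
    (hr' : r' = if last < key x then r + 1 else r) (hrk : rk' x = r')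
    (hrk' : ∀ y < n, y ≠ x → rk' y = rk y) :
    Ranked n (A.erase x) key rk' r' (key x) := by
  have hlast := h.todo x hx
  have hne : ∀ y, y ∉ A.erase x → y ≠ x → y ∉ A := fun y hy hyx hyA =>
    hy (Finset.mem_erase.2 ⟨hyx, hyA⟩)
  refine ⟨fun y hy hyA => ?_, fun y hy => hmin y (Finset.mem_of_mem_erase hy),
    fun y hy z hz hyA hzA => ?_⟩
  · by_cases hyx : y = x
    · subst hyx
      simp [hrk]
    · obtain ⟨h₁, h₂, h₃⟩ := h.done y hy (hne y hyA hyx)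
      rw [hrk' y hy hyx]
      split_ifs at hr' <;> omega
  · by_cases hyx : y = x
    · by_cases hzx : z = x
      · simp [hyx, hzx]
      · obtain ⟨h₁, h₂, h₃⟩ := h.done z hz (hne z hzA hzx)
        rw [hyx, hrk' z hz hzx, hrk]
        split_ifs at hr' <;> omega
    · obtain ⟨h₁, h₂, h₃⟩ := h.done y hy (hne y hyA hyx)
      by_cases hzx : z = x
      · rw [hzx, hrk' y hy hyx, hrk]
        split_ifs at hr' <;> omega
      · rw [hrk' y hy hyx, hrk' z hz hzx]
        exact h.iff y hy z hz (hne y hyA hyx) (hne z hzA hzx)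

variable {w U n L d j : ℕ} {s₀ s : State}

/-- The invariant of the loop that computes the ranks in the coordinate `j`. -/
structure RankInv (n L d j : ℕ) (s₀ s : State) (i : ℕ) (A : Finset ℕ) : Prop where
  card : A.card + i = n
  tree : HasTree n L (keyOf aInput s₀) (s.arr aTree) A
  ranked : Ranked n A (keyOf aInput s₀) (fun x => s.arr aRank (x * d + j)) (s.var rRank)
    (s.var rLast)
  rank_le : s.var rRank ≤ i
  other : ∀ x, ∀ i' < d, i' ≠ j → s.arr aRank (x * d + i') = s₀.arr aRank (x * d + i')
  sum : ∀ x < n, s.arr aRankSum x =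
    s₀.arr aRankSum x + if x ∈ A then 0 else s.arr aRank (x * d + j)

theorem rankNext_spec {i : ℕ} {A : Finset ℕ} (hE : TreeEnv w U n L aInput s)
    (hkey : keyOf aInput s = keyOf aInput s₀) (hI : RankInv n L d j s₀ s i A) (hi : i < n)
    (hj : j < d) (hcoord : s.var rCoord = j) (hdU : n * d ≤ U)
    (hsum : ∀ x < n, s₀.arr aRankSum x + n < 2 ^ w) :
    Total w U (rankNext d) s fun s' => ∃ A', RankInv n L d j s₀ s' (i + 1) A' := by
  have hne : A.Nonempty := by
    rw [← Finset.card_pos]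
    have := hI.card
    omega
  unfold rankNext
  rw [total_seq]
  refine (pop_spec hE (hkey ▸ hI.tree) hne).mono ?_
  rintro s₁ hF ⟨hx, hmin, htree⟩
  rw [hkey] at hmin htree
  obtain ⟨x, hxe⟩ : ∃ x, x = s₁.var rBox := ⟨_, rfl⟩
  rw [← hxe] at hx hmin htree
  have hxn := hI.tree.lt x hx
  have hU := hE.hU
  have hk₁ := hE.key_lt x hxn
  have hc₁ : s₁.var rCoord = j := (hF.var _ rfl).trans hcoord
  have hb₁ := hF.var rKeyBase rfl
  have hs₁ := hF.var rKeyStep rfl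
  have hr₁ := hF.var rRank rfl
  have hl₁ := hF.var rLast rfl
  have hin₁ := hF.arr aInput rfl
  have hrank₁ := hF.arr aRank rfl
  have hsum₁ := hF.arr aRankSum rfl
  have hkx : s₁.arr aInput (s₁.var rKeyBase + x * s₁.var rKeyStep) = keyOf aInput s₀ x := by
    rw [← hkey, keyOf, hb₁, hs₁, hin₁]
  have hxd : x * d + j < n * d := by
    calc x * d + j < x * d + d := by omega
      _ = (x + 1) * d := by ring
      _ ≤ n * d := Nat.mul_le_mul_right _ (by omega)
  have hnd : n ≤ n * d := Nat.le_mul_of_pos_right n (by omega)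
  have hdn : d ≤ n * d := Nat.le_mul_of_pos_left d (by omega)
  have hrle := hI.rank_le
  have hS := hsum x hxn
  have hSx : s₁.arr aRankSum x = s₀.arr aRankSum x := by
    rw [hsum₁, hI.sum x hxn, if_pos hx, add_zero]
  have hpost : ∀ (s₂ : State) (r' last' : ℕ), s₂.arr = s₁.arr → s₂.var rRank = r' →
      s₂.var rLast = last' → last' = keyOf aInput s₀ x →
      r' = (if s.var rLast < keyOf aInput s₀ x then s.var rRank + 1 else s.var rRank) →
      ∃ A', RankInv n L d j s₀ ((s₂.put aRank (x * d + j) r').put aRankSum x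
        (s₀.arr aRankSum x + r')) (i + 1) A' := by
    intro s₂ r' last' ha h₁ h₂ h₃ hr'
    -- The index `x * d + j` with `j < d` determines both the box and the coordinate, so no other
    -- rank is overwritten.
    have hrk : ∀ i' < d, ∀ y, Function.update (s₁.arr aRank) (x * d + j) r' (y * d + i') =
        if y = x ∧ i' = j then r' else s.arr aRank (y * d + i') := by
      intro i' hi' y
      rw [Function.update_apply, hrank₁]
      refine if_congr ⟨fun h => address_inj hi' hj h, ?_⟩ rfl rfl
      rintro ⟨rfl, rfl⟩
      rfl
    refine ⟨A.erase x, ?_, ?_, ?_, ?_, ?_, ?_⟩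
    · have := hI.card
      rw [Finset.card_erase_of_mem hx]
      have := Finset.card_pos.2 hne
      omega
    · simpa +decide [ha] using htree
    · simp +decide only [State.put_var, State.put_arr, if_true, if_false, ha, h₁, h₂, h₃, hrk j hj,
        and_true]
      refine hI.ranked.next hx hmin hr' (by simp) fun y hy hyx => by simp [hyx]
    · simp +decide only [State.put_var, h₁]
      split_ifs at hr' <;> omega
    · intro y i' hi' hij
      simp +decide only [State.put_arr, if_true, if_false, ha, hrk i' hi', hij,
        and_false]
      exact hI.other y i' hi' hij
    · intro y hy
      simp +decide only [State.put_arr, if_true, if_false, ha, hrk j hj,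
        and_true, Function.update_apply]
      by_cases hyx : y = x
      · simp [hyx]
      · simp only [hyx, if_false, Finset.mem_erase, ne_eq, not_false_eq_true, true_and, hsum₁,
          hI.sum y hy]
  have hsafe : d < 2 ^ w ∧ x * d < 2 ^ w ∧ x * d + j < 2 ^ w ∧ x * d + j < U ∧ x < U ∧
      1 < 2 ^ w ∧ s.var rRank + 1 < 2 ^ w ∧ s₀.arr aRankSum x + (s.var rRank + 1) < 2 ^ w ∧
      s₀.arr aRankSum x + s.var rRank < 2 ^ w := by
    omega
  have hsafe' : x * s₁.var rKeyStep < 2 ^ w ∧ s₁.var rKeyBase + x * s₁.var rKeyStep < 2 ^ w ∧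
      s₁.var rKeyBase + x * s₁.var rKeyStep < U := by
    rw [hb₁, hs₁]
    omega
  simp +decide only [keyExpr, total_seq, total_assign, total_put, total_ifLt, total_skip, eval_var,
    eval_const, eval_get, eval_add, eval_mul, safe_var, safe_const, safe_get, safe_add, safe_mul,
    State.set_var, State.set_arr, State.put_arr, State.put_var, if_true, if_false, true_and,
    and_true, ← hxe, hkx, hsafe, hsafe', hc₁, hr₁, hl₁, hSx]
  refine ⟨fun h => hpost _ _ _ ?_ ?_ ?_ rfl ?_, fun h => hpost _ _ _ ?_ ?_ rfl ?_ ?_⟩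
  · rfl
  · simp +decide
  · simp +decide
  · rw [if_pos h]
  · rfl
  · simp +decide [hr₁]
  · simp +decide only [State.set_var, if_false, hl₁]
    exact le_antisymm (hI.ranked.todo x hx) (not_lt.1 h)
  · rw [if_neg h]

/-- The ranks of the boxes in the coordinates below `j` have been computed. -/
structure RanksUpTo (n d j : ℕ) (b : ℕ → ℕ → ℕ) (s : State) : Prop where
  le : ∀ x < n, ∀ i < j, s.arr aRank (x * d + i) ≤ n
  iff : ∀ x < n, ∀ y < n, ∀ i < j,
    s.arr aRank (x * d + i) ≤ s.arr aRank (y * d + i) ↔ b x i ≤ b y i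
  sum : ∀ x < n, s.arr aRankSum x = ∑ i ∈ Finset.range j, s.arr aRank (x * d + i)

/-- Arbitrary words are replaced by numbers at most `n` with the same order in each coordinate. This
is what makes a table of polynomial size possible. The sums of the ranks are accumulated along the
way, as keys for the final sort. -/
theorem ranks_spec {b : ℕ → ℕ → ℕ} (hU : U < 2 ^ w) (hLU : 2 ^ (L + 1) ≤ U) (hnL : n < 2 ^ L)
    (hn : 1 ≤ n) (hdU : n * d + n ≤ U) (hN : s.var rN = n) (hL : s.var rLevels = L)
    (hT : s.var rTree = 2 ^ L) (hd : d < 2 ^ w)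
    (hb : ∀ x < n, ∀ i < d, s.arr aInput (x * d + i) = b x i)
    (hsum : ∀ x < n, s.arr aRankSum x = 0) (htree : EmptyTree n L (s.arr aTree)) :
    Total w U (ranks d) s fun s' => RanksUpTo n d d b s' ∧ EmptyTree n L (s'.arr aTree) := by
  refine Total.loop (fun j s' => RanksUpTo n d j b s' ∧ EmptyTree n L (s'.arr aTree)) hd
    ⟨⟨fun _ _ i hi => absurd hi (by omega), fun _ _ _ _ i hi => absurd hi (by omega), by simpa⟩,
      htree⟩ ?_ fun s' _ h => h
  intro j hj s₁ hF ⟨hR, htree₁⟩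
  rw [eval_const] at hj
  have hpow : 2 ^ (L + 1) = 2 * 2 ^ L := by ring
  have h0 : 0 < 2 ^ w := by positivity
  have hxd : ∀ x < n, x * d + j < n * d := by
    intro x hx
    calc x * d + j < x * d + d := by omega
      _ = (x + 1) * d := by ring
      _ ≤ n * d := Nat.mul_le_mul_right _ (by omega)
  have hin := hF.arr aInput rfl
  simp +decide only [total_seq, total_assign, eval_var, eval_const, safe_var, safe_const,
    State.set_var, if_true, true_and, hd]
  have hE : TreeEnv w U n L aInput (((s₁.set rCoord j).set rKeyBase j).set rKeyStep d) := by
    refine ⟨by decide, hU, hLU, hnL, ?_, ?_, ?_, ?_⟩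
    · simp +decide [hF.var rLevels rfl, hL]
    · simp +decide [hF.var rTree rfl, hT]
    · simp +decide [hF.var rN rfl, hN]
    · intro x hx
      have := hxd x hx
      simp +decide only [State.set_var, if_true, if_false]
      omega
  refine (fill_spec hE (by simpa using htree₁)).mono ?_
  intro s₂ hF₂ hfill
  generalize hs₁' : ((s₁.set rCoord j).set rKeyBase j).set rKeyStep d = s₁' at *
  simp +decide only [true_and, h0]
  have hkey : ∀ x < n, keyOf aInput s₁' x = b x j := by
    intro x hx
    rw [← hs₁', keyOf]
    simp +decide only [State.set_var, if_true, if_false, State.set_arr, hin, ← hb x hx j hj]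
    congr 1
    ring
  have hrank₂ : s₂.arr aRank = s₁.arr aRank := by rw [hF₂.arr aRank rfl, ← hs₁']; rfl
  have hsum₂ : s₂.arr aRankSum = s₁.arr aRankSum := by rw [hF₂.arr aRankSum rfl, ← hs₁']; rfl
  have hsle : ∀ x < n, s₁.arr aRankSum x ≤ j * n := by
    intro x hx
    rw [hR.sum x hx]
    simpa using Finset.sum_le_card_nsmul (Finset.range j) _ n
      fun i hi => hR.le x hx i (Finset.mem_range.1 hi)
  refine Total.loop (fun i s' => i ≤ n → ∃ A, RankInv n L d j s₂ s' i A) trivial ?_ ?_ ?_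
  · have hk₂ : keyOf aInput s₂ = keyOf aInput s₁' := by
      funext x
      rw [keyOf, keyOf, hF₂.var rKeyBase rfl, hF₂.var rKeyStep rfl, hF₂.arr aInput rfl]
    refine fun _ => ⟨Finset.range n, by simp, ?_, ?_, ?_, ?_, ?_⟩
    · simpa [hk₂] using hfill
    · simpa +decide using Ranked.init
    · simp +decide
    · simp
    · intro x hx
      simp [hx]
  · intro i hi s₃ hF₃ hI
    have hN₂ : s₂.var rN = n := by rw [hF₂.var rN rfl, hE.boxes]
    simp +decide only [eval_var, State.set_var, if_false, hN₂] at hi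
    obtain ⟨A, hA⟩ := hI hi.le
    have hv : ∀ y, y ≠ rRank → y ≠ rLast → y ≠ rCount →
        (loop rCount (var rN) (rankNext d)).writesVar y = false →
        (s₃.set rCount i).var y = s₂.var y := by
      intro y h₁ h₂ h₃ h₄
      simp [h₁, h₂, h₃, hF₃.var y h₄]
    refine (rankNext_spec (s₀ := s₂) (A := A) (i := i) (j := j) (hE.congr ?_ ?_ ?_ ?_ ?_) ?_
      ⟨hA.card, by simpa using hA.tree, by simpa +decide using hA.ranked,
        by simpa +decide using hA.rank_le, by simpa using hA.other, by simpa using hA.sum⟩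
      hi hj ?_ (by omega) ?_).mono fun s' _ h _ => h
    · rw [hv _ (by decide) (by decide) (by decide) rfl, hF₂.var _ rfl]
    · rw [hv _ (by decide) (by decide) (by decide) rfl, hF₂.var _ rfl]
    · rw [hv _ (by decide) (by decide) (by decide) rfl, hF₂.var _ rfl]
    · rw [hv _ (by decide) (by decide) (by decide) rfl, hF₂.var _ rfl]
    · rw [hv _ (by decide) (by decide) (by decide) rfl, hF₂.var _ rfl]
    · funext x
      rw [keyOf, keyOf, hv _ (by decide) (by decide) (by decide) rfl,
        hv _ (by decide) (by decide) (by decide) rfl, State.set_arr, hF₃.arr _ rfl]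
      rfl
    · rw [hv _ (by decide) (by decide) (by decide) rfl, hF₂.var _ rfl, ← hs₁']
      simp +decide
    · intro x hx
      rw [hsum₂]
      have := hsle x hx
      have : (j + 1) * n ≤ d * n := Nat.mul_le_mul_right _ hj
      rw [mul_comm d n, add_mul] at this
      omega
  · intro s₃ hF₃ hI
    have hN₂ : s₂.var rN = n := by rw [hF₂.var rN rfl, hE.boxes]
    simp +decide only [eval_var, State.set_var, if_false, hN₂] at hI
    obtain ⟨A, hA⟩ := hI le_rfl
    obtain rfl : A = ∅ := by
      rw [← Finset.card_eq_zero]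
      have := hA.card
      omega
    have hother : ∀ x, ∀ i < j, s₃.arr aRank (x * d + i) = s₁.arr aRank (x * d + i) := by
      intro x i hi
      rw [hA.other x i (by omega) (by omega), hrank₂]
    have hkey₂ : ∀ x < n, keyOf aInput s₂ x = b x j := by
      intro x hx
      rw [← hkey x hx, keyOf, keyOf, hF₂.var rKeyBase rfl, hF₂.var rKeyStep rfl,
        hF₂.arr aInput rfl]
    refine ⟨⟨fun x hx i hi => ?_, fun x hx y hy i hi => ?_, fun x hx => ?_⟩, hA.tree.emptyTree⟩
    · rcases Nat.lt_succ_iff_lt_or_eq.1 hi with h | rfl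
      · rw [hother x i h]
        exact hR.le x hx i h
      · exact (hA.ranked.done x hx (by simp)).2.1.trans hA.rank_le
    · rcases Nat.lt_succ_iff_lt_or_eq.1 hi with h | rfl
      · rw [hother x i h, hother y i h]
        exact hR.iff x hx y hy i h
      · rw [← hkey₂ x hx, ← hkey₂ y hy]
        exact hA.ranked.iff x hx y hy (by simp) (by simp)
    · rw [hA.sum x hx, Finset.sum_range_succ, hsum₂, hR.sum x hx]
      simp only [Finset.notMem_empty, if_false]
      congr 1
      exact Finset.sum_congr rfl fun i hi => (hother x i (Finset.mem_range.1 hi)).symm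

end NestedBoxes

namespace NestedBoxes

open WordRAM WordRAM.Stmt WordRAM.Expr

/-! ### The table -/

/-- The address of a cell of the table: `S` is the radix, `r` are the ranks of a box, and `ℓ` are
the levels; `g` is `1` for insertions and `0` for queries. -/
def cellAt (S g key : ℕ) (r ℓ : ℕ → ℕ) : ℕ → ℕ
  | 0 => key
  | i + 1 => (cellAt S g key r ℓ i * S + ℓ i) * S + ((r i + 1 - g) / 2 ^ ℓ i + g)

theorem digit_lt {S m a x : ℕ} (ha : a < S ^ m) (hx : x < S) : a * S + x < S ^ (m + 1) := by
  calc a * S + x < a * S + S := by omega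
    _ = (a + 1) * S := by ring
    _ ≤ S ^ m * S := Nat.mul_le_mul_right _ ha
    _ = S ^ (m + 1) := (pow_succ _ _).symm

/-- Block numbers go up to `n + 1`, both for insertions and for queries; hence the radix `n + 2`. -/
theorem block_lt {n S g r ℓ : ℕ} (hr : r ≤ n) (hS : n + 2 ≤ S) (hg : g ≤ 1) :
    (r + 1 - g) / 2 ^ ℓ + g < S := by
  have := Nat.div_le_self (r + 1 - g) (2 ^ ℓ)
  omega

theorem cellAt_lt {S g key k d n : ℕ} {r ℓ : ℕ → ℕ} (hkey : key < S ^ k) (hS : n + 2 ≤ S)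
    (hg : g ≤ 1) (hr : ∀ i < d, r i ≤ n) (hℓ : ∀ i < d, ℓ i < S) (i : ℕ) (hi : i ≤ d) :
    cellAt S g key r ℓ i < S ^ (k + 2 * i) := by
  induction i with
  | zero => simpa [cellAt] using hkey
  | succ i ih =>
    exact digit_lt (digit_lt (ih (by omega)) (hℓ i (by omega))) (block_lt (hr i (by omega)) hS hg)

/-- The levels and the blocks are digits in radix `S`, so they can be decoded from the address. As
the levels agree, the conclusion compares the blocks at the common level `ℓ i`. -/
theorem cellAt_inj {S g g' key key' n : ℕ} {r r' ℓ ℓ' : ℕ → ℕ} (d : ℕ) (hS : n + 2 ≤ S)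
    (hg : g ≤ 1) (hg' : g' ≤ 1) (hr : ∀ i < d, r i ≤ n) (hr' : ∀ i < d, r' i ≤ n)
    (hℓ : ∀ i < d, ℓ i < S) (hℓ' : ∀ i < d, ℓ' i < S)
    (h : cellAt S g key r ℓ d = cellAt S g' key' r' ℓ' d) :
    key = key' ∧ ∀ i < d, (r i + 1 - g) / 2 ^ ℓ i + g = (r' i + 1 - g') / 2 ^ ℓ i + g' := by
  induction d with
  | zero => exact ⟨h, fun i hi => absurd hi (by omega)⟩
  | succ d ih =>
    obtain ⟨h₁, h₂⟩ := address_inj (block_lt (hr d (by omega)) hS hg)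
      (block_lt (hr' d (by omega)) hS hg') h
    obtain ⟨h₃, h₄⟩ := address_inj (hℓ d (by omega)) (hℓ' d (by omega)) h₁
    obtain ⟨h₅, h₆⟩ := ih (fun i hi => hr i (by omega)) (fun i hi => hr' i (by omega))
      (fun i hi => hℓ i (by omega)) (fun i hi => hℓ' i (by omega)) h₃
    refine ⟨h₅, fun i hi => ?_⟩
    rcases Nat.lt_succ_iff_lt_or_eq.1 hi with hi | rfl
    · exact h₆ i hi
    · rw [h₂, h₄]

theorem cellAt_eq {S key d : ℕ} {r r' ℓ : ℕ → ℕ}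
    (h : ∀ i < d, r i / 2 ^ ℓ i + 1 = (r' i + 1) / 2 ^ ℓ i) :
    cellAt S 1 key r ℓ d = cellAt S 0 key r' ℓ d := by
  induction d with
  | zero => rfl
  | succ d ih =>
    simp only [cellAt]
    rw [ih fun i hi => h i (by omega)]
    simp [h d (by omega)]

/-- If `y + 1 ≤ r`, then `(y + 1) / 2 ^ ℓ ≤ r / 2 ^ ℓ`. So a query never finds a larger rank. -/
theorem le_of_block_eq {r y ℓ : ℕ} (h : r / 2 ^ ℓ + 1 = (y + 1) / 2 ^ ℓ) : r ≤ y := by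
  by_contra hlt
  have := Nat.div_le_div_right (c := 2 ^ ℓ) (show y + 1 ≤ r by omega)
  omega

/-- As long as the gap between `r` and `y + 1` is at least two, halving both leaves a gap of at
least one. Repeat until the gap is exactly one. The level need not be unique, which is harmless for
a maximum. -/
theorem exists_block_eq {r y L : ℕ} (h : r ≤ y) (hL : y + 1 < 2 ^ L) :
    ∃ ℓ < L, r / 2 ^ ℓ + 1 = (y + 1) / 2 ^ ℓ := by
  induction L generalizing r y with
  | zero => simp at hL
  | succ L ih =>
    by_cases hry : r = y
    · exact ⟨0, by omega, by simp [hry]⟩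
    · rw [pow_succ] at hL
      by_cases h1 : (y + 1) / 2 = 0
      · omega
      -- It is `y + 1` that is halved, so the role of `y` is taken over by `(y + 1) / 2 - 1`.
      obtain ⟨ℓ, hℓ, hh⟩ := ih (r := r / 2) (y := (y + 1) / 2 - 1) (by omega) (by omega)
      refine ⟨ℓ + 1, by omega, ?_⟩
      rw [show (y + 1) / 2 - 1 + 1 = (y + 1) / 2 by omega] at hh
      rwa [pow_succ', ← Nat.div_div_eq_div_mul, ← Nat.div_div_eq_div_mul]

/-- Base `L` digits: a single loop over `c < L ^ d` runs through all choices of one level per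
coordinate. -/
theorem exists_levelCode {L d : ℕ} (ℓ : ℕ → ℕ) (hℓ : ∀ i < d, ℓ i < L) :
    ∃ c < L ^ d, ∀ i < d, c / L ^ i % L = ℓ i := by
  let f : Fin d → Fin L := fun i => ⟨ℓ i, hℓ i i.2⟩
  refine ⟨finFunctionFinEquiv f, (finFunctionFinEquiv f).2, fun i hi => ?_⟩
  have := congrArg Fin.val (congrFun (finFunctionFinEquiv.symm_apply_apply f) ⟨i, hi⟩)
  rwa [finFunctionFinEquiv_symm_apply_val] at this

/-- The cell of the table for the key `key`, the box `x` and the code `c` of levels. -/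
def cell (S L d g : ℕ) (rk : ℕ → ℕ → ℕ) (key x c : ℕ) : ℕ :=
  cellAt S g key (rk x) (fun i => c / L ^ i % L) d

/-- The ranks stored in a state. -/
def rankOf (d : ℕ) (s : State) (x i : ℕ) : ℕ := s.arr aRank (x * d + i)

variable {w U n L d k S : ℕ} {s : State}

/-- The constants that the table depends on. -/
structure TableEnv (w U n L d k S : ℕ) (s : State) : Prop where
  hU : U < 2 ^ w
  boxes : s.var rN = n
  size : s.var rSize = S
  levels : s.var rLevels = L
  levelCodes : s.var rLevelCodes = L ^ d
  codes : s.var rCodes = n ^ k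
  one_le : 1 ≤ n
  levels_pos : 1 ≤ L
  levels_le : L ≤ S
  boxes_le : n + 2 ≤ S
  size_pow : S ^ (k + 2 * d + 2) ≤ U
  ranks_lt : n * d ≤ U
  dim_lt : d < 2 ^ w
  rank_le : ∀ x < n, ∀ i < d, rankOf d s x i ≤ n

theorem TableEnv.congr {s' : State} (h : TableEnv w U n L d k S s)
    (hv : ∀ y < 5, s'.var y = s.var y) (ha : s'.arr aRank = s.arr aRank) :
    TableEnv w U n L d k S s' where
  hU := h.hU
  boxes := (hv _ (by decide)).trans h.boxes
  size := (hv _ (by decide)).trans h.size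
  levels := (hv _ (by decide)).trans h.levels
  levelCodes := (hv _ (by decide)).trans h.levelCodes
  codes := (hv _ (by decide)).trans h.codes
  one_le := h.one_le
  levels_pos := h.levels_pos
  levels_le := h.levels_le
  boxes_le := h.boxes_le
  size_pow := h.size_pow
  ranks_lt := h.ranks_lt
  dim_lt := h.dim_lt
  rank_le := by
    simp only [rankOf, ha]
    exact h.rank_le

theorem TableEnv.pow_le (h : TableEnv w U n L d k S s) {m : ℕ} (hm : m ≤ k + 2 * d + 2) :
    S ^ m ≤ U :=
  (Nat.pow_le_pow_right (by have := h.boxes_le; omega) hm).trans h.size_pow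

theorem rank_index_lt {n d x i : ℕ} (hx : x < n) (hi : i < d) : x * d + i < n * d := by
  calc x * d + i < x * d + d := by omega
    _ = (x + 1) * d := by ring
    _ ≤ n * d := Nat.mul_le_mul_right _ hx

theorem TableEnv.level_lt (h : TableEnv w U n L d k S s) (a : ℕ) : a % L < S :=
  (Nat.mod_lt _ h.levels_pos).trans_le h.levels_le

theorem TableEnv.cell_lt (h : TableEnv w U n L d k S s) {g key x : ℕ} (hg : g ≤ 1)
    (hkey : key < S ^ k) (hx : x < n) (c : ℕ) :
    cell S L d g (rankOf d s) key x c < U :=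
  (cellAt_lt hkey h.boxes_le hg (h.rank_le x hx) (fun _ _ => h.level_lt _) d le_rfl).trans_le
    (h.pow_le (by omega))

/-- Each round takes one base `L` digit from the level code and appends two radix `S` digits to the
address. All intermediate results stay below a power of `S` that is at most `U`. -/
theorem cellAddress_spec {g : ℕ} (hE : TableEnv w U n L d k S s) (hg : g ≤ 1)
    (hkey : s.var rKey < S ^ k) (hx : s.var rPoint < n) :
    Total w U (cellAddress d g) s fun s' =>
      s'.var rAddress =
        cell S L d g (rankOf d s) (s.var rKey) (s.var rPoint) (s.var rLevelCode) := by
  unfold cellAddress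
  simp +decide only [total_seq, total_assign, eval_var, safe_var, State.set_var, if_false, true_and]
  refine Total.loop (fun i s' => i ≤ d → s'.var rRest = s.var rLevelCode / L ^ i ∧
    s'.var rAddress = cellAt S g (s.var rKey) (rankOf d s (s.var rPoint))
      (fun i => s.var rLevelCode / L ^ i % L) i) hE.dim_lt ?_ ?_ ?_
  · simp +decide [cellAt]
  · intro i hi s₁ hF hI
    rw [eval_const] at hi
    obtain ⟨h₁, h₂⟩ := hI hi.le
    have hL₁ : s₁.var rLevels = L := by
      rw [hF.var _ rfl]
      simpa +decide using hE.levels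
    have hS₁ : s₁.var rSize = S := by
      rw [hF.var _ rfl]
      simpa +decide using hE.size
    have hp₁ : s₁.var rPoint = s.var rPoint := by
      rw [hF.var _ rfl]
      simp +decide
    have ha₁ : s₁.arr aRank (s.var rPoint * d + i) = rankOf d s (s.var rPoint) i := by
      rw [hF.arr _ rfl]
      rfl
    have hU := hE.hU
    have hd := hE.dim_lt
    have hlt := cellAt_lt hkey hE.boxes_le hg (hE.rank_le _ hx)
      (fun i _ => hE.level_lt (s.var rLevelCode / L ^ i)) i hi.le
    have hlt₁ := digit_lt hlt (hE.level_lt (s.var rLevelCode / L ^ i))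
    have hr := hE.rank_le _ hx i hi
    have hb := block_lt (ℓ := s.var rLevelCode / L ^ i % L) hr hE.boxes_le hg
    have hlt₂ := digit_lt hlt₁ hb
    have hp₀ := hE.pow_le (m := k + 2 * i + 1) (by omega)
    have hp₂ := hE.pow_le (m := k + 2 * i + 1 + 1) (by omega)
    have hS₂ := hE.pow_le (m := 1) (by omega)
    have hbox := hE.boxes_le
    have hidx := rank_index_lt hx hi
    have hidx' := hE.ranks_lt
    rw [pow_one] at hS₂
    generalize hc : cellAt S g (s.var rKey) (rankOf d s (s.var rPoint))
      (fun i => s.var rLevelCode / L ^ i % L) i = a at *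
    generalize hb' : (rankOf d s (s.var rPoint) i + 1 - g) / 2 ^ (s.var rLevelCode / L ^ i % L) = z
      at *
    generalize hl' : s.var rLevelCode / L ^ i % L = l at *
    generalize hrk' : rankOf d s (s.var rPoint) i = r at *
    have hpos : a * S + l < 2 ^ w := by omega
    have hmul : (a * S + l) * S + (z + g) < 2 ^ w := by omega
    have hsafe : a * S < 2 ^ w ∧ (a * S + l) * S < 2 ^ w ∧ z + g < 2 ^ w ∧ g < 2 ^ w ∧ 1 < 2 ^ w ∧
        r + 1 < 2 ^ w ∧ g ≤ r + 1 ∧ s.var rPoint * d < 2 ^ w ∧ s.var rPoint * d + i < 2 ^ w ∧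
        s.var rPoint * d + i < U := by omega
    simp +decide only [total_seq, total_assign, eval_var, eval_const, eval_get, eval_add, eval_sub,
      eval_mul, eval_div, eval_mod, eval_shr, safe_var, safe_const, safe_get, safe_add, safe_sub,
      safe_mul, safe_div, safe_mod, safe_shr, State.set_var, State.set_arr, if_true, if_false,
      true_and, and_true, h₁, h₂, hL₁, hS₁, hp₁, hl', ha₁, hb', hpos, hmul, hd, hsafe]
    intro _
    refine ⟨?_, ?_⟩
    · rw [pow_succ, Nat.div_div_eq_div_mul]
    · simp only [cellAt, hc, hl', hrk', hb']
  · intro s' _ hI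
    exact (hI le_rfl).2

theorem query_spec (hE : TableEnv w U n L d k S s) (hkey : s.var rKey < S ^ k)
    (hx : s.var rPoint < n) :
    Total w U (query d) s fun s' =>
      (∀ c < L ^ d, s.arr aTable (cell S L d 0 (rankOf d s) (s.var rKey) (s.var rPoint) c) ≤
        s'.var rBest) ∧
      (s'.var rBest = 0 ∨ ∃ c < L ^ d,
        s'.var rBest = s.arr aTable (cell S L d 0 (rankOf d s) (s.var rKey) (s.var rPoint) c)) := by
  have h0 : 0 < 2 ^ w := by positivity
  unfold query
  simp +decide only [total_seq, total_assign, eval_const, safe_const, h0, true_and]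
  refine Total.loop (fun i s' =>
      (∀ c < i, s.arr aTable (cell S L d 0 (rankOf d s) (s.var rKey) (s.var rPoint) c) ≤
        s'.var rBest) ∧
      (s'.var rBest = 0 ∨ ∃ c < i, s'.var rBest =
        s.arr aTable (cell S L d 0 (rankOf d s) (s.var rKey) (s.var rPoint) c))) trivial ?_ ?_ ?_
  · simp +decide
  · intro i hi s₁ hF ⟨h₁, h₂⟩
    have hv : ∀ y, y ≠ rBest → y ≠ rLevelCode → (loop rLevelCode (var rLevelCodes) (
        cellAddress d 0 ;; ifLt (var rBest) (get aTable (var rAddress))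
          (assign rBest (get aTable (var rAddress))) skip)).writesVar y = false →
        (s₁.set rLevelCode i).var y = s.var y := by
      intro y hy₁ hy₂ hy₃
      rw [State.set_var, if_neg hy₂, hF.var y hy₃, State.set_var, if_neg hy₁]
    have ha : (s₁.set rLevelCode i).arr aRank = s.arr aRank := by
      rw [State.set_arr, hF.arr _ rfl]; rfl
    have hk₁ := hv rKey (by decide) (by decide) rfl
    have hp₁ := hv rPoint (by decide) (by decide) rfl
    have hr₁ : rankOf d (s₁.set rLevelCode i) = rankOf d s := by
      funext x j
      rw [rankOf, rankOf, ha]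
    rw [total_seq]
    refine (cellAddress_spec (g := 0) (hE.congr ?_ ha) (by omega) (by rw [hk₁]; exact hkey)
      (by rw [hp₁]; exact hx)).mono ?_
    · intro y hy
      refine hv y ?_ ?_ ?_
      · simp only [rBest]; omega
      · simp only [rLevelCode]; omega
      · interval_cases y <;> rfl
    · intro s₂ hF₂ hadr
      rw [hk₁, hp₁, hr₁, State.set_var, if_pos rfl] at hadr
      have hb₂ : s₂.var rBest = s₁.var rBest := by
        rw [hF₂.var _ rfl]
        simp +decide
      have ht₂ : s₂.arr aTable = s.arr aTable := by
        rw [hF₂.arr _ rfl, State.set_arr, hF.arr _ rfl]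
        rfl
      have hlt := hE.cell_lt (g := 0) (by omega) hkey hx i
      simp +decide only [total_ifLt, total_assign, total_skip, eval_var, eval_get, safe_var,
        safe_get, true_and, hadr, ht₂, hb₂, hlt, State.set_var, if_true]
      refine ⟨fun h => ⟨fun c hc => ?_, .inr ⟨i, by omega, rfl⟩⟩, fun h => ⟨fun c hc => ?_, ?_⟩⟩
      · rcases Nat.lt_succ_iff_lt_or_eq.1 hc with hc | rfl
        · exact (h₁ c hc).trans h.le
        · exact le_rfl
      · rcases Nat.lt_succ_iff_lt_or_eq.1 hc with hc | rfl
        · exact h₁ c hc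
        · exact not_lt.1 h
      · exact h₂.imp_right fun ⟨c, hc, h⟩ => ⟨c, by omega, h⟩
  · intro s' _ hI
    simpa +decide only [eval_var, State.set_var, if_false, hE.levelCodes] using hI

/-- The first two clauses serve the completeness of the table, the last one its soundness. -/
theorem update_spec (hE : TableEnv w U n L d k S s) (hkey : s.var rKey < S ^ k)
    (hx : s.var rPoint < n) :
    Total w U (update d) s fun s' =>
      (∀ a, s.arr aTable a ≤ s'.arr aTable a) ∧
      (∀ c < L ^ d, s.var rValue ≤
        s'.arr aTable (cell S L d 1 (rankOf d s) (s.var rKey) (s.var rPoint) c)) ∧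
      ∀ a, s'.arr aTable a = s.arr aTable a ∨ s'.arr aTable a = s.var rValue ∧
        ∃ c < L ^ d, a = cell S L d 1 (rankOf d s) (s.var rKey) (s.var rPoint) c := by
  unfold update
  refine Total.loop (fun i s' =>
      (∀ a, s.arr aTable a ≤ s'.arr aTable a) ∧
      (∀ c < i, s.var rValue ≤
        s'.arr aTable (cell S L d 1 (rankOf d s) (s.var rKey) (s.var rPoint) c)) ∧
      ∀ a, s'.arr aTable a = s.arr aTable a ∨ s'.arr aTable a = s.var rValue ∧
        ∃ c < i, a = cell S L d 1 (rankOf d s) (s.var rKey) (s.var rPoint) c) trivial ?_ ?_ ?_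
  · simp +decide
  · intro i hi s₁ hF ⟨h₁, h₂, h₃⟩
    have hv : ∀ y, y ≠ rLevelCode → (loop rLevelCode (var rLevelCodes) (
        cellAddress d 1 ;; ifLt (get aTable (var rAddress)) (var rValue)
          (put aTable (var rAddress) (var rValue)) skip)).writesVar y = false →
        (s₁.set rLevelCode i).var y = s.var y := by
      intro y hy₂ hy₃
      rw [State.set_var, if_neg hy₂, hF.var y hy₃]
    have ha : (s₁.set rLevelCode i).arr aRank = s.arr aRank := by
      rw [State.set_arr, hF.arr _ rfl]
    have hk₁ := hv rKey (by decide) rfl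
    have hp₁ := hv rPoint (by decide) rfl
    have hr₁ : rankOf d (s₁.set rLevelCode i) = rankOf d s := by
      funext x j
      rw [rankOf, rankOf, ha]
    rw [total_seq]
    refine (cellAddress_spec (g := 1) (hE.congr ?_ ha) (by omega) (by rw [hk₁]; exact hkey)
      (by rw [hp₁]; exact hx)).mono ?_
    · intro y hy
      refine hv y ?_ ?_
      · simp only [rLevelCode]; omega
      · interval_cases y <;> rfl
    · intro s₂ hF₂ hadr
      rw [hk₁, hp₁, hr₁, State.set_var, if_pos rfl] at hadr
      have hb₂ : s₂.var rValue = s.var rValue := by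
        rw [hF₂.var _ rfl, hv rValue (by decide) rfl]
      have ht₂ : s₂.arr aTable = s₁.arr aTable := by
        rw [hF₂.arr _ rfl, State.set_arr]
      have hlt := hE.cell_lt (g := 1) (by omega) hkey hx i
      simp +decide only [total_ifLt, total_put, total_skip, eval_var, eval_get, safe_var,
        safe_get, true_and, hadr, ht₂, hb₂, hlt, State.put_arr, if_true]
      generalize hcell : cell S L d 1 (rankOf d s) (s.var rKey) (s.var rPoint) = ad at *
      refine ⟨fun h => ⟨fun a => ?_, fun c hc => ?_, fun a => ?_⟩, fun h => ⟨h₁, fun c hc => ?_,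
        fun a => ?_⟩⟩
      · rw [Function.update_apply]
        split_ifs with hadr
        · rw [hadr]
          exact (h₁ _).trans h.le
        · exact h₁ a
      · rw [Function.update_apply]
        split_ifs with hadr
        · exact le_rfl
        · rcases Nat.lt_succ_iff_lt_or_eq.1 hc with hc | rfl
          · exact h₂ c hc
          · exact absurd rfl hadr
      · rw [Function.update_apply]
        split_ifs with hadr
        · exact .inr ⟨rfl, i, by omega, hadr⟩
        · exact (h₃ a).imp_right fun ⟨hh, c, hc, hac⟩ => ⟨hh, c, by omega, hac⟩
      · rcases Nat.lt_succ_iff_lt_or_eq.1 hc with hc | rfl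
        · exact h₂ c hc
        · exact not_lt.1 h
      · exact (h₃ a).imp_right fun ⟨hh, c, hc, hac⟩ => ⟨hh, c, by omega, hac⟩
  · intro s' _ hI
    simpa +decide only [eval_var, hE.levelCodes] using hI

end NestedBoxes

namespace NestedBoxes

open WordRAM WordRAM.Stmt WordRAM.Expr

/-! ### Processing one box -/

variable {w U n L d k S : ℕ} {s : State}

theorem pow_boxes_le (hE : TableEnv w U n L d k S s) (m : ℕ) : n ^ m ≤ S ^ m :=
  Nat.pow_le_pow_left (by have := hE.boxes_le; omega) m

/-- The number `q` is the answer of the query for the box `x` in the row `key` of the table. -/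
def IsQuery (L d : ℕ) (cells : ℕ → ℕ) (T : ℕ → ℕ) (q : ℕ) : Prop :=
  (∀ c < L ^ d, T (cells c) ≤ q) ∧ (q = 0 ∨ ∃ c < L ^ d, q = T (cells c))

/-- All candidates are computed from the old table and kept in a separate array. As a box fits into
itself, inserting them at once could lead to using it twice. -/
theorem computeCandidates_spec (hE : TableEnv w U n L d k S s) (hx : s.var rBox < n)
    (hT : ∀ a, s.arr aTable a < n) :
    Total w U (computeCandidates d) s fun s' =>
      (∀ c < n ^ k, ∃ q, s'.arr aCandidate c = q + 1 ∧
        IsQuery L d (cell S L d 0 (rankOf d s) c (s.var rBox)) (s.arr aTable) q) ∧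
      (∀ c < n ^ k, s'.arr aCandidate c ≤ s'.var rAnswer) ∧ s.var rAnswer ≤ s'.var rAnswer ∧
      (s'.var rAnswer = s.var rAnswer ∨ ∃ c < n ^ k, s'.var rAnswer = s'.arr aCandidate c) := by
  unfold computeCandidates
  refine Total.loop (fun i s' => i ≤ n ^ k →
      (∀ c < i, ∃ q, s'.arr aCandidate c = q + 1 ∧
        IsQuery L d (cell S L d 0 (rankOf d s) c (s.var rBox)) (s.arr aTable) q) ∧
      (∀ c < i, s'.arr aCandidate c ≤ s'.var rAnswer) ∧ s.var rAnswer ≤ s'.var rAnswer ∧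
      (s'.var rAnswer = s.var rAnswer ∨ ∃ c < i, s'.var rAnswer = s'.arr aCandidate c)) trivial
    (by simp) ?_ ?_
  · intro i hi s₁ hF hI
    rw [eval_var, hE.codes] at hi
    obtain ⟨h₁, h₂, h₃, h₄⟩ := hI hi.le
    have hr₁ : rankOf d s₁ = rankOf d s := by
      funext x j
      rw [rankOf, rankOf, hF.arr _ rfl]
    have ht₁ : s₁.arr aTable = s.arr aTable := hF.arr _ rfl
    have hb₁ : s₁.var rBox = s.var rBox := hF.var _ rfl
    have hpow := pow_boxes_le hE k
    have hpow' := hE.pow_le (m := k) (by omega)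
    have hSU := hE.pow_le (m := 1) (by omega)
    rw [pow_one] at hSU
    have hU := hE.hU
    have hnS := hE.boxes_le
    simp +decide only [total_seq, total_assign, eval_var, safe_var, State.set_var, if_true,
      if_false, true_and]
    refine (query_spec (hE.congr ?_ ?_) ?_ ?_).mono ?_
    · intro y hy
      rw [← hF.var y (by interval_cases y <;> rfl)]
      interval_cases y <;> simp +decide
    · rw [← hF.arr aRank rfl]
      rfl
    · simp +decide only [State.set_var, if_true, if_false]
      omega
    · simpa +decide only [State.set_var, if_true, if_false, hb₁] using hx
    · rintro s₂ hF₂ ⟨hq₁, hq₂⟩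
      have hr₂ : rankOf d (((s₁.set rCode i).set rKey i).set rPoint (s₁.var rBox)) =
        rankOf d s := hr₁
      rw [hr₂] at hq₁ hq₂
      simp +decide only [State.set_var, State.set_arr, if_true, if_false, ht₁, hb₁] at hq₁ hq₂
      have hc₂ : s₂.var rCode = i := by
        rw [hF₂.var _ rfl]
        simp +decide
      have ha₂ : s₂.var rAnswer = s₁.var rAnswer := by
        rw [hF₂.var _ rfl]
        simp +decide
      have hcand₂ : s₂.arr aCandidate = s₁.arr aCandidate := hF₂.arr _ rfl
      have hqn : s₂.var rBest < n := by
        rcases hq₂ with h | ⟨c, _, h⟩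
        · have := hE.one_le
          omega
        · rw [h]
          exact hT _
      have hsafe : 1 < 2 ^ w ∧ s₂.var rBest + 1 < 2 ^ w ∧ i < U := by omega
      have hpost : ∀ a, (s₁.var rAnswer < s₂.var rBest + 1 → a = s₂.var rBest + 1) →
          (¬ s₁.var rAnswer < s₂.var rBest + 1 → a = s₁.var rAnswer) →
          (∀ c < i + 1, ∃ q,
            Function.update (s₂.arr aCandidate) i (s₂.var rBest + 1) c = q + 1 ∧
            IsQuery L d (cell S L d 0 (rankOf d s) c (s.var rBox)) (s.arr aTable) q) ∧
          (∀ c < i + 1, Function.update (s₂.arr aCandidate) i (s₂.var rBest + 1) c ≤ a) ∧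
          s.var rAnswer ≤ a ∧ (a = s.var rAnswer ∨ ∃ c < i + 1,
            a = Function.update (s₂.arr aCandidate) i (s₂.var rBest + 1) c) := by
        intro a ha ha'
        have hle : s₁.var rAnswer ≤ a ∧ s₂.var rBest + 1 ≤ a := by
          by_cases h : s₁.var rAnswer < s₂.var rBest + 1
          · exact ⟨(ha h).symm ▸ h.le, (ha h).ge⟩
          · exact ⟨(ha' h).ge, (ha' h).symm ▸ not_lt.1 h⟩
        rw [hcand₂]
        refine ⟨fun c hc => ?_, fun c hc => ?_, ?_, ?_⟩
        · rcases Nat.lt_succ_iff_lt_or_eq.1 hc with hc | rfl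
          · rw [Function.update_of_ne hc.ne]
            exact h₁ c hc
          · exact ⟨_, Function.update_self .., hq₁, hq₂⟩
        · rcases Nat.lt_succ_iff_lt_or_eq.1 hc with hc | rfl
          · rw [Function.update_of_ne hc.ne]
            exact (h₂ c hc).trans hle.1
          · rw [Function.update_self]
            exact hle.2
        · exact h₃.trans hle.1
        · by_cases h : s₁.var rAnswer < s₂.var rBest + 1
          · exact .inr ⟨i, by omega, by rw [Function.update_self, ha h]⟩
          · rw [ha' h]
            refine h₄.imp_right fun ⟨c, hc, hh⟩ => ⟨c, by omega, ?_⟩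
            rw [Function.update_of_ne hc.ne, hh]
      simp +decide only [total_put, total_ifLt, total_assign, total_skip, eval_var,
        eval_const, eval_add, safe_var, safe_const, safe_add, true_and, and_true, hc₂, ha₂, hsafe,
        State.put_var, State.put_arr, State.set_var, State.set_arr, if_true]
      exact ⟨fun h _ => hpost _ (fun _ => rfl) (fun h' => absurd h h'),
        fun h _ => hpost _ (fun h' => absurd h' h) (fun _ => rfl)⟩
  · intro s' _ hI
    rw [eval_var, hE.codes] at hI
    exact hI le_rfl

/-- Move the last digit of a number with `k + 1` digits to the front. -/
def rotate (n k F : ℕ) : ℕ := F % n ^ k * n + F / n ^ k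

theorem rotate_lt {F : ℕ} (hn : 1 ≤ n) (hF : F < n ^ (k + 1)) : rotate n k F < n ^ (k + 1) := by
  rw [rotate, add_comm, mul_comm, pow_succ]
  have h₁ : F / n ^ k < n := Nat.div_lt_of_lt_mul (by rwa [← pow_succ])
  have h₂ : F % n ^ k < n ^ k := Nat.mod_lt _ (by positivity)
  calc F / n ^ k + n * (F % n ^ k) < n + n * (F % n ^ k) := by omega
    _ = (F % n ^ k + 1) * n := by ring
    _ ≤ n ^ k * n := Nat.mul_le_mul_right _ h₂

/-- The cell of the table for the tuple with code `F`, and the code `c` of levels. -/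
def tupleCell (S L d n k : ℕ) (rk : ℕ → ℕ → ℕ) (F c : ℕ) : ℕ :=
  cell S L d 1 rk (F % n ^ k) (F / n ^ k) c

theorem tuple_lt {x c : ℕ} (hx : x < n) (hc : c < n ^ k) : x * n ^ k + c < n ^ (k + 1) := by
  rw [pow_succ, mul_comm (n ^ k)]
  exact rank_index_lt hx hc

theorem iterate_rotate_lt {F : ℕ} (hn : 1 ≤ n) (hF : F < n ^ (k + 1)) (m : ℕ) :
    (rotate n k)^[m] F < n ^ (k + 1) := by
  induction m with
  | zero => exact hF
  | succ m ih =>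
    rw [Function.iterate_succ_apply']
    exact rotate_lt hn ih

/-- Queries replace only the last entry of a tuple. Storing each value under all `k + 1` rotations
lets later boxes extend any pile. In the last clause `m` is unrestricted because every rotation is
sound. -/
theorem insertCandidates_spec (hE : TableEnv w U n L d k S s) (hx : s.var rBox < n)
    (hk : k + 1 < 2 ^ w) :
    Total w U (insertCandidates k d) s fun s' =>
      (∀ a, s.arr aTable a ≤ s'.arr aTable a) ∧
      (∀ c < n ^ k, ∀ m < k + 1, ∀ l < L ^ d, s.arr aCandidate c ≤ s'.arr aTable
        (tupleCell S L d n k (rankOf d s) ((rotate n k)^[m] (s.var rBox * n ^ k + c)) l)) ∧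
      ∀ a, s'.arr aTable a = s.arr aTable a ∨ ∃ c < n ^ k, s'.arr aTable a = s.arr aCandidate c ∧
        ∃ m l, l < L ^ d ∧
        a = tupleCell S L d n k (rankOf d s) ((rotate n k)^[m] (s.var rBox * n ^ k + c)) l := by
  unfold insertCandidates
  have hU := hE.hU
  have hn := hE.one_le
  have hpow := pow_boxes_le hE (k + 1)
  have hpow' := hE.pow_le (m := k + 1) (by omega)
  have hpow₁ := pow_boxes_le hE k
  have hpow₁' := hE.pow_le (m := k) (by omega)
  generalize hrk : rankOf d s = rk at *
  refine Total.loop (fun i s' => i ≤ n ^ k →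
      (∀ a, s.arr aTable a ≤ s'.arr aTable a) ∧
      (∀ c < i, ∀ m < k + 1, ∀ l < L ^ d, s.arr aCandidate c ≤ s'.arr aTable
        (tupleCell S L d n k rk ((rotate n k)^[m] (s.var rBox * n ^ k + c)) l)) ∧
      ∀ a, s'.arr aTable a = s.arr aTable a ∨ ∃ c < i, s'.arr aTable a = s.arr aCandidate c ∧
        ∃ m l, l < L ^ d ∧
        a = tupleCell S L d n k rk ((rotate n k)^[m] (s.var rBox * n ^ k + c)) l) trivial
    (by simp) ?_ ?_
  · intro i hi s₁ hF hI
    rw [eval_var, hE.codes] at hi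
    obtain ⟨h₁, h₂, h₃⟩ := hI hi.le
    have hr₁ : rankOf d s₁ = rk := by
      rw [← hrk]
      funext x j
      rw [rankOf, rankOf, hF.arr _ rfl]
    have hb₁ : s₁.var rBox = s.var rBox := hF.var _ rfl
    have hn₁ : s₁.var rCodes = n ^ k := (hF.var _ rfl).trans hE.codes
    have hc₁ : s₁.arr aCandidate = s.arr aCandidate := hF.arr _ rfl
    have hlt := tuple_lt hx hi
    generalize hF₀ : s.var rBox * n ^ k + i = F at *
    have hsafe : s.var rBox * n ^ k < 2 ^ w ∧ F < 2 ^ w ∧ i < U := by omega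
    simp +decide only [total_seq, total_assign, eval_var, eval_add, eval_mul, eval_get,
      safe_var, safe_add, safe_mul, safe_get, State.set_var, State.set_arr, if_true, if_false,
      true_and, hb₁, hn₁, hF₀, hsafe]
    generalize hs₁' : ((s₁.set rCode i).set rTuple F).set rValue (s₁.arr aCandidate i) = s₁' at *
    have hv₁' : s₁'.var rValue = s.arr aCandidate i := by rw [← hs₁', hc₁]; simp
    have ht₁' : s₁'.arr aTable = s₁.arr aTable := by rw [← hs₁']; rfl
    have hr₁' : rankOf d s₁' = rk := by rw [← hs₁', ← hr₁]; rfl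
    have hE₁' : TableEnv w U n L d k S s₁' := by
      refine hE.congr (fun y hy => ?_) ?_
      · rw [← hs₁', ← hF.var y (by interval_cases y <;> rfl)]
        interval_cases y <;> simp +decide
      · rw [← hs₁', ← hF.arr aRank rfl]
        rfl
    refine Total.loop (fun m s' => s'.var rTuple = (rotate n k)^[m] F ∧
      (∀ a, s₁'.arr aTable a ≤ s'.arr aTable a) ∧
      (∀ m' < m, ∀ l < L ^ d, s.arr aCandidate i ≤ s'.arr aTable
        (tupleCell S L d n k rk ((rotate n k)^[m'] F) l)) ∧
      ∀ a, s'.arr aTable a = s₁'.arr aTable a ∨ s'.arr aTable a = s.arr aCandidate i ∧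
        ∃ m l, l < L ^ d ∧ a = tupleCell S L d n k rk ((rotate n k)^[m] F) l) hk ?_ ?_ ?_
    · refine ⟨?_, fun _ => le_rfl, fun _ h => absurd h (by omega), fun _ => .inl rfl⟩
      rw [← hs₁']
      simp +decide
    · rintro m hm s₂ hF₂ ⟨g₁, g₂, g₃, g₄⟩
      have hn₂ : s₂.var rCodes = n ^ k := (hF₂.var _ rfl).trans hE₁'.codes
      have hFm := iterate_rotate_lt hn hlt m
      have hFm' := rotate_lt hn hFm
      have hmod : (rotate n k)^[m] F % n ^ k < S ^ k :=
        (Nat.mod_lt _ (by positivity)).trans_le hpow₁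
      have hdiv : (rotate n k)^[m] F / n ^ k < n := Nat.div_lt_of_lt_mul (by rwa [← pow_succ])
      simp +decide only [total_seq, total_assign, eval_var, eval_mod, eval_div, safe_var, safe_mod,
        safe_div, State.set_var, State.set_arr, if_true, if_false, true_and, g₁, hn₂]
      generalize hs₂' : ((s₂.set rRotation m).set rKey ((rotate n k)^[m] F % n ^ k)).set rPoint
        ((rotate n k)^[m] F / n ^ k) = s₂'
      have hk₂' : s₂'.var rKey = (rotate n k)^[m] F % n ^ k := by rw [← hs₂']; simp +decide
      have hp₂' : s₂'.var rPoint = (rotate n k)^[m] F / n ^ k := by rw [← hs₂']; simp +decide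
      have ht₂' : s₂'.arr aTable = s₂.arr aTable := by rw [← hs₂']; rfl
      have hr₂' : rankOf d s₂' = rk := by
        rw [← hr₁', ← hs₂']
        funext x j
        rw [rankOf, rankOf, ← hF₂.arr _ rfl]
        rfl
      have hv₂' : s₂'.var rValue = s.arr aCandidate i := by
        rw [← hv₁', ← hF₂.var _ rfl, ← hs₂']
        simp +decide
      have hE₂' : TableEnv w U n L d k S s₂' := by
        refine hE₁'.congr (fun y hy => ?_) ?_
        · rw [← hs₂', ← hF₂.var y (by interval_cases y <;> rfl)]
          interval_cases y <;> simp +decide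
        · rw [← hs₂', ← hF₂.arr aRank rfl]
          rfl
      refine (update_spec hE₂' (by rwa [hk₂']) (by rwa [hp₂'])).mono ?_
      rintro s₃ hF₃ ⟨f₁, f₂, f₃⟩
      rw [hk₂', hp₂', hr₂', hv₂'] at f₂
      rw [hk₂', hp₂', hr₂', hv₂'] at f₃
      rw [ht₂'] at f₁ f₃
      have hk₃ : s₃.var rKey = (rotate n k)^[m] F % n ^ k := (hF₃.var _ rfl).trans hk₂'
      have hp₃ : s₃.var rPoint = (rotate n k)^[m] F / n ^ k := (hF₃.var _ rfl).trans hp₂'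
      have hn₃ : s₃.var rN = n := (hF₃.var _ rfl).trans hE₂'.boxes
      have hrot : (rotate n k)^[m] F % n ^ k * n + (rotate n k)^[m] F / n ^ k =
        rotate n k ((rotate n k)^[m] F) := rfl
      have hsafe : (rotate n k)^[m] F % n ^ k * n < 2 ^ w ∧
          rotate n k ((rotate n k)^[m] F) < 2 ^ w := by omega
      simp +decide only [eval_var, eval_mul, eval_add, safe_var, safe_mul, safe_add,
        true_and, hk₃, hp₃, hn₃, hrot, hsafe,
        Function.iterate_succ_apply']
      refine ⟨fun a => (g₂ a).trans (f₁ a), fun m' hm' l hl => ?_, fun a => ?_⟩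
      · rcases Nat.lt_succ_iff_lt_or_eq.1 hm' with hm' | rfl
        · exact (g₃ m' hm' l hl).trans (f₁ _)
        · exact f₂ l hl
      · rcases f₃ a with h | ⟨h, l, hl, hal⟩
        · rw [h]
          exact g₄ a
        · exact .inr ⟨h, m, l, hl, hal⟩
    · rintro s₂ hF₂ ⟨-, g₂, g₃, g₄⟩ -
      rw [eval_const] at g₃
      refine ⟨fun a => (h₁ a).trans (ht₁' ▸ g₂ a), fun c hc m hm l hl => ?_, fun a => ?_⟩
      · rcases Nat.lt_succ_iff_lt_or_eq.1 hc with hc | rfl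
        · exact (h₂ c hc m hm l hl).trans (ht₁' ▸ g₂ _)
        · rw [hF₀]
          exact g₃ m hm l hl
      · rcases g₄ a with h | ⟨h, m, l, hl, hal⟩
        · rw [h, ht₁']
          exact (h₃ a).imp_right fun ⟨c, hc, hh⟩ => ⟨c, by omega, hh⟩
        · exact .inr ⟨i, by omega, h, m, l, hl, hF₀ ▸ hal⟩
  · intro s' _ hI
    rw [eval_var, hE.codes] at hI
    exact hI le_rfl

end NestedBoxes

namespace NestedBoxes

/-! ### Tuples of boxes -/

section Tuples

variable {n k : ℕ}

/-- The code of a tuple of boxes. -/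
def tupleCode (T : Fin (k + 1) → Fin n) : ℕ := ∑ i, (T i : ℕ) * n ^ (i : ℕ)

theorem tupleCode_eq (T : Fin (k + 1) → Fin n) :
    ∃ c < n ^ k, c = ∑ i : Fin k, (T i.castSucc : ℕ) * n ^ (i : ℕ) ∧
      tupleCode T = T (Fin.last k) * n ^ k + c := by
  have h := (finFunctionFinEquiv fun i : Fin k => T i.castSucc).2
  rw [finFunctionFinEquiv_apply] at h
  refine ⟨_, h, rfl, ?_⟩
  rw [tupleCode, Fin.sum_univ_castSucc]
  simp [add_comm]

theorem mul_add_mod_of_lt {a b c : ℕ} (h : c < b) : (a * b + c) % b = c := by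
  rw [add_comm, Nat.add_mul_mod_self_right, Nat.mod_eq_of_lt h]

theorem tupleCode_div (T : Fin (k + 1) → Fin n) : tupleCode T / n ^ k = T (Fin.last k) := by
  obtain ⟨c, hc, -, h⟩ := tupleCode_eq T
  rw [h, add_comm, Nat.add_mul_div_right _ _ (by omega), Nat.div_eq_of_lt hc, zero_add]

/-- The last entry is the leading digit, so the remaining `k` digits, which form the key of the
table row, are unaffected. -/
theorem tupleCode_update (T : Fin (k + 1) → Fin n) (x : Fin n) :
    tupleCode (Function.update T (Fin.last k) x) = x * n ^ k + tupleCode T % n ^ k := by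
  obtain ⟨c, hc, hc', h⟩ := tupleCode_eq T
  obtain ⟨c₁, hc₁, hc₁', h₁⟩ := tupleCode_eq (Function.update T (Fin.last k) x)
  rw [h₁, h, mul_add_mod_of_lt hc, Function.update_self, hc₁', hc']
  congr 1
  refine Finset.sum_congr rfl fun i _ => ?_
  rw [Function.update_of_ne (Fin.castSucc_lt_last i).ne]

theorem exists_tupleCode {x : Fin n} {c : ℕ} (hc : c < n ^ k) :
    ∃ T : Fin (k + 1) → Fin n, T (Fin.last k) = x ∧ tupleCode T = x * n ^ k + c := by
  have hlt : x * n ^ k + c < n ^ (k + 1) := tuple_lt x.2 hc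
  have h : tupleCode (finFunctionFinEquiv.symm (⟨_, hlt⟩ : Fin (n ^ (k + 1)))) =
      x * n ^ k + c := by
    rw [tupleCode, ← finFunctionFinEquiv_apply, Equiv.apply_symm_apply]
  refine ⟨_, ?_, h⟩
  apply Fin.ext
  rw [← tupleCode_div, h, add_comm, Nat.add_mul_div_right _ _ (by omega), Nat.div_eq_of_lt hc,
    zero_add]

theorem rotate_tupleCode (T : Fin (k + 1) → Fin n) :
    rotate n k (tupleCode T) = tupleCode fun i => T (i - 1) := by
  obtain ⟨c, hc, hc', h⟩ := tupleCode_eq T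
  rw [rotate, tupleCode_div, h, mul_add_mod_of_lt hc, tupleCode, Fin.sum_univ_succ, hc']
  have h₁ : (0 : Fin (k + 1)) - 1 = Fin.last k := by
    rw [sub_eq_iff_eq_add, Fin.last_add_one]
  have h₂ : ∀ i : Fin k, i.succ - 1 = i.castSucc := fun i => by
    rw [sub_eq_iff_eq_add, Fin.coeSucc_eq_succ]
  simp only [h₁, h₂, Fin.val_zero, pow_zero, mul_one, Fin.val_succ, pow_succ, Finset.sum_mul,
    mul_assoc]
  rw [add_comm]

theorem iterate_rotate_tupleCode (T : Fin (k + 1) → Fin n) (m : ℕ) :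
    (rotate n k)^[m] (tupleCode T) = tupleCode fun i => T (i - m • 1) := by
  induction m with
  | zero => simp
  | succ m ih =>
    rw [Function.iterate_succ_apply', ih, rotate_tupleCode]
    congr 1
    funext i
    rw [succ_nsmul', sub_sub]

/-- Shows that fewer than `k + 1` successive rotations produce every cyclic shift of the piles. -/
theorem val_nsmul_one (t : Fin (k + 1)) : (t : ℕ) • (1 : Fin (k + 1)) = t := by
  induction t using Fin.induction with
  | zero => simp
  | succ i ih =>
    rw [Fin.val_succ, succ_nsmul, ← Fin.coeSucc_eq_succ]
    congr 1

end Tuples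

/-! ### Pilings -/

section Pilings

variable {n d k : ℕ} {B : Fin n → Fin d → ℕ}

theorem FitsInto.refl (a : Fin d → ℕ) : FitsInto a a := fun _ => le_rfl

theorem FitsInto.trans {a b c : Fin d → ℕ} (h : FitsInto a b) (h' : FitsInto b c) :
    FitsInto a c := fun i => (h i).trans (h' i)

theorem pairwise_fits {l : List (Fin n)} (h : l.IsChain fun a b => FitsInto (B a) (B b)) :
    l.Pairwise fun a b => FitsInto (B a) (B b) := by
  have : IsTrans (Fin n) fun a b => FitsInto (B a) (B b) := ⟨fun _ _ _ => FitsInto.trans⟩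
  exact List.isChain_iff_pairwise.1 h

/-- There are piles of boxes from `P` with `v` boxes altogether, such that the boxes of pile `t`
fit into the box `T t`. -/
def Reach (B : Fin n → Fin d → ℕ) (P : Finset (Fin n)) (T : Fin k → Fin n) (v : ℕ) : Prop :=
  ∃ p : Fin k → List (Fin n), IsPiling B p ∧ (∀ t, ∀ b ∈ p t, b ∈ P ∧ FitsInto (B b) (B (T t))) ∧
    ∑ t, (p t).length = v

theorem reach_zero (P : Finset (Fin n)) (T : Fin k → Fin n) : Reach B P T 0 :=
  ⟨fun _ => [], ⟨by simp, by simp, by simp⟩, by simp, by simp⟩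

theorem Reach.mono {P P' : Finset (Fin n)} {T : Fin k → Fin n} {v : ℕ} (h : Reach B P T v)
    (hP : P ⊆ P') : Reach B P' T v := by
  obtain ⟨p, h₁, h₂, h₃⟩ := h
  exact ⟨p, h₁, fun t b hb => ⟨hP (h₂ t b hb).1, (h₂ t b hb).2⟩, h₃⟩

theorem IsPiling.comp {p : Fin k → List (Fin n)} (h : IsPiling B p) (σ : Equiv.Perm (Fin k)) :
    IsPiling B fun t => p (σ t) where
  fits _ := h.fits _
  nodup _ := h.nodup _
  disjoint _ _ hst := h.disjoint _ _ (σ.injective.ne hst)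

theorem Reach.comp {P : Finset (Fin n)} {T : Fin k → Fin n} {v : ℕ} (h : Reach B P T v)
    (σ : Equiv.Perm (Fin k)) : Reach B P (fun t => T (σ t)) v := by
  obtain ⟨p, h₁, h₂, h₃⟩ := h
  exact ⟨fun t => p (σ t), h₁.comp σ, fun t => h₂ _, by
    rw [← h₃]; exact Equiv.sum_comp σ fun t => (p t).length⟩

theorem sum_length_update (p : Fin k → List (Fin n)) (t : Fin k) (l : List (Fin n)) :
    ∑ s, (Function.update p t l s).length + (p t).length = ∑ s, (p s).length + l.length := by
  rw [← Finset.add_sum_erase _ _ (Finset.mem_univ t),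
    ← Finset.add_sum_erase _ (fun s => (p s).length) (Finset.mem_univ t), Function.update_self]
  have : ∑ s ∈ Finset.univ.erase t, (Function.update p t l s).length =
      ∑ s ∈ Finset.univ.erase t, (p s).length :=
    Finset.sum_congr rfl fun s hs => by rw [Function.update_of_ne (Finset.ne_of_mem_erase hs)]
  omega

/-- All boxes of pile `t` fit into `T t`, hence into `x`, which can go on top. The entry `T t` need
not lie on its pile, so this also covers an empty pile with the entry `x`. -/
theorem Reach.step {P : Finset (Fin n)} {T : Fin k → Fin n} {v : ℕ} {x : Fin n} {t : Fin k}
    (h : Reach B P T v) (hx : x ∉ P) (hfit : FitsInto (B (T t)) (B x)) :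
    Reach B (insert x P) (Function.update T t x) (v + 1) := by
  obtain ⟨p, h₁, h₂, h₃⟩ := h
  have hxp : ∀ s, x ∉ p s := fun s hs => hx (h₂ s x hs).1
  refine ⟨Function.update p t (p t ++ [x]), ⟨fun s => ?_, fun s => ?_, fun s s' hs => ?_⟩,
    fun s b hb => ?_, ?_⟩
  · by_cases hst : s = t
    · subst hst
      rw [Function.update_self, List.isChain_append]
      refine ⟨h₁.fits s, by simp, fun b hb y hy => ?_⟩
      simp only [List.head?_cons, Option.mem_some_iff] at hy
      subst hy
      exact (h₂ s b (List.mem_of_getLast? hb)).2.trans hfit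
    · rw [Function.update_of_ne hst]
      exact h₁.fits s
  · by_cases hst : s = t
    · subst hst
      rw [Function.update_self, List.nodup_append]
      refine ⟨h₁.nodup s, by simp, fun a ha b hb => ?_⟩
      rw [List.mem_singleton] at hb
      rintro rfl
      exact hxp s (hb ▸ ha)
    · rw [Function.update_of_ne hst]
      exact h₁.nodup s
  · have key : ∀ s ≠ t, (p s).Disjoint (p t ++ [x]) := by
      intro s hst b hb hb'
      rw [List.mem_append, List.mem_singleton] at hb'
      rcases hb' with hb' | rfl
      · exact h₁.disjoint s t hst hb hb'
      · exact hxp s hb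
    by_cases hst : s = t
    · subst hst
      rw [Function.update_self, Function.update_of_ne hs.symm]
      exact (key s' hs.symm).symm
    · rw [Function.update_of_ne hst]
      by_cases hst' : s' = t
      · subst hst'
        rw [Function.update_self]
        exact key s hst
      · rw [Function.update_of_ne hst']
        exact h₁.disjoint s s' hs
  · by_cases hst : s = t
    · subst hst
      rw [Function.update_self, List.mem_append, List.mem_singleton] at hb
      rw [Function.update_self]
      rcases hb with hb | rfl
      · exact ⟨Finset.mem_insert_of_mem (h₂ s b hb).1, (h₂ s b hb).2.trans hfit⟩
      · exact ⟨Finset.mem_insert_self _ _, .refl _⟩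
    · rw [Function.update_of_ne hst] at hb ⊢
      exact ⟨Finset.mem_insert_of_mem (h₂ s b hb).1, (h₂ s b hb).2⟩
  · have := sum_length_update p t (p t ++ [x])
    rw [List.length_append, List.length_singleton] at this
    omega

/-- Removing a box from the middle keeps a chain because fitting is transitive; hence the passage
through `List.Pairwise`. -/
theorem IsPiling.erase {p : Fin k → List (Fin n)} (h : IsPiling B p) (x : Fin n) (t : Fin k) :
    IsPiling B (Function.update p t ((p t).erase x)) := by
  have hsub : ∀ s, (Function.update p t ((p t).erase x) s).Sublist (p s) := by
    intro s
    by_cases hst : s = t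
    · subst hst
      rw [Function.update_self]
      exact List.erase_sublist
    · rw [Function.update_of_ne hst]
  exact ⟨fun s => (List.Pairwise.sublist (hsub s) (pairwise_fits (h.fits s))).isChain,
    fun s => (h.nodup s).sublist (hsub s),
    fun s s' hs b hb hb' => h.disjoint s s' hs ((hsub s).subset hb) ((hsub s').subset hb')⟩

/-- For all piles of boxes from `P`, the number of boxes is a value of some tuple of boxes from
these piles, where the entries for the empty piles are arbitrary. -/
def Complete (B : Fin n → Fin d → ℕ) (P : Finset (Fin n)) (Val : (Fin k → Fin n) → ℕ → Prop) :
    Prop :=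
  ∀ p : Fin k → List (Fin n), IsPiling B p → (∀ t, ∀ b ∈ p t, b ∈ P) → ∀ T₀ : Fin k → Fin n,
    ∃ T : Fin k → Fin n, (∀ t, p t = [] → T t = T₀ t) ∧ (∀ t, p t ≠ [] → T t ∈ p t) ∧
      Val T (∑ t, (p t).length)

theorem complete_empty {Val : (Fin k → Fin n) → ℕ → Prop} (h : ∀ T, Val T 0) :
    Complete B ∅ Val := by
  intro p _ hp T₀
  have hnil : ∀ t, p t = [] := fun t =>
    List.eq_nil_iff_forall_not_mem.2 fun b hb => by simpa using hp t b hb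
  exact ⟨T₀, fun _ _ => rfl, fun t ht => absurd (hnil t) ht, by simpa [hnil] using h T₀⟩

/-- If `x` is on pile `t`, remove it and rotate the piling so that this pile becomes the last one.
The hypothesis covers the rotated piling too, so `Val` need not be symmetric. Then put `x` back as
the last entry and undo the rotation. A piling without `x` is covered by `hmono`. -/
theorem Complete.step {P : Finset (Fin n)} {Val Val' : (Fin (k + 1) → Fin n) → ℕ → Prop}
    (h : Complete B P Val) {x : Fin n}
    (horder : ∀ e ∈ P, FitsInto (B x) (B e) → FitsInto (B e) (B x))
    (hmono : ∀ T v, Val T v → Val' T v)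
    (hstep : ∀ T v m, Val T v → FitsInto (B (T (Fin.last k))) (B x) →
      Val' (fun i => Function.update T (Fin.last k) x (i - m)) (v + 1)) :
    Complete B (insert x P) Val' := by
  intro p hp hpP T₀
  by_cases hxp : ∃ t, x ∈ p t
  · obtain ⟨t, ht⟩ := hxp
    obtain ⟨m, hm⟩ : ∃ m, Fin.last k + m = t := ⟨t - Fin.last k, by abel⟩
    have hnot : ∀ s ≠ t, x ∉ p s := fun s hs hxs => hp.disjoint s t hs hxs ht
    have hmem : ∀ b, b ∈ (p t).erase x ↔ b ≠ x ∧ b ∈ p t := fun b =>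
      (hp.nodup t).mem_erase_iff
    have hP : ∀ s, ∀ b ∈ Function.update p t ((p t).erase x) s, b ∈ P := by
      intro s b hb
      by_cases hst : s = t
      · subst hst
        rw [Function.update_self, hmem] at hb
        exact (Finset.mem_insert.1 (hpP s b hb.2)).resolve_left hb.1
      · rw [Function.update_of_ne hst] at hb
        exact (Finset.mem_insert.1 (hpP s b hb)).resolve_left fun hbx => hnot s hst (hbx ▸ hb)
    -- The default entry for pile `t` is set to `x`: if `x` was alone on its pile, the predecessor
    -- of `x` is `x` itself.
    obtain ⟨T, h₁, h₂, h₃⟩ := h _ ((hp.erase x t).comp (Equiv.addRight m)) (fun s => hP _)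
      fun i => Function.update T₀ t x (i + m)
    simp only [Equiv.coe_addRight] at h₁ h₂ h₃
    have hfit : FitsInto (B (T (Fin.last k))) (B x) := by
      by_cases hnil : (p t).erase x = []
      · rw [h₁ (Fin.last k) (by rw [hm, Function.update_self, hnil]), hm, Function.update_self]
        exact .refl _
      · have hT := h₂ (Fin.last k) (by rwa [hm, Function.update_self])
        have hTP := hP _ _ hT
        rw [hm, Function.update_self, hmem] at hT
        -- The box `x` need not be on top of its pile. Any other box there is comparable with `x`,
        -- and if `x` fits into it, the processing order gives the converse.
        have hpair : (p t).Pairwise fun a b =>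
            FitsInto (B a) (B b) ∨ FitsInto (B b) (B a) :=
          (pairwise_fits (hp.fits t)).imp Or.inl
        have : Std.Symm fun a b => FitsInto (B a) (B b) ∨ FitsInto (B b) (B a) :=
          ⟨fun _ _ => Or.symm⟩
        rcases hpair.forall hT.2 ht hT.1 with h | h
        · exact h
        · exact horder _ hTP h
    refine ⟨fun i => Function.update T (Fin.last k) x (i - m), fun s hs => ?_, fun s hs => ?_, ?_⟩
    · have hst : s ≠ t := by
        rintro rfl
        simp [hs] at ht
      have hsm : s - m ≠ Fin.last k := fun hh => hst (by rw [← hm, ← hh]; abel)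
      have := h₁ (s - m)
      simp only [sub_add_cancel, Function.update_of_ne hst] at this
      simp only [Function.update_of_ne hsm]
      exact this hs
    · by_cases hst : s = t
      · subst hst
        have hsm : s - m = Fin.last k := by rw [← hm]; abel
        simp only [hsm, Function.update_self]
        exact ht
      · have hsm : s - m ≠ Fin.last k := fun hh => hst (by rw [← hm, ← hh]; abel)
        have := h₂ (s - m)
        simp only [sub_add_cancel, Function.update_of_ne hst] at this
        simp only [Function.update_of_ne hsm]
        exact this hs
    · have := hstep T _ m h₃ hfit
      have hsum := Equiv.sum_comp (Equiv.addRight m)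
        fun s => (Function.update p t ((p t).erase x) s).length
      simp only [Equiv.coe_addRight] at hsum
      rw [hsum] at this
      have hlen := sum_length_update p t ((p t).erase x)
      have hpos := List.length_pos_of_mem ht
      rw [List.length_erase_of_mem ht] at hlen
      rwa [show ∑ s, (Function.update p t ((p t).erase x) s).length + 1 = ∑ s, (p s).length by
        omega] at this
  · push Not at hxp
    obtain ⟨T, h₁, h₂, h₃⟩ := h p hp (fun t b hb =>
      (Finset.mem_insert.1 (hpP t b hb)).resolve_left fun hbx => hxp t (hbx ▸ hb)) T₀
    exact ⟨T, h₁, h₂, hmono _ _ h₃⟩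

end Pilings

end NestedBoxes

namespace NestedBoxes

open WordRAM WordRAM.Stmt WordRAM.Expr

/-! ### Correctness of the dynamic program -/

section Table

variable {n d k S L : ℕ} {B : Fin n → Fin d → ℕ} {rk : ℕ → ℕ → ℕ}

/-- The numbers `rk x i` are ranks of the boxes `B`. -/
structure IsRank (S L : ℕ) (B : Fin n → Fin d → ℕ) (rk : ℕ → ℕ → ℕ) : Prop where
  fits : ∀ x y : Fin n, FitsInto (B x) (B y) ↔ ∀ i < d, rk x i ≤ rk y i
  le : ∀ x < n, ∀ i < d, rk x i ≤ n
  le_size : n + 2 ≤ S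
  lt_pow : n + 1 < 2 ^ L
  levels_pos : 1 ≤ L
  levels_le : L ≤ S

/-- The table `T` and the preliminary answer `ans` after the boxes in `P` have been processed. -/
structure TableOk (k S L : ℕ) (B : Fin n → Fin d → ℕ) (rk : ℕ → ℕ → ℕ) (P : Finset (Fin n))
    (T : ℕ → ℕ) (ans i : ℕ) : Prop where
  sound : ∀ a, T a = 0 ∨ ∃ F : Fin (k + 1) → Fin n, ∃ l, l < L ^ d ∧
    a = tupleCell S L d n k rk (tupleCode F) l ∧ Reach B P F (T a)
  complete : Complete B P fun (F : Fin (k + 1) → Fin n) v =>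
    ∀ l < L ^ d, v ≤ T (tupleCell S L d n k rk (tupleCode F) l)
  le : ∀ a, T a ≤ i
  le_ans : ∀ a, T a ≤ ans
  ans : ∃ F : Fin (k + 1) → Fin n, Reach B P F ans

theorem tableOk_zero {T : ℕ → ℕ} (hn : 1 ≤ n) (hT : ∀ a, T a = 0) :
    TableOk k S L B rk ∅ T 0 0 where
  sound a := .inl (hT a)
  complete := complete_empty fun _ _ _ => Nat.zero_le _
  le a := (hT a).le
  le_ans a := (hT a).le
  ans := ⟨fun _ => ⟨0, hn⟩, reach_zero _ _⟩

theorem IsRank.level_lt (h : IsRank S L B rk) (a : ℕ) : a % L < S :=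
  (Nat.mod_lt _ h.levels_pos).trans_le h.levels_le

/-- Soundness of queries: a tuple is found only if its other entries match and its last box fits. -/
theorem cell_query_eq (h : IsRank S L B rk) {F : Fin (k + 1) → Fin n} {x : Fin n} {c l l' : ℕ}
    (hc : tupleCell S L d n k rk (tupleCode F) l = cell S L d 0 rk c x l') :
    tupleCode F % n ^ k = c ∧ FitsInto (B (F (Fin.last k))) (B x) := by
  rw [tupleCell, tupleCode_div] at hc
  obtain ⟨h₁, h₂⟩ := cellAt_inj d h.le_size le_rfl zero_le_one (h.le _ (F _).2) (h.le _ x.2)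
    (fun _ _ => h.level_lt _) (fun _ _ => h.level_lt _) hc
  refine ⟨h₁, (h.fits _ _).2 fun i hi => ?_⟩
  have := h₂ i hi
  simp only [Nat.add_sub_cancel, Nat.sub_zero, add_zero] at this
  exact le_of_block_eq this

/-- Completeness of queries: choose a level in each coordinate by `exists_block_eq` and encode these
levels. -/
theorem exists_cell_eq (h : IsRank S L B rk) {F : Fin (k + 1) → Fin n} {x : Fin n}
    (hfit : FitsInto (B (F (Fin.last k))) (B x)) :
    ∃ l < L ^ d, tupleCell S L d n k rk (tupleCode F) l =
      cell S L d 0 rk (tupleCode F % n ^ k) x l := by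
  have hrk := (h.fits _ _).1 hfit
  have : ∀ i, ∃ ℓ, i < d → ℓ < L ∧ rk (F (Fin.last k)) i / 2 ^ ℓ + 1 = (rk x i + 1) / 2 ^ ℓ := by
    intro i
    by_cases hi : i < d
    · obtain ⟨ℓ, h₁, h₂⟩ := exists_block_eq (hrk i hi)
        (show rk x i + 1 < 2 ^ L from (Nat.succ_le_succ (h.le x x.2 i hi)).trans_lt h.lt_pow)
      exact ⟨ℓ, fun _ => ⟨h₁, h₂⟩⟩
    · exact ⟨0, fun hi' => absurd hi' hi⟩
  choose ℓ hℓ using this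
  obtain ⟨l, hl, hl'⟩ := exists_levelCode ℓ fun i hi => (hℓ i hi).1
  refine ⟨l, hl, ?_⟩
  rw [tupleCell, tupleCode_div]
  exact cellAt_eq fun i hi => by rw [hl' i hi]; exact (hℓ i hi).2

/-- Each candidate comes from a stored tuple whose last box fits into `x`, or from no tuple at all;
`Reach.step` then gives soundness. Conversely, the query for `x` sees every stored tuple that
`Complete.step` may ask for. The hypotheses on `cand`, `ans'` and `T'` are the postconditions of the
program. -/
theorem TableOk.step (h : IsRank S L B rk) {P : Finset (Fin n)} {T T' cand : ℕ → ℕ}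
    {ans ans' i : ℕ} (hT : TableOk k S L B rk P T ans i) {x : Fin n} (hx : x ∉ P)
    (horder : ∀ e ∈ P, FitsInto (B x) (B e) → FitsInto (B e) (B x))
    (hcand : ∀ c < n ^ k, ∃ q, cand c = q + 1 ∧ IsQuery L d (cell S L d 0 rk c x) T q)
    (hans₁ : ∀ c < n ^ k, cand c ≤ ans') (hans₂ : ans ≤ ans')
    (hans₃ : ans' = ans ∨ ∃ c < n ^ k, ans' = cand c)
    (hins₁ : ∀ a, T a ≤ T' a)
    (hins₂ : ∀ c < n ^ k, ∀ m < k + 1, ∀ l < L ^ d, cand c ≤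
      T' (tupleCell S L d n k rk ((rotate n k)^[m] (x * n ^ k + c)) l))
    (hins₃ : ∀ a, T' a = T a ∨ ∃ c < n ^ k, T' a = cand c ∧ ∃ m l, l < L ^ d ∧
      a = tupleCell S L d n k rk ((rotate n k)^[m] (x * n ^ k + c)) l) :
    TableOk k S L B rk (insert x P) T' ans' (i + 1) := by
  have hreach : ∀ c < n ^ k, ∃ F : Fin (k + 1) → Fin n, tupleCode F = x * n ^ k + c ∧
      Reach B (insert x P) F (cand c) := by
    intro c hc
    obtain ⟨q, hq, -, hq'⟩ := hcand c hc
    rw [hq]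
    obtain ⟨F, hF, hFc⟩ := exists_tupleCode (x := x) hc
    -- The value `0` need not belong to any tuple. Then `x` alone is a solution for the tuple with
    -- last entry `x` and code `c` for the others.
    have hzero : q = 0 → ∃ F : Fin (k + 1) → Fin n, tupleCode F = x * n ^ k + c ∧
        Reach B (insert x P) F (q + 1) := by
      rintro rfl
      refine ⟨F, hFc, ?_⟩
      have := (reach_zero (B := B) P F).step (t := Fin.last k) hx (by rw [hF]; exact .refl _)
      rwa [← hF, Function.update_eq_self, hF] at this
    rcases hq' with hq0 | ⟨l, hl, hql⟩
    · exact hzero hq0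
    · rcases hT.sound (cell S L d 0 rk c x l) with h0 | ⟨F', l', -, hcell, hR⟩
      · exact hzero (hql.trans h0)
      · obtain ⟨hkey, hfit⟩ := cell_query_eq h hcell.symm
        refine ⟨_, ?_, (hql ▸ hR).step hx hfit⟩
        rw [tupleCode_update, hkey]
  have hle : ∀ c < n ^ k, cand c ≤ i + 1 := by
    intro c hc
    obtain ⟨q, hq, -, hq'⟩ := hcand c hc
    rw [hq]
    rcases hq' with rfl | ⟨l, -, rfl⟩
    · omega
    · exact Nat.succ_le_succ (hT.le _)
  refine ⟨fun a => ?_, ?_, fun a => ?_, fun a => ?_, ?_⟩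
  · rcases hins₃ a with ha | ⟨c, hc, ha, m, l, hl, hal⟩
    · rw [ha]
      exact (hT.sound a).imp_right fun ⟨F, l, hl, hal, hR⟩ =>
        ⟨F, l, hl, hal, hR.mono (Finset.subset_insert _ _)⟩
    · obtain ⟨F, hF, hR⟩ := hreach c hc
      refine .inr ⟨fun i => F (i - m • 1), l, hl, ?_, ?_⟩
      · rw [hal, ← hF, iterate_rotate_tupleCode]
      · rw [ha]
        exact hR.comp (Equiv.subRight (m • 1))
  · refine hT.complete.step horder (fun F v hv l hl => (hv l hl).trans (hins₁ _))
      fun F v m hv hfit l hl => ?_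
    have hc : tupleCode F % n ^ k < n ^ k :=
      Nat.mod_lt _ (Nat.pow_pos (by have := x.2; omega))
    obtain ⟨q, hq, hq', -⟩ := hcand _ hc
    obtain ⟨l', hl', hcell⟩ := exists_cell_eq h hfit
    have h₁ : v ≤ q := (hv l' hl').trans (hcell ▸ hq' l' hl')
    -- The shift by `m : Fin (k + 1)` is realized by `m` rotations.
    have h₂ := hins₂ _ hc m m.2 l hl
    rw [← tupleCode_update, iterate_rotate_tupleCode, val_nsmul_one, hq] at h₂
    exact (Nat.succ_le_succ h₁).trans h₂
  · rcases hins₃ a with ha | ⟨c, hc, ha, -⟩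
    · rw [ha]
      exact (hT.le a).trans (by omega)
    · rw [ha]
      exact hle c hc
  · rcases hins₃ a with ha | ⟨c, hc, ha, -⟩
    · rw [ha]
      exact (hT.le_ans a).trans hans₂
    · rw [ha]
      exact hans₁ c hc
  · rcases hans₃ with rfl | ⟨c, hc, rfl⟩
    · obtain ⟨F, hF⟩ := hT.ans
      exact ⟨F, hF.mono (Finset.subset_insert _ _)⟩
    · obtain ⟨F, -, hF⟩ := hreach c hc
      exact ⟨F, hF⟩

/-- The tuple that accounts for a given piling has at least one cell, since `0 < L ^ d`, and its
value is bounded by the answer. -/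
theorem TableOk.isOptimum (h : IsRank S L B rk) {T : ℕ → ℕ} {ans i : ℕ}
    (hT : TableOk k S L B rk Finset.univ T ans i) : IsOptimum (k + 1) B ans := by
  obtain ⟨F, p, hp, -, hans⟩ := hT.ans
  refine ⟨⟨p, hp, hans⟩, ?_⟩
  rintro m ⟨p', hp', rfl⟩
  obtain ⟨F', -, -, hF'⟩ := hT.complete p' hp' (fun _ _ _ => Finset.mem_univ _) F
  exact (hF' 0 (Nat.pow_pos h.levels_pos)).trans (hT.le_ans _)

end Table

/-! ### The loop over the boxes in the order of their rank sums -/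

section Solve

variable {w U n L d k S : ℕ} {s : State} {B : Fin n → Fin d → ℕ}

theorem solve_spec (hE : TableEnv w U n L d k S s) (hR : IsRank S L B (rankOf d s))
    (hLU : 2 ^ (L + 1) ≤ U) (hT : s.var rTree = 2 ^ L) (hk : k + 1 < 2 ^ w) (hnU : n ≤ U)
    (hsum : ∀ x < n, s.arr aRankSum x = ∑ i ∈ Finset.range d, rankOf d s x i)
    (htree : EmptyTree n L (s.arr aTree)) (htable : ∀ a, s.arr aTable a = 0)
    (hans : s.var rAnswer = 0) :
    Total w U (solve k d) s fun s' => IsOptimum (k + 1) B (s'.var rAnswer) := by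
  have hU := hE.hU
  have hn := hE.one_le
  have h0 : 0 < 2 ^ w := by omega
  have h1 : 1 < 2 ^ w := by omega
  unfold solve
  simp +decide only [total_seq, total_assign, eval_const, safe_const, h0, h1, true_and]
  generalize hs₁ : (s.set rKeyBase 0).set rKeyStep 1 = s₁
  have hv₁ : ∀ y, y ≠ rKeyBase → y ≠ rKeyStep → s₁.var y = s.var y := by
    intro y h₁ h₂
    rw [← hs₁]
    simp [h₁, h₂]
  have ha₁ : s₁.arr = s.arr := by rw [← hs₁]; rfl
  have hkey₁ : ∀ x, keyOf aRankSum s₁ x = s.arr aRankSum x := by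
    intro x
    rw [keyOf, ← hs₁]
    simp +decide
  have hTE : TreeEnv w U n L aRankSum s₁ := by
    refine ⟨by decide, hU, hLU, by have := hR.lt_pow; omega, ?_, ?_, ?_, fun x hx => ?_⟩
    · rw [hv₁ _ (by decide) (by decide), hE.levels]
    · rw [hv₁ _ (by decide) (by decide), hT]
    · rw [hv₁ _ (by decide) (by decide), hE.boxes]
    · rw [← hs₁]
      simp +decide
      omega
  refine (fill_spec hTE (by rwa [ha₁])).mono fun s₂ hF₂ hfill => ?_
  have hrank : ∀ s' : State, s'.arr aRank = s₂.arr aRank → rankOf d s' = rankOf d s := by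
    intro s' h
    funext x i
    rw [rankOf, h, hF₂.arr _ rfl, ha₁, rankOf]
  have hn₂ : s₂.var rN = n := (hF₂.var _ rfl).trans hTE.boxes
  -- The processed boxes are those that are no longer in the tournament tree.
  let P : Finset ℕ → Finset (Fin n) := fun A => Finset.univ.filter fun x => (x : ℕ) ∉ A
  refine Total.loop (fun i s' => i ≤ n → ∃ A : Finset ℕ, A.card + i = n ∧
    HasTree n L (s.arr aRankSum) (s'.arr aTree) A ∧
    (∀ x < n, x ∉ A → ∀ y ∈ A, s.arr aRankSum x ≤ s.arr aRankSum y) ∧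
    TableOk k S L B (rankOf d s) (P A) (s'.arr aTable) (s'.var rAnswer) i) trivial ?_ ?_ ?_
  · refine fun _ => ⟨Finset.range n, by simp, ?_, fun x hx hxA => ?_, ?_⟩
    · rwa [funext hkey₁] at hfill
    · exact absurd (Finset.mem_range.2 hx) hxA
    · have hP : P (Finset.range n) = ∅ := by simp [P]
      rw [hP, hF₂.var rAnswer rfl, hv₁ _ (by decide) (by decide), hans]
      refine tableOk_zero hn fun a => ?_
      rw [hF₂.arr _ rfl, ha₁, htable]
  · intro i hi s₃ hF₃ hI
    rw [eval_var, hn₂] at hi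
    obtain ⟨A, hcard, htr, hord, hok⟩ := hI hi.le
    have hne : A.Nonempty := by
      rw [← Finset.card_pos]
      omega
    have hv₃ : ∀ y, y ≠ rCount → y ≠ rKeyBase → y ≠ rKeyStep → (fill aRankSum).writesVar y = false →
        (loop rCount (var rN) (pop aRankSum ;; computeCandidates d ;;
          insertCandidates k d)).writesVar y = false → (s₃.set rCount i).var y = s.var y := by
      intro y h₁ h₂ h₃ h₄ h₅
      rw [State.set_var, if_neg h₁, hF₃.var y h₅, hF₂.var y h₄, hv₁ y h₂ h₃]
    have hkey₃ : keyOf aRankSum (s₃.set rCount i) = s.arr aRankSum := by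
      funext x
      rw [← hkey₁ x, keyOf, keyOf, State.set_arr, hF₃.arr _ rfl, hF₂.arr _ rfl]
      simp +decide only [State.set_var, if_false]
      rw [hF₃.var rKeyBase rfl, hF₃.var rKeyStep rfl, hF₂.var rKeyBase rfl, hF₂.var rKeyStep rfl]
    have hTE₃ : TreeEnv w U n L aRankSum (s₃.set rCount i) := by
      refine hTE.congr ?_ ?_ ?_ ?_ ?_ <;> simp +decide only [State.set_var, if_false] <;>
        rw [hF₃.var _ rfl, hF₂.var _ rfl]
    rw [total_seq]
    refine (pop_spec hTE₃ (by rw [hkey₃]; exact htr) hne).mono ?_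
    rintro s₄ hF₄ ⟨hx, hmin, htr₄⟩
    rw [hkey₃] at hmin htr₄
    have hxn := htr.lt _ hx
    have hrk₄ : rankOf d s₄ = rankOf d s :=
      hrank s₄ (by rw [hF₄.arr _ rfl, State.set_arr, hF₃.arr _ rfl])
    have hta₄ : s₄.arr aTable = s₃.arr aTable := hF₄.arr _ rfl
    have han₄ : s₄.var rAnswer = s₃.var rAnswer := by
      rw [hF₄.var _ rfl]
      simp +decide
    have hE₄ : TableEnv w U n L d k S s₄ := by
      refine hE.congr (fun y hy => ?_) ?_
      · rw [← hv₃ y, hF₄.var y]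
        · interval_cases y <;> rfl
        · simp only [rCount]; omega
        · simp only [rKeyBase]; omega
        · simp only [rKeyStep]; omega
        · interval_cases y <;> rfl
        · interval_cases y <;> rfl
      · rw [hF₄.arr _ rfl, State.set_arr, hF₃.arr _ rfl, hF₂.arr _ rfl, ha₁]
    rw [total_seq]
    refine (computeCandidates_spec hE₄ hxn fun a => ?_).mono ?_
    · rw [hta₄]
      exact (hok.le a).trans_lt hi
    rintro s₅ hF₅ ⟨c₁, c₂, c₃, c₄⟩
    have hx₅ : s₅.var rBox = s₄.var rBox := hF₅.var _ rfl
    have hrk₅ : rankOf d s₅ = rankOf d s :=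
      hrank s₅ (by rw [hF₅.arr _ rfl, hF₄.arr _ rfl, State.set_arr, hF₃.arr _ rfl])
    have hta₅ : s₅.arr aTable = s₃.arr aTable := (hF₅.arr _ rfl).trans hta₄
    have hE₅ : TableEnv w U n L d k S s₅ := by
      refine hE₄.congr (fun y hy => ?_) (hF₅.arr _ rfl)
      exact hF₅.var y (by interval_cases y <;> rfl)
    refine (insertCandidates_spec hE₅ (by rwa [hx₅]) hk).mono ?_
    rintro s₆ hF₆ ⟨d₁, d₂, d₃⟩ -
    have han₆ : s₆.var rAnswer = s₅.var rAnswer := hF₆.var _ rfl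
    have htr₆ : s₆.arr aTree = s₄.arr aTree := (hF₆.arr _ rfl).trans (hF₅.arr _ rfl)
    generalize hxe : s₄.var rBox = x at *
    rw [hta₄, hrk₄] at c₁
    rw [hx₅, hrk₅] at d₂ d₃
    rw [hta₅] at d₁ d₃
    rw [han₄] at c₃ c₄
    refine ⟨A.erase x, ?_, by rwa [htr₆], fun y hy hyA z hz => ?_, ?_⟩
    · rw [Finset.card_erase_of_mem hx]
      have := Finset.card_pos.2 hne
      omega
    · by_cases hyx : y = x
      · rw [hyx]
        exact hmin z (Finset.mem_of_mem_erase hz)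
      · exact hord y hy (fun h => hyA (Finset.mem_erase.2 ⟨hyx, h⟩)) z
          (Finset.mem_of_mem_erase hz)
    · have hP : P (A.erase x) = insert ⟨x, hxn⟩ (P A) := by
        ext y
        simp only [P, Finset.mem_filter, Finset.mem_univ, true_and, Finset.mem_erase,
          Finset.mem_insert, Fin.ext_iff, not_and, ne_eq]
        constructor
        · intro h
          by_cases hyx : (y : ℕ) = x
          · exact .inl hyx
          · exact .inr (h hyx)
        · rintro (h | h)
          · exact fun h' => absurd h h'
          · exact fun _ => h
      rw [hP, han₆]
      refine hok.step hR (x := ⟨x, hxn⟩) (by simp [P, hx]) (fun e he hfit => ?_) c₁ c₂ c₃ c₄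
        d₁ d₂ d₃
      have heA : (e : ℕ) ∉ A := by simpa [P] using he
      have hle := hord e e.2 heA x hx
      -- The ranks of `x` are at most those of `e`, while the sum for `e` is at most that for `x`.
      -- So all ranks agree, and `e` fits into `x`.
      rw [hsum e e.2, hsum x hxn] at hle
      have hrk := (hR.fits _ _).1 hfit
      have heq := (Finset.sum_eq_sum_iff_of_le fun i hi => hrk i (Finset.mem_range.1 hi)).1
        (le_antisymm (Finset.sum_le_sum fun i hi => hrk i (Finset.mem_range.1 hi)) hle)
      exact (hR.fits _ _).2 fun i hi => (heq i (Finset.mem_range.2 hi)).ge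
  · intro s' _ hI
    rw [eval_var, hn₂] at hI
    obtain ⟨A, hcard, -, -, hok⟩ := hI le_rfl
    obtain rfl : A = ∅ := by
      rw [← Finset.card_eq_zero]
      omega
    have hP : P ∅ = Finset.univ := by simp [P]
    rw [hP] at hok
    exact hok.isOptimum hR

end Solve

end NestedBoxes

namespace NestedBoxes

open WordRAM WordRAM.Stmt WordRAM.Expr

/-! ### The constants of the program -/

variable {w U n d k : ℕ} {s : State}

theorem prelude_spec (hU : U < 2 ^ w) (hn : 1 ≤ n)
    (hpow : (2 * n + (d + 2)) ^ (k + 2 * d + 2) ≤ U) (hN : s.var rN = n) :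
    Total w U (prelude k d) s fun s' => ∃ L, 1 ≤ L ∧ n + 2 ≤ 2 ^ L ∧ 2 ^ L ≤ 2 * (n + 1) ∧
      s'.var rSize = 2 * n + (d + 2) ∧ s'.var rLevels = L ∧ s'.var rTree = 2 ^ L ∧
      s'.var rLevelCodes = L ^ d ∧ s'.var rCodes = n ^ k := by
  have hS : ∀ m ≤ k + 2 * d + 2, (2 * n + (d + 2)) ^ m < 2 ^ w := fun m hm =>
    ((Nat.pow_le_pow_right (by omega) hm).trans hpow).trans_lt hU
  have hS₁ := hS 1 (by omega)
  have hS₂ := hS 2 (by omega)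
  rw [pow_one] at hS₁
  have hS₂' : 4 * (n + 1) < 2 ^ w := by
    refine lt_of_le_of_lt ?_ hS₂
    rw [pow_two]
    exact Nat.mul_le_mul (by omega) (by omega)
  have hk : k < 2 ^ w := by
    refine (Nat.lt_two_pow_self (n := k)).trans_le (le_trans ?_ (hS k (by omega)).le)
    exact Nat.pow_le_pow_left (by omega) k
  have hsafe : 2 < 2 ^ w ∧ 2 * n < 2 ^ w ∧ d + 2 < 2 ^ w ∧ 1 < 2 ^ w ∧ d < 2 ^ w ∧ n + 2 < 2 ^ w := by
    omega
  unfold prelude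
  simp +decide only [total_seq, total_assign, eval_var, eval_const, eval_add, eval_mul, safe_var,
    safe_const, safe_add, safe_mul, true_and, and_true, hN, hsafe, hS₁]
  -- Either `2 ^ L` is large enough or `L` has grown in every round, so `n` rounds suffice. Doubling
  -- happens only below `n + 2`, which gives the upper bound `2 * (n + 1)`.
  refine Total.loop (fun i s' => ∃ L, 1 ≤ L ∧ s'.var rLevels = L ∧ s'.var rTree = 2 ^ L ∧
    2 ^ L ≤ 2 * (n + 1) ∧ (n + 2 ≤ 2 ^ L ∨ L = i + 1)) trivial ?_ ?_ ?_
  · exact ⟨1, le_rfl, by simp +decide, by simp +decide, by omega, .inr rfl⟩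
  · rintro i - s₁ hF ⟨L, h₁, h₂, h₃, h₄, h₅⟩
    have hn₁ : s₁.var rN = n := by
      rw [hF.var _ rfl]
      simpa +decide using hN
    have hL : L < 2 ^ L := Nat.lt_two_pow_self
    have hsafe' : 2 ^ L * 2 < 2 ^ w ∧ L + 1 < 2 ^ w := by omega
    simp +decide only [total_ifLt, total_seq, total_assign, total_skip, eval_var, eval_const,
      eval_add, eval_mul, safe_var, safe_const, safe_add, safe_mul, true_and, and_true,
      State.set_var, if_true, if_false, hn₁, h₂, h₃, hsafe, hsafe']
    refine ⟨fun h => ⟨L + 1, by omega, rfl, by rw [pow_succ], by rw [pow_succ]; omega, ?_⟩,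
      fun h => ⟨L, h₁, rfl, rfl, h₄, .inl (not_lt.1 h)⟩⟩
    rcases h₅ with h₅ | h₅
    · omega
    · exact .inr (by omega)
  · rintro s₁ hF ⟨L, h₁, h₂, h₃, h₄, h₅⟩
    simp +decide only [eval_var, State.set_var, if_false, hN] at h₅
    have h₆ : n + 2 ≤ 2 ^ L := by
      rcases h₅ with h₅ | h₅
      · exact h₅
      · rw [h₅]
        have := Nat.lt_two_pow_self (n := n)
        rw [pow_succ]
        omega
    have hn₁ : s₁.var rN = n := by
      rw [hF.var _ rfl]
      simpa +decide using hN
    have hsz₁ : s₁.var rSize = 2 * n + (d + 2) := by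
      rw [hF.var _ rfl]
      simp +decide
    have hLS : L ≤ 2 * n + (d + 2) := by
      have : L < 2 ^ L := Nat.lt_two_pow_self
      omega
    refine Total.loop (fun i s' => s'.var rLevelCodes = L ^ i) (by exact hsafe.2.2.2.2.1) ?_ ?_ ?_
    · simp
    · intro i hi s₂ hF₂ hI
      rw [eval_const] at hi
      have hL₂ : s₂.var rLevels = L := by
        rw [hF₂.var _ rfl]
        simpa +decide using h₂
      have hlt : L ^ i * L < 2 ^ w := by
        rw [← pow_succ]
        exact (Nat.pow_le_pow_left hLS _).trans_lt (hS _ (by omega))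
      simp +decide only [total_assign, eval_var, eval_mul, safe_var, safe_mul, true_and,
        State.set_var, if_true, if_false, hI, hL₂, hlt, pow_succ]
    · intro s₂ hF₂ hI
      have hn₂ : s₂.var rN = n := by
        rw [hF₂.var _ rfl]
        simpa +decide using hn₁
      refine Total.loop (fun i s' => s'.var rCodes = n ^ i) (by exact hk) ?_ ?_ ?_
      · simp
      · intro i hi s₃ hF₃ hI₃
        rw [eval_const] at hi
        have hn₃ : s₃.var rN = n := by
          rw [hF₃.var _ rfl]
          simpa +decide using hn₂
        have hlt : n ^ i * n < 2 ^ w := by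
          rw [← pow_succ]
          exact (Nat.pow_le_pow_left (by omega) _).trans_lt (hS (i + 1) (by omega))
        simp +decide only [total_assign, eval_var, eval_mul, safe_var, safe_mul, true_and,
          State.set_var, if_true, if_false, hI₃, hn₃, hlt, pow_succ]
      · intro s₃ hF₃ hI₃
        refine ⟨L, h₁, h₆, h₄, ?_, ?_, ?_, ?_, hI₃⟩
        · rw [hF₃.var _ rfl]
          simp +decide only [State.set_var, if_false]
          rw [hF₂.var _ rfl]
          simpa +decide using hsz₁
        · rw [hF₃.var _ rfl]
          simp +decide only [State.set_var, if_false]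
          rw [hF₂.var _ rfl]
          simpa +decide using h₂
        · rw [hF₃.var _ rfl]
          simp +decide only [State.set_var, if_false]
          rw [hF₂.var _ rfl]
          simpa +decide using h₃
        · rw [hF₃.var _ rfl]
          simp +decide only [State.set_var, if_false]
          exact hI

/-- The whole program, except that the answer is not yet in the right place. -/
theorem main_spec {B : Fin n → Fin d → ℕ} (hU : U < 2 ^ w) (hn : 1 ≤ n)
    (hpow : (2 * n + (d + 2)) ^ (k + 2 * d + 2) ≤ U) (hN : s.var rN = n)
    (hans : s.var rAnswer = 0)
    (hB : ∀ x : Fin n, ∀ i : Fin d, s.arr aInput (x * d + i) = B x i)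
    (hzero : ∀ g, g ≠ aInput → ∀ a, s.arr g a = 0) :
    Total w U (prelude k d) s fun s₁ =>
      (∃ L, 1 ≤ L ∧ 2 ^ L ≤ 2 * (n + 1) ∧ s₁.var rN = n ∧ s₁.var rLevels = L ∧
        s₁.var rLevelCodes = L ^ d ∧ s₁.var rCodes = n ^ k) ∧
      Total w U (body k d) s₁ fun s' => IsOptimum (k + 1) B (s'.var rAnswer) := by
  refine (prelude_spec hU hn hpow hN).mono ?_
  rintro s₁ hF ⟨L, h₁, h₂, h₃, h₄, h₅, h₆, h₇, h₈⟩
  have hn₁ : s₁.var rN = n := (hF.var _ rfl).trans hN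
  refine ⟨⟨L, h₁, h₃, hn₁, h₅, h₇, h₈⟩, ?_⟩
  have ha₁ : s₁.arr = s.arr := funext fun g => hF.arr g rfl
  have hS : ∀ m ≤ k + 2 * d + 2, (2 * n + (d + 2)) ^ m ≤ U := fun m hm =>
    (Nat.pow_le_pow_right (by omega) hm).trans hpow
  have hS₁ := hS 1 (by omega)
  have hS₂ := hS 2 (by omega)
  rw [pow_one] at hS₁
  have hLU : 2 ^ (L + 1) ≤ U := by
    refine le_trans ?_ hS₂
    rw [pow_succ, pow_two]
    calc 2 ^ L * 2 ≤ 2 * (n + 1) * 2 := Nat.mul_le_mul_right _ h₃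
      _ ≤ _ := Nat.mul_le_mul (by omega) (by omega)
  have hdU : n * d + n ≤ U := by
    refine le_trans ?_ hS₂
    rw [pow_two]
    calc n * d + n = n * (d + 1) := by ring
      _ ≤ _ := Nat.mul_le_mul (by omega) (by omega)
  have hk : k + 1 < 2 ^ w := by
    refine lt_of_lt_of_le ?_ ((hS (k + 1) (by omega)).trans hU.le)
    exact (Nat.lt_two_pow_self (n := k + 1)).trans_le (Nat.pow_le_pow_left (by omega) _)
  have hLS : L ≤ 2 * n + (d + 2) := by
    have : L < 2 ^ L := Nat.lt_two_pow_self
    omega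
  unfold body
  rw [total_seq]
  refine (ranks_spec (n := n) (L := L) (b := fun x i => s₁.arr aInput (x * d + i)) hU hLU
    (by omega) hn hdU hn₁ h₅ h₆ (by omega) (fun _ _ _ _ => rfl) (fun x _ => ?_) ?_).mono ?_
  · rw [ha₁, hzero _ (by decide)]
  · refine ⟨fun q _ _ => ?_, fun q => ?_⟩ <;> rw [ha₁, hzero _ (by decide)]
    omega
  rintro s₂ hF₂ ⟨hR, htree⟩
  refine solve_spec (n := n) (L := L) (S := 2 * n + (d + 2))
    ⟨hU, ?_, ?_, ?_, ?_, ?_, hn, h₁, hLS, by omega, hpow, by omega, by omega, hR.le⟩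
    ⟨fun x y => ?_, hR.le, by omega, by omega, h₁, hLS⟩ hLU ?_ hk (by omega) hR.sum htree
    (fun a => ?_) ?_
  · rw [hF₂.var _ rfl, hn₁]
  · rw [hF₂.var _ rfl, h₄]
  · rw [hF₂.var _ rfl, h₅]
  · rw [hF₂.var _ rfl, h₇]
  · rw [hF₂.var _ rfl, h₈]
  · constructor
    · intro h i hi
      rw [rankOf, rankOf, hR.iff x x.2 y y.2 i hi, ha₁]
      have := h ⟨i, hi⟩
      rwa [← hB, ← hB] at this
    · intro h i
      have := (hR.iff x x.2 y y.2 i i.2).1 (h i i.2)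
      rw [ha₁] at this
      rwa [← hB, ← hB]
  · rw [hF₂.var _ rfl, h₆]
  · rw [hF₂.arr _ rfl, ha₁, hzero _ (by decide)]
  · rw [hF₂.var _ rfl, hF.var _ rfl, hans]

/-! ### The running time of the program -/

/-- The variables that bound the number of iterations of the loops are positive. -/
def BoundsPos (v : ℕ → ℕ) : Prop := 1 ≤ v rN ∧ 1 ≤ v rLevels ∧ 1 ≤ v rLevelCodes ∧ 1 ≤ v rCodes

/-- The running time is `O(m)`, where `m` depends on the variables. -/
def TimeLe (c : Stmt) (m : (ℕ → ℕ) → ℕ) : Prop :=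
  ∃ C, ∀ v, BoundsPos v → c.time v ≤ C * m v

/-- For code whose loops have constant bounds, the first hypothesis holds by `rfl`. -/
theorem TimeLe.of_const {c : Stmt} {m : (ℕ → ℕ) → ℕ} (h : ∀ v, c.time v = c.time 0)
    (hm : ∀ v, BoundsPos v → 1 ≤ m v) : TimeLe c m :=
  ⟨c.time 0, fun v hv => by rw [h]; exact Nat.le_mul_of_pos_right _ (hm v hv)⟩

theorem TimeLe.mono {c : Stmt} {m m' : (ℕ → ℕ) → ℕ} (h : TimeLe c m)
    (hm : ∀ v, BoundsPos v → m v ≤ m' v) : TimeLe c m' := by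
  obtain ⟨C, hC⟩ := h
  exact ⟨C, fun v hv => (hC v hv).trans (Nat.mul_le_mul_left _ (hm v hv))⟩

theorem TimeLe.seq {c c' : Stmt} {m : (ℕ → ℕ) → ℕ} (h : TimeLe c m) (h' : TimeLe c' m) :
    TimeLe (c ;; c') m := by
  obtain ⟨C, hC⟩ := h
  obtain ⟨C', hC'⟩ := h'
  exact ⟨C + C', fun v hv => by
    rw [add_mul]
    exact add_le_add (hC v hv) (hC' v hv)⟩

/-- The lower bounds on `m` and `m'` absorb the constant overhead per iteration and per loop. -/
theorem TimeLe.loop {x : ℕ} {e : Expr} {c : Stmt} {m m' : (ℕ → ℕ) → ℕ} (h : TimeLe c m)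
    (hm : ∀ v, BoundsPos v → e.bound v * m v ≤ m' v) (hm₁ : ∀ v, BoundsPos v → 1 ≤ m v)
    (hm' : ∀ v, BoundsPos v → 1 ≤ m' v) : TimeLe (Stmt.loop x e c) m' := by
  obtain ⟨C, hC⟩ := h
  refine ⟨C + 5 + (e.len + 3), fun v hv => ?_⟩
  have h₁ : e.bound v * (c.time v + 5) ≤ (C + 5) * m' v := by
    calc e.bound v * (c.time v + 5) ≤ e.bound v * ((C + 5) * m v) := by
          refine Nat.mul_le_mul_left _ ?_
          rw [add_mul]
          exact add_le_add (hC v hv) (Nat.le_mul_of_pos_right _ (hm₁ v hv))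
      _ = (C + 5) * (e.bound v * m v) := by ring
      _ ≤ _ := Nat.mul_le_mul_left _ (hm v hv)
  have h₂ : e.len + 3 ≤ (e.len + 3) * m' v := Nat.le_mul_of_pos_right _ (hm' v hv)
  rw [add_mul (C + 5)]
  simp only [time]
  omega

/-- A number of steps that suffices for the program, up to a constant factor. -/
def totalTime (v : ℕ → ℕ) : ℕ := v rN * v rCodes * v rLevelCodes * v rLevels

theorem mul_one_le {a b : ℕ} (ha : 1 ≤ a) (hb : 1 ≤ b) : 1 ≤ a * b := Nat.mul_pos ha hb

theorem setLeaf_time (g : ℕ) (e : Expr) : TimeLe (setLeaf g e) fun v => v rLevels := by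
  refine .seq (.of_const (fun _ => rfl) fun v hv => hv.2.1) (.seq (.of_const (fun _ => rfl)
    fun v hv => hv.2.1) (.loop (m := fun _ => 1) (.of_const (fun _ => rfl) fun _ _ => le_rfl)
    (fun v _ => (mul_one _).le) (fun _ _ => le_rfl) fun v hv => hv.2.1))

theorem fill_time (g : ℕ) : TimeLe (fill g) fun v => v rN * v rLevels :=
  .loop (setLeaf_time g _) (fun _ _ => le_rfl) (fun _ hv => hv.2.1)
    fun _ hv => mul_one_le hv.1 hv.2.1

theorem pop_time (g : ℕ) : TimeLe (pop g) fun v => v rLevels :=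
  .seq (.of_const (fun _ => rfl) fun _ hv => hv.2.1) (setLeaf_time g _)

theorem TimeLe.constLoop {x d : ℕ} {c : Stmt} {m : (ℕ → ℕ) → ℕ} (h : TimeLe c m)
    (hm : ∀ v, BoundsPos v → 1 ≤ m v) : TimeLe (Stmt.loop x (Expr.const d) c) m := by
  obtain ⟨C, hC⟩ := h
  refine ⟨d * (C + 5) + 4, fun v hv => ?_⟩
  have h₁ : d * (c.time v + 5) ≤ d * (C + 5) * m v := by
    rw [mul_assoc]
    refine Nat.mul_le_mul_left _ ?_
    rw [add_mul]
    exact add_le_add (hC v hv) (Nat.le_mul_of_pos_right _ (hm v hv))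
  have h₂ := hm v hv
  rw [add_mul]
  simp only [time, Expr.len, Expr.bound]
  omega

theorem ranks_time (d : ℕ) : TimeLe (ranks d) fun v => v rN * v rLevels := by
  have hpos : ∀ v, BoundsPos v → 1 ≤ v rN * v rLevels := fun v hv => mul_one_le hv.1 hv.2.1
  refine .constLoop (.seq (.of_const (fun _ => rfl) hpos) (.seq (.of_const (fun _ => rfl) hpos)
    (.seq (fill_time _) (.seq (.of_const (fun _ => rfl) hpos) (.seq (.of_const (fun _ => rfl) hpos)
    (.loop (m := fun v => v rLevels) ?_ (fun _ _ => le_rfl) (fun _ hv => hv.2.1) hpos)))))) hpos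
  exact .seq (pop_time _) (.of_const (fun _ => rfl) fun _ hv => hv.2.1)

theorem query_time (d : ℕ) : TimeLe (query d) fun v => v rLevelCodes :=
  .seq (.of_const (fun _ => rfl) fun _ hv => hv.2.2.1) (.loop (m := fun _ => 1)
    (.of_const (fun _ => rfl) fun _ _ => le_rfl) (fun _ _ => (mul_one _).le) (fun _ _ => le_rfl)
    fun _ hv => hv.2.2.1)

theorem update_time (d : ℕ) : TimeLe (update d) fun v => v rLevelCodes :=
  .loop (m := fun _ => 1) (.of_const (fun _ => rfl) fun _ _ => le_rfl) (fun _ _ => (mul_one _).le)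
    (fun _ _ => le_rfl) fun _ hv => hv.2.2.1

theorem computeCandidates_time (d : ℕ) :
    TimeLe (computeCandidates d) fun v => v rCodes * v rLevelCodes := by
  have hpos : ∀ v, BoundsPos v → 1 ≤ v rLevelCodes := fun v hv => hv.2.2.1
  exact .loop (.seq (.of_const (fun _ => rfl) hpos) (.seq (.of_const (fun _ => rfl) hpos)
    (.seq (query_time d) (.of_const (fun _ => rfl) hpos)))) (fun _ _ => le_rfl) hpos
    fun v hv => mul_one_le hv.2.2.2 hv.2.2.1

theorem insertCandidates_time (k d : ℕ) :
    TimeLe (insertCandidates k d) fun v => v rCodes * v rLevelCodes := by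
  have hpos : ∀ v, BoundsPos v → 1 ≤ v rLevelCodes := fun v hv => hv.2.2.1
  exact .loop (.seq (.of_const (fun _ => rfl) hpos) (.seq (.of_const (fun _ => rfl) hpos)
    (.constLoop (.seq (.of_const (fun _ => rfl) hpos) (.seq (.of_const (fun _ => rfl) hpos)
    (.seq (update_time d) (.of_const (fun _ => rfl) hpos)))) hpos))) (fun _ _ => le_rfl) hpos
    fun v hv => mul_one_le hv.2.2.2 hv.2.2.1

/-- Per box, the table takes time `rCodes * rLevelCodes` and the tree `rLevels`; bounding their sum
by the product costs only one more logarithm. -/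
theorem body_time (k d : ℕ) : TimeLe (body k d) totalTime := by
  have hpos : ∀ v, BoundsPos v → 1 ≤ totalTime v := fun v hv =>
    mul_one_le (mul_one_le (mul_one_le hv.1 hv.2.2.2) hv.2.2.1) hv.2.1
  have hle : ∀ v, BoundsPos v → v rN * v rLevels ≤ totalTime v := by
    intro v hv
    rw [totalTime, mul_assoc (v rN)]
    exact Nat.mul_le_mul_right _ (Nat.le_mul_of_pos_right _ (mul_one_le hv.2.2.2 hv.2.2.1))
  refine .seq ((ranks_time d).mono hle) (.seq (.of_const (fun _ => rfl) hpos)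
    (.seq (.of_const (fun _ => rfl) hpos) (.seq ((fill_time _).mono hle)
    (.loop (m := fun v => v rCodes * v rLevelCodes * v rLevels) ?_ (fun v _ => ?_) ?_ hpos))))
  · refine .seq ((pop_time _).mono fun v hv => ?_) (.seq
      ((computeCandidates_time d).mono fun v hv => ?_)
      ((insertCandidates_time k d).mono fun v hv => ?_))
    · exact Nat.le_mul_of_pos_left _ (mul_one_le hv.2.2.2 hv.2.2.1)
    · exact Nat.le_mul_of_pos_right _ hv.2.1
    · exact Nat.le_mul_of_pos_right _ hv.2.1
  · simp only [totalTime, Expr.bound, mul_assoc, le_refl]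
  · exact fun v hv => mul_one_le (mul_one_le hv.2.2.2 hv.2.2.1) hv.2.1

theorem prelude_time (k d : ℕ) : TimeLe (prelude k d) fun v => v rN := by
  have hpos : ∀ v, BoundsPos v → 1 ≤ v rN := fun v hv => hv.1
  exact .seq (.of_const (fun _ => rfl) hpos) (.seq (.of_const (fun _ => rfl) hpos)
    (.seq (.of_const (fun _ => rfl) hpos) (.seq (.loop (m := fun _ => 1)
    (.of_const (fun _ => rfl) fun _ _ => le_rfl) (fun v _ => (mul_one _).le) (fun _ _ => le_rfl)
    hpos) (.of_const (fun _ => rfl) hpos))))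

end NestedBoxes

namespace NestedBoxes

open WordRAM WordRAM.Stmt WordRAM.Expr

/-! ### The machine program -/

/-- The whole algorithm for `k + 1` piles in dimension `d`. -/
def algorithm (k d : ℕ) : Stmt := prelude k d ;; body k d ;; assign rN (var rAnswer)

/-- Compute the length of the arrays, i.e. an eighth of the size of the memory. -/
def setup : List Instr := [.const 32 1, .op .sub 31 31 32, .const 32 8, .op .div 31 31 32]

/-- The program for `k + 1` piles in dimension `d`. -/
def program (k d : ℕ) : Program := setup ++ (algorithm k d).code 31 4 32

/-- The state that the input represents. -/
def inputState {n d : ℕ} (B : Fin n → Fin d → ℕ) : State where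
  var x := if x = rN then n else 0
  arr g a := if g = aInput then (input B).mem a else 0

variable {w n d k : ℕ}

/-- The word size is not known to the program, but `0 - 1` wraps around to `2 ^ w - 1`. An eighth of
this is a length for which all eight arrays fit into memory. -/
theorem setup_steps (hw : 8 < 2 ^ w) (B : Fin n → Fin d → ℕ) :
    ∃ σ, Steps (program k d) w (input B) 4 σ ∧ σ.pc = 4 ∧ σ.reg 31 = (2 ^ w - 1) / 8 ∧
      (∀ r < 31, σ.reg r = (input B).reg r) ∧ σ.mem = (input B).mem := by
  have h : CodeAt (program k d) 0 setup := ⟨[], (algorithm k d).code 31 4 32, rfl, rfl⟩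
  refine ⟨_, (h.steps rfl).trans ((h.tail.steps rfl).trans ((h.tail.tail.steps rfl).trans
    (h.tail.tail.tail.steps rfl))), rfl, ?_, fun r hr => ?_, rfl⟩
  · have h₁ : 1 % 2 ^ w = 1 := Nat.mod_eq_of_lt (by omega)
    have h₂ : (2 ^ w - 1) % 2 ^ w = 2 ^ w - 1 := Nat.mod_eq_of_lt (by omega)
    have h₃ : (2 ^ w - 1) / 8 % 2 ^ w = (2 ^ w - 1) / 8 := Nat.mod_eq_of_lt (by omega)
    simp [exec, BinOp.eval, input, h₁, h₂, h₃, Nat.mod_eq_of_lt hw]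
  · have h₁ : r ≠ 31 := by omega
    have h₂ : r ≠ 32 := by omega
    simp [exec, h₁, h₂]

theorem input_mem_mul_add (B : Fin n → Fin d → ℕ) (x : Fin n) (i : Fin d) :
    (input B).mem (x * d + i) = B x i := by
  have hlt : (x : ℕ) * d + i < n * d := by
    calc (x : ℕ) * d + i < x * d + d := by omega
      _ = (x + 1) * d := by ring
      _ ≤ n * d := Nat.mul_le_mul_right _ x.2
  simp only [input, hlt, dif_pos]
  congr 1
  · ext
    simp [Fin.divNat, Nat.mul_add_div i.pos, Nat.div_eq_of_lt i.2, mul_comm (x : ℕ) d]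
  · ext
    simp [Fin.modNat, Nat.mod_eq_of_lt i.2]

theorem input_mem_lt {B : Fin n → Fin d → ℕ} (hB : ∀ x i, B x i < 2 ^ w) (a : ℕ) :
    (input B).mem a < 2 ^ w := by
  simp only [input]
  split
  · exact hB _ _
  · positivity

/-- Every array but the first starts at or after address `U ≥ n * d`, beyond the input. So the
table, the tree and the rank sums start as zero without any work. -/
theorem rep_inputState {U : ℕ} {B : Fin n → Fin d → ℕ} {σ : Config} (hn : n < 2 ^ w)
    (hU : n * d ≤ U) (hB : ∀ x i, B x i < 2 ^ w) (hlen : σ.reg 31 = U)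
    (hreg : ∀ r < 31, σ.reg r = (input B).reg r) (hmem : σ.mem = (input B).mem) :
    Rep w 31 U (inputState B) σ where
  var := hreg
  len := hlen
  arr g _ i _ := by
    by_cases hg : g = 0
    · simp [hmem, inputState, hg]
    · have : ¬ g * U + i < n * d := by
        have := Nat.le_mul_of_pos_left U (Nat.pos_of_ne_zero hg)
        omega
      simp [hmem, inputState, hg, input, this]
  var_lt x _ := by
    simp only [inputState]
    split <;> omega
  arr_lt g _ i _ := by
    simp only [inputState]
    split
    · exact input_mem_lt hB _
    · positivity

/-! ### The running time in terms of the number of boxes -/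

theorem wordSize_bound {e : ℕ} (hw : ((d + 5) * e + 4) * (Nat.log 2 n + 1) ≤ w) :
    8 * (2 * n + (d + 2)) ^ e < 2 ^ w := by
  set m := Nat.log 2 n + 1 with hm
  have h₁ : n < 2 ^ m := Nat.lt_pow_succ_log_self (by norm_num) n
  have h₂ : d + 2 < 2 ^ (d + 2) := Nat.lt_two_pow_self
  have h₃ : 2 * n + (d + 2) ≤ 2 ^ ((d + 5) * m) := by
    calc 2 * n + (d + 2) ≤ 2 * 2 ^ m + 2 ^ (d + 2) := by omega
      _ = 2 ^ (m + 1) + 2 ^ (d + 2) := by ring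
      _ ≤ 2 ^ (m + 1) * 2 ^ (d + 2) := by
          refine Nat.add_le_mul ?_ ?_
          · exact (pow_one 2).symm.trans_le (Nat.pow_le_pow_right (by norm_num) (by omega))
          · exact (pow_one 2).symm.trans_le (Nat.pow_le_pow_right (by norm_num) (by omega))
      _ = 2 ^ (m + 1 + (d + 2)) := (pow_add _ _ _).symm
      -- As `1 ≤ m`, the exponent `m + d + 3` is at most `(d + 5) * m`.
      _ ≤ _ := Nat.pow_le_pow_right (by norm_num) (by nlinarith)
  calc 8 * (2 * n + (d + 2)) ^ e ≤ 8 * (2 ^ ((d + 5) * m)) ^ e :=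
        Nat.mul_le_mul_left _ (Nat.pow_le_pow_left h₃ e)
    _ < 2 ^ 4 * (2 ^ ((d + 5) * m)) ^ e := Nat.mul_lt_mul_of_pos_right (by norm_num) (by positivity)
    _ = 2 ^ (4 + (d + 5) * m * e) := by rw [← pow_mul, ← pow_add]
    _ ≤ 2 ^ w := Nat.pow_le_pow_right (by norm_num) (le_trans (by nlinarith) hw)

theorem levels_pow_le (d : ℕ) : ∃ C : ℝ, 0 ≤ C ∧ ∀ n L : ℕ, 1 ≤ n → 2 ^ L ≤ 2 * (n + 1) →
    (L : ℝ) ^ (d + 1) ≤ C * (n : ℝ) ^ (1 / 2 : ℝ) := by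
  -- Chosen so that the power `d + 1` of `n ^ δ` is `n ^ (1 / 2)`.
  set δ : ℝ := 1 / (2 * (d + 1)) with hδ
  have hδ₀ : 0 < δ := by positivity
  refine ⟨(2 + 2 / δ) ^ (d + 1), by positivity, fun n L hn hL => ?_⟩
  have hn₁ : (1 : ℝ) ≤ n := by exact_mod_cast hn
  have hL₁ : (2 : ℝ) ^ L ≤ 2 ^ 2 * n := by
    have : 2 ^ L ≤ 2 ^ 2 * n := by omega
    exact_mod_cast this
  have hlog : (L : ℝ) * Real.log 2 ≤ 2 * Real.log 2 + Real.log n := by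
    have := Real.log_le_log (by positivity) hL₁
    rwa [Real.log_mul (by positivity) (by positivity), Real.log_pow, Real.log_pow] at this
  have hlog₂ := Real.log_two_gt_d9
  have hlogn : 0 ≤ Real.log n := Real.log_nonneg hn₁
  -- Division of `hlog` by `log 2`, which exceeds `1 / 2`.
  have hL₂ : (L : ℝ) ≤ 2 + 2 * Real.log n := by nlinarith
  have hpow : (1 : ℝ) ≤ (n : ℝ) ^ δ := Real.one_le_rpow hn₁ hδ₀.le
  have hL₃ : (L : ℝ) ≤ (2 + 2 / δ) * (n : ℝ) ^ δ := by
    have h := Real.log_le_rpow_div (Nat.cast_nonneg n) hδ₀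
    calc (L : ℝ) ≤ 2 + 2 * Real.log n := hL₂
      _ ≤ 2 * (n : ℝ) ^ δ + 2 * ((n : ℝ) ^ δ / δ) := by linarith
      _ = _ := by ring
  calc (L : ℝ) ^ (d + 1) ≤ ((2 + 2 / δ) * (n : ℝ) ^ δ) ^ (d + 1) :=
        pow_le_pow_left₀ (Nat.cast_nonneg _) hL₃ _
    _ = _ := by
      rw [mul_pow, ← Real.rpow_natCast ((n : ℝ) ^ δ), ← Real.rpow_mul (Nat.cast_nonneg _)]
      congr 2
      rw [hδ]
      push_cast
      field_simp

/-- The program is correct, with a bound on the running time in terms of the number `L` of levels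
of the tables. -/
theorem program_spec (k d : ℕ) : ∃ C : ℕ, ∀ n w : ℕ, 1 ≤ n →
    ((d + 5) * (k + 2 * d + 2) + 4) * (Nat.log 2 n + 1) ≤ w →
    ∀ B : Fin n → Fin d → ℕ, (∀ i j, B i j < 2 ^ w) →
      ∃ t m L : ℕ, 2 ^ L ≤ 2 * (n + 1) ∧ t ≤ C * (n ^ (k + 1) * L ^ (d + 1)) ∧
        HaltsWith (program k d) w (input B) t m ∧ IsOptimum (k + 1) B m := by
  obtain ⟨C₁, hC₁⟩ := prelude_time k d
  obtain ⟨C₂, hC₂⟩ := body_time k d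
  refine ⟨C₁ + C₂ + 6, fun n w hn hw B hB => ?_⟩
  have hS := wordSize_bound hw
  set U := (2 ^ w - 1) / 8 with hUdef
  have hU : 8 * U < 2 ^ w := by
    have : 0 < 2 ^ w := by positivity
    omega
  have hSU : (2 * n + (d + 2)) ^ (k + 2 * d + 2) ≤ U := by omega
  have hS₂ : (2 * n + (d + 2)) ^ 2 ≤ U :=
    (Nat.pow_le_pow_right (by omega) (by omega)).trans hSU
  have hnd : n * d ≤ U := by
    refine le_trans ?_ hS₂
    rw [pow_two]
    exact Nat.mul_le_mul (by omega) (by omega)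
  have hnU : n < U := by
    refine lt_of_lt_of_le ?_ hS₂
    rw [pow_two]
    nlinarith
  obtain ⟨σ, hσ, hpc, hlen, hreg, hmem⟩ := setup_steps (k := k) (w := w) (by omega) B
  have hrep := rep_inputState (by omega) hnd hB hlen hreg hmem
  obtain ⟨t₁, s₁, hE₁, ⟨L, hL, hL₂, hN, hlev, hlc, hc⟩, t₂, s₂, hE₂, hopt⟩ :=
    main_spec (s := inputState B) (w := w) (by omega) hn hSU rfl rfl (input_mem_mul_add B)
      fun g hg a => if_neg hg
  have hE : (algorithm k d).Exec w U (inputState B) (t₁ + (t₂ + 2)) (s₂.set rN (s₂.var rAnswer)) :=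
    hE₁.seq (hE₂.seq (.assign _ _ _ trivial))
  have hcode : CodeAt (program k d) 4 ((algorithm k d).code 31 4 32) :=
    ⟨setup, [], by simp [program], rfl⟩
  obtain ⟨σ', hσ', hpc', hrep', -⟩ := hE.simulates hU rfl (by norm_num) hcode hpc hrep
  have hsteps := hσ.trans hσ'
  refine ⟨4 + (t₁ + (t₂ + 2)), s₂.var rAnswer, L, hL₂, ?_, ⟨?_, ?_⟩, hopt⟩
  · have ht₁ : t₁ ≤ C₁ * n := by
      refine ((hE₁.le_time (K := fun x => x == rN) (v := fun x => if x = rN then n else 1) rfl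
        fun x hx => ?_).1).trans (hC₁ _ ⟨hn, le_rfl, le_rfl, le_rfl⟩)
      rw [eq_of_beq hx]
      rfl
    have ht₂ : t₂ ≤ C₂ * (n ^ (k + 1) * L ^ (d + 1)) := by
      -- From now on all four loop bounds are fixed, so `v` can be the variables of the state after
      -- the prelude.
      refine ((hE₂.le_time (K := fun x => x == rN || x == rLevels || x == rLevelCodes || x == rCodes)
        rfl fun x _ => rfl).1).trans ((hC₂ _ ⟨?_, ?_, ?_, ?_⟩).trans_eq ?_)
      · omega
      · omega
      · rw [hlc]; exact Nat.one_le_pow _ _ hL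
      · rw [hc]; exact Nat.one_le_pow _ _ hn
      · rw [totalTime, hN, hlev, hlc, hc]
        ring
    have h₁ : n ≤ n ^ (k + 1) * L ^ (d + 1) :=
      (Nat.le_self_pow (by omega) n).trans (Nat.le_mul_of_pos_right _ (Nat.one_le_pow _ _ hL))
    have h₂ := Nat.mul_le_mul_left C₁ h₁
    rw [add_mul, add_mul]
    omega
  · rw [hsteps, Halted, hpc']
    simp [program, Stmt.length_code, setup]
    omega
  · rw [hsteps, hrep'.var 0 (by norm_num)]
    simp

end NestedBoxes

/-- For every number `k ≥ 1` of piles there is `ε > 0` such that, in every fixed dimension `d`,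
multiple nested boxes with `k` piles is solved in time `O(n ^ (k + 1 - ε))` on the word RAM with
words of `w ≥ c * (⌊log₂ n⌋ + 1)` bits, the sizes of the boxes being words. -/
theorem mainTheorem12 (k : ℕ) (hk : 1 ≤ k) :
    ∃ ε : ℝ, 0 < ε ∧ ∀ d : ℕ, ∃ (P : WordRAM.Program) (c : ℕ) (C : ℝ),
      ∀ n w : ℕ, 1 ≤ n → c * (Nat.log 2 n + 1) ≤ w →
        ∀ B : Fin n → Fin d → ℕ, (∀ i j, B i j < 2 ^ w) →
          ∃ t m : ℕ, (t : ℝ) ≤ C * (n : ℝ) ^ ((k : ℝ) + 1 - ε) ∧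
            WordRAM.HaltsWith P w (NestedBoxes.input B) t m ∧ NestedBoxes.IsOptimum k B m := by
  obtain ⟨k, rfl⟩ := Nat.exists_eq_add_of_le' hk
  -- The running time is at most a constant times `n ^ (k + 1) * L ^ (d + 1)` for `k + 1` piles, a
  -- factor `n` below the trivial exponent up to logarithms. Half of this factor is spent on the
  -- power of `L`.
  refine ⟨1 / 2, by norm_num, fun d => ?_⟩
  obtain ⟨C, hC⟩ := NestedBoxes.program_spec k d
  obtain ⟨C', hC'₀, hC'⟩ := NestedBoxes.levels_pow_le d
  refine ⟨NestedBoxes.program k d, (d + 5) * (k + 2 * d + 2) + 4, C * C', fun n w hn hw B hB => ?_⟩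
  obtain ⟨t, m, L, hL, ht, hhalts, hopt⟩ := hC n w hn hw B hB
  refine ⟨t, m, ?_, hhalts, hopt⟩
  have hn₀ : (0 : ℝ) < n := by exact_mod_cast hn
  calc (t : ℝ) ≤ C * ((n : ℝ) ^ (k + 1) * (L : ℝ) ^ (d + 1)) := by exact_mod_cast ht
    _ ≤ C * ((n : ℝ) ^ (k + 1) * (C' * (n : ℝ) ^ (1 / 2 : ℝ))) := by
        gcongr
        exact hC' n L hn hL
    _ = C * C' * ((n : ℝ) ^ (k + 1) * (n : ℝ) ^ (1 / 2 : ℝ)) := by ring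
    _ = _ := by
        rw [← Real.rpow_natCast, ← Real.rpow_add hn₀]
        congr 2
        push_cast
        ring
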